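/- Let $\Bbbk$ be a field, let $\mathscr M=\{\mathscr M(n)\}_{n\ge 1}$ be a collection of sets, and let $\mathscr F_{\mathscr M}$ be the free shuffle operad over $\Bbbk$ generated by $\mathscr M$. It has a basis of tree monomials: rooted trees with $n$ bijectively labelled leaves, whose internal vertices with $r\ge1$ inputs are decorated by elements of $\mathscr M(r)$, in their canonical planar representation (the inputs of each vertex are ordered by the smallest leaves reachable through them). The degenerate tree (one leaf, no vertices) is the unit. Composition is given by grafting. A divisor of a tree monomial $T$ is a non-empty connected set $S$ of internal vertices of $T$, taken together with all their incoming and outgoing edges. It determines a tree monomial: the subtree with vertices $S$ inherits the decorations, each of its leaves is labelled by the smallest leaf of $T$ reachable through it, and these labels are then replaced by $1,\dots,m$ in the order-preserving way. Let $\mathscr G$ be a set of tree monomials with leaves labelled by $1,\dots,n$ ($n$ arbitrary), none of them the degenerate tree, and let $\mathscr O=\mathscr F_{\mathscr M}/(\mathscr G)$ be the quotient by the operadic ideal generated by $\mathscr G$, regarded as a dg operad concentrated in degree $0$ with zero differential. For a tree monomial $T$ let $S_1,\dots,S_q$ be the divisors of $T$ whose tree monomial belongs to $\mathscr G$. Put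 $\mathscr A_{\mathscr G}(T)=\Bbbk T\otimes\Lambda(S_1,\dots,S_q)$, where each $S_i$ has degree $1$, with the differential $d=\sum_{i=1}^q\partial_i$, where $\partial_i$ is the derivation of degree $-1$ of the exterior algebra with $\partial_i(S_j)=\delta_{ij}$. Let $\mathscr A_{\mathscr G}$ be the direct sum of the complexes $\mathscr A_{\mathscr G}(T)$ over all tree monomials $T$, with the shuffle compositions which compose the underlying tree monomials and take the wedge product of the symbols of the divisors, where divisors of the factors are regarded as divisors of the composite. **Theorem.** $(\mathscr A_{\mathscr G},d)$ is a dg shuffle operad, and it is a free resolution of $\mathscr O$. That is, the underlying graded shuffle operad of $\mathscr A_{\mathscr G}$ is free (freely generated by some graded subcollection), and there is a morphism of dg shuffle operads $\mathscr A_{\mathscr G}\to\mathscr O$, sending $T\otimes 1$ to the class of $T$ for each tree monomial $T$, which is a quasi-isomorphism. -/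

import Mathlib

open scoped DirectSum

universe u v w w'

namespace ShuffleOperad

/-! ## Graded and differential graded shuffle operads -/

/-- Non-empty finite ordered sets, realised as the non-empty finite subsets of `ℕ`. Between two of
them there is at most one order-preserving bijection, and there is one exactly when they have the
same cardinality. -/
abbrev FinOrd : Type := {I : Finset ℕ // I.Nonempty}

/-- The least element of a non-empty finite ordered set. -/
def FinOrd.least (I : FinOrd) : ℕ := I.1.min' I.2

/-- The one-element ordered set `{i}`. -/
def FinOrd.single (i : ℕ) : FinOrd := ⟨{i}, Finset.singleton_nonempty i⟩

/-- The combinatorial type of a shuffle composition of two operations. Here `K` is the union of `I`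
and `J`, and `I` meets `J` only in the least element `j` of `J`. Such data are the shuffling
surjections from `K` whose only fibre with possibly more than one element is `J`: the quotient of
`K` by `J`, ordered by the minima of the fibres, is `I`. The operation with inputs `J` is inserted
in the input `j` of the operation with inputs `I`. -/
structure IsGraft (I J K : FinOrd) : Prop where
  inter : I.1 ∩ J.1 = {J.least}
  union : I.1 ∪ J.1 = K.1

/-- The data of a graded shuffle operad over `k`, homological degrees being natural numbers:
a graded vector space for each finite ordered set, the action of the order-preserving bijections,
units, and the shuffle compositions of two operations. -/
structure GradedData (k : Type u) [Field k] where
  obj : FinOrd → Type w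
  [addCommGroup : ∀ I, AddCommGroup (obj I)]
  [module : ∀ I, Module k (obj I)]
  deg : ∀ I, ℕ → Submodule k (obj I)
  relabel : ∀ {I J : FinOrd}, I.1.card = J.1.card → (obj I →ₗ[k] obj J)
  one : ∀ i : ℕ, obj (FinOrd.single i)
  comp : ∀ {I J K : FinOrd}, IsGraft I J K → (obj I →ₗ[k] obj J →ₗ[k] obj K)

attribute [instance] GradedData.addCommGroup GradedData.module

/-- The axioms of a graded shuffle operad, with the Koszul sign rule. -/
structure IsGradedOperad {k : Type u} [Field k] (P : GradedData.{u, w} k) : Prop where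
  graded : ∀ I, DirectSum.IsInternal (P.deg I)
  relabel_deg : ∀ {I J : FinOrd} (h : I.1.card = J.1.card) (p : ℕ), ∀ a ∈ P.deg I p,
    P.relabel h a ∈ P.deg J p
  relabel_refl : ∀ {I : FinOrd} (a : P.obj I), P.relabel (rfl : I.1.card = I.1.card) a = a
  relabel_trans : ∀ {I J K : FinOrd} (h : I.1.card = J.1.card) (h' : J.1.card = K.1.card)
    (a : P.obj I), P.relabel h' (P.relabel h a) = P.relabel (h.trans h') a
  one_deg : ∀ i, P.one i ∈ P.deg (FinOrd.single i) 0
  relabel_one : ∀ (i j : ℕ) (h : (FinOrd.single i).1.card = (FinOrd.single j).1.card),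
    P.relabel h (P.one i) = P.one j
  comp_deg : ∀ {I J K : FinOrd} (h : IsGraft I J K) (p q : ℕ), ∀ a ∈ P.deg I p, ∀ b ∈ P.deg J q,
    P.comp h a b ∈ P.deg K (p + q)
  /-- Compositions are natural with respect to order-preserving bijections. -/
  relabel_comp : ∀ {I J K I' J' K' : FinOrd} (h : IsGraft I J K) (h' : IsGraft I' J' K')
    (e : ℕ → ℕ), StrictMonoOn e (K.1 : Set ℕ) →
    I.1.image e = I'.1 → J.1.image e = J'.1 → K.1.image e = K'.1 →
    ∀ (hI : I.1.card = I'.1.card) (hJ : J.1.card = J'.1.card) (hK : K.1.card = K'.1.card)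
      (a : P.obj I) (b : P.obj J),
      P.relabel hK (P.comp h a b) = P.comp h' (P.relabel hI a) (P.relabel hJ b)
  one_comp : ∀ {I : FinOrd} (i : ℕ) (h : IsGraft (FinOrd.single i) I I) (a : P.obj I),
    P.comp h (P.one i) a = a
  comp_one : ∀ {I : FinOrd} (i : ℕ) (h : IsGraft I (FinOrd.single i) I) (a : P.obj I),
    P.comp h a (P.one i) = a
  /-- Sequential composition: `c` is inserted in an input of `b`. -/
  comp_assoc : ∀ {I J K L N R : FinOrd} (h₁ : IsGraft I J K) (h₂ : IsGraft K L N)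
    (h₃ : IsGraft J L R) (h₄ : IsGraft I R N) (a : P.obj I) (b : P.obj J) (c : P.obj L),
    P.comp h₂ (P.comp h₁ a b) c = P.comp h₄ a (P.comp h₃ b c)
  /-- Parallel composition: `b` and `c` are inserted in two different inputs of `a`. -/
  comp_comm : ∀ {I J K L N R : FinOrd} (h₁ : IsGraft I J K) (h₂ : IsGraft K L N)
    (h₃ : IsGraft I L R) (h₄ : IsGraft R J N), J.least ≠ L.least →
    ∀ (p q : ℕ) (a : P.obj I), ∀ b ∈ P.deg J p, ∀ c ∈ P.deg L q,
    P.comp h₂ (P.comp h₁ a b) c = (-1 : k) ^ (p * q) • P.comp h₄ (P.comp h₃ a c) b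

/-- Morphisms of graded shuffle operads. -/
structure GradedHom {k : Type u} [Field k] (P : GradedData.{u, w} k) (Q : GradedData.{u, w'} k) where
  toFun : ∀ I, P.obj I →ₗ[k] Q.obj I
  map_deg : ∀ I (p : ℕ), ∀ a ∈ P.deg I p, toFun I a ∈ Q.deg I p
  map_relabel : ∀ {I J : FinOrd} (h : I.1.card = J.1.card) (a : P.obj I),
    toFun J (P.relabel h a) = Q.relabel h (toFun I a)
  map_one : ∀ i, toFun _ (P.one i) = Q.one i
  map_comp : ∀ {I J K : FinOrd} (h : IsGraft I J K) (a : P.obj I) (b : P.obj J),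
    toFun K (P.comp h a b) = Q.comp h (toFun I a) (toFun J b)

/-- The graded shuffle operad `P` is freely generated by its graded subcollection `V`: every
morphism of graded collections from `V` to a graded shuffle operad `Q` extends to a unique morphism
of graded shuffle operads from `P` to `Q`. -/
structure IsFreeOn {k : Type u} [Field k] (P : GradedData.{u, w} k)
    (V : ∀ I : FinOrd, ℕ → Submodule k (P.obj I)) : Prop where
  le_deg : ∀ I p, V I p ≤ P.deg I p
  relabel_mem : ∀ {I J : FinOrd} (h : I.1.card = J.1.card) (p : ℕ), ∀ a ∈ V I p,
    P.relabel h a ∈ V J p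
  exists_unique_extension : ∀ Q : GradedData.{u, w'} k, IsGradedOperad Q →
    ∀ f : (∀ I p, V I p →ₗ[k] Q.obj I),
      (∀ I p a, f I p a ∈ Q.deg I p) →
      (∀ {I J : FinOrd} (h : I.1.card = J.1.card) (p : ℕ) (a : V I p),
        f J p ⟨P.relabel h a, relabel_mem h p a a.2⟩ = Q.relabel h (f I p a)) →
      ∃! F : GradedHom P Q, ∀ I p (a : V I p), F.toFun I a = f I p a

/-- A graded shuffle operad is free if it is freely generated by some graded subcollection. -/
def IsFree {k : Type u} [Field k] (P : GradedData.{u, w} k) : Prop :=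
  ∃ V : ∀ I : FinOrd, ℕ → Submodule k (P.obj I), IsFreeOn.{u, w, w'} P V

/-- The data of a dg shuffle operad: those of a graded shuffle operad, and a differential. -/
structure DGData (k : Type u) [Field k] extends GradedData.{u, w} k where
  d : ∀ I, obj I →ₗ[k] obj I

/-- The axioms of a dg shuffle operad; the differential has degree `-1`. -/
structure IsDGOperad {k : Type u} [Field k] (P : DGData.{u, w} k) : Prop
    extends IsGradedOperad P.toGradedData where
  d_deg : ∀ I (p : ℕ), ∀ a ∈ P.deg I (p + 1), P.d I a ∈ P.deg I p
  d_deg_zero : ∀ I, ∀ a ∈ P.deg I 0, P.d I a = 0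
  d_d : ∀ I (a : P.obj I), P.d I (P.d I a) = 0
  d_relabel : ∀ {I J : FinOrd} (h : I.1.card = J.1.card) (a : P.obj I),
    P.d J (P.relabel h a) = P.relabel h (P.d I a)
  d_comp : ∀ {I J K : FinOrd} (h : IsGraft I J K) (p : ℕ), ∀ a ∈ P.deg I p, ∀ b : P.obj J,
    P.d K (P.comp h a b) = P.comp h (P.d I a) b + (-1 : k) ^ p • P.comp h a (P.d J b)

/-- Morphisms of dg shuffle operads. -/
structure DGHom {k : Type u} [Field k] (P : DGData.{u, w} k) (Q : DGData.{u, w'} k)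
    extends GradedHom P.toGradedData Q.toGradedData where
  map_d : ∀ I (a : P.obj I), toFun I (P.d I a) = Q.d I (toFun I a)

section Homology

variable {k : Type u} [Field k]

/-- Cycles of degree `p`. -/
def DGData.cycles (P : DGData.{u, w} k) (I : FinOrd) (p : ℕ) : Submodule k (P.obj I) :=
  P.deg I p ⊓ LinearMap.ker (P.d I)

/-- Boundaries of degree `p`. -/
def DGData.boundaries (P : DGData.{u, w} k) (I : FinOrd) (p : ℕ) : Submodule k (P.obj I) :=
  (P.deg I (p + 1)).map (P.d I)

/-- Homology in degree `p`. -/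
abbrev DGData.homology (P : DGData.{u, w} k) (I : FinOrd) (p : ℕ) : Type w :=
  P.cycles I p ⧸ (P.boundaries I p).comap (P.cycles I p).subtype

theorem DGHom.map_cycles {P : DGData.{u, w} k} {Q : DGData.{u, w'} k} (f : DGHom P Q) (I : FinOrd)
    (p : ℕ) : ∀ a ∈ P.cycles I p, f.toFun I a ∈ Q.cycles I p := by
  rintro a ⟨h1, h2⟩
  refine ⟨f.map_deg I p a h1, ?_⟩
  have h3 : P.d I a = 0 := h2
  have h4 : Q.d I (f.toFun I a) = 0 := by rw [← f.map_d, h3, map_zero]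
  exact h4

/-- The map induced on homology. -/
def DGHom.homologyMap {P : DGData.{u, w} k} {Q : DGData.{u, w'} k} (f : DGHom P Q) (I : FinOrd)
    (p : ℕ) : P.homology I p →ₗ[k] Q.homology I p :=
  Submodule.mapQ _ _ ((f.toFun I).restrict (f.map_cycles I p)) (by
    rintro ⟨a, ha⟩ ⟨b, hb, hab⟩
    exact ⟨f.toFun I b, f.map_deg I _ b hb, by
      rw [← f.map_d, hab]; rfl⟩)

/-- Quasi-isomorphisms. -/
def DGHom.IsQuasiIso {P : DGData.{u, w} k} {Q : DGData.{u, w'} k} (f : DGHom P Q) : Prop :=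
  ∀ I p, Function.Bijective (f.homologyMap I p)

end Homology

/-! ## Trees -/

/-- Planar rooted trees with leaves labelled by natural numbers and internal vertices with `n`
inputs decorated by elements of `M n`, `n ≥ 1`. The tree `leaf i` is the degenerate tree. -/
inductive Tree (M : ℕ → Type v) : Type v
  | leaf (i : ℕ) : Tree M
  | node (n : ℕ) (m : M (n + 1)) (c : Fin (n + 1) → Tree M) : Tree M

namespace Tree

variable {M : ℕ → Type v}

/-- The set of labels of the leaves. -/
def leaves : Tree M → Finset ℕ
  | leaf i => {i}
  | node _ _ c => Finset.univ.biUnion fun i => (c i).leaves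

theorem leaves_nonempty (t : Tree M) : t.leaves.Nonempty := by
  induction t with
  | leaf i => exact Finset.singleton_nonempty i
  | node n m c ih =>
    obtain ⟨x, hx⟩ := ih 0
    exact ⟨x, by simp only [leaves, Finset.mem_biUnion]; exact ⟨0, Finset.mem_univ _, hx⟩⟩

/-- The smallest leaf. -/
def minLeaf (t : Tree M) : ℕ := t.leaves.min' t.leaves_nonempty

/-- The leaves have pairwise different labels, and the inputs of each vertex are ordered by the
smallest leaves that one can reach through them: the tree is the canonical planar representative
of an abstract tree with (bijectively) labelled leaves. -/
def Canonical : Tree M → Prop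
  | leaf _ => True
  | node _ _ c => (∀ i, (c i).Canonical) ∧
      ∀ i j, i < j → Disjoint (c i).leaves (c j).leaves ∧ (c i).minLeaf < (c j).minLeaf

/-- Change of the labels of the leaves. -/
def mapLeaves (e : ℕ → ℕ) : Tree M → Tree M
  | leaf i => leaf (e i)
  | node n m c => node n m fun i => (c i).mapLeaves e

/-- Grafting of the tree `s` at the leaf `j`. -/
def graft (s : Tree M) (j : ℕ) : Tree M → Tree M
  | leaf i => if i = j then s else leaf i
  | node n m c => node n m fun i => graft s j (c i)

/-- The internal vertices of a tree. A vertex is given by its address, the list of the numbers of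
the inputs on the path from the root to it. -/
def vertices : Tree M → Finset (List ℕ)
  | leaf _ => ∅
  | node _ _ c => insert [] (Finset.univ.biUnion fun i => (c i).vertices.image (List.cons i.1))

/-- The tree growing from the given address. -/
def growing : Tree M → List ℕ → Tree M
  | t, [] => t
  | leaf i, _ :: _ => leaf i
  | node n m c, a :: p => if h : a < n + 1 then (c ⟨a, h⟩).growing p else node n m c

open Classical in
/-- The address of the leaf `j`. -/
noncomputable def address (j : ℕ) : Tree M → List ℕ
  | leaf _ => []
  | node _ _ c =>
    if h : ∃ i, j ∈ (c i).leaves then (h.choose : ℕ) :: address j (c h.choose) else []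

/-- `S` is the set of vertices of a subtree of `t` with root `r`: a set of internal vertices which
contains `r`, and which contains with each of its elements the path from `r` to it. -/
structure IsSubtree (t : Tree M) (r : List ℕ) (S : Finset (List ℕ)) : Prop where
  root_mem : r ∈ S
  subset : S ⊆ t.vertices
  root_prefix : ∀ v ∈ S, r <+: v
  path_mem : ∀ v ∈ S, ∀ x, r <+: x → x <+: v → x ∈ S

/-- Prune a tree, whose root has the address `p`, to its vertices with addresses in `S`. An edge
which is cut becomes a leaf labelled by its smallest descendant. -/
def prune (S : Finset (List ℕ)) : Tree M → List ℕ → Tree M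
  | leaf i, _ => leaf i
  | node n m c, p => if p ∈ S then node n m fun i => (c i).prune S (p ++ [i.1])
      else leaf (node n m c).minLeaf

/-- The labelled tree corresponding to the subtree of `t` with root `r` and set of vertices `S`;
its leaves are labelled by their smallest descendants, without standardisation. -/
def restrict (t : Tree M) (r : List ℕ) (S : Finset (List ℕ)) : Tree M :=
  (t.growing r).prune S r

/-- `t` is obtained from `s` by an order-preserving change of the labels of the leaves. If the
leaves of `s` are labelled by `1, …, n`, this means that `s` is the standardisation of `t`. -/
def SameShape (s t : Tree M) : Prop :=
  ∃ e : ℕ → ℕ, StrictMonoOn e (s.leaves : Set ℕ) ∧ t = s.mapLeaves e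

/-- The divisors of `t` (that is, occurrences of tree monomials in `t`) for which the corresponding
tree monomial belongs to the set `G`. -/
def Divisor (G : Set (Tree M)) (t : Tree M) : Type :=
  {S : Finset (List ℕ) // ∃ r, t.IsSubtree r S ∧ ∃ g ∈ G, g.SameShape (t.restrict r S)}

/-! ### Facts on trees needed to define the compositions -/

theorem minLeaf_mem (t : Tree M) : t.minLeaf ∈ t.leaves := Finset.min'_mem _ _

theorem mem_leaves_node {n : ℕ} {m : M (n + 1)} {c : Fin (n + 1) → Tree M} {x : ℕ} :
    x ∈ (node n m c).leaves ↔ ∃ i, x ∈ (c i).leaves := by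
  simp [leaves]

theorem minLeaf_eq_iff (t : Tree M) (x : ℕ) :
    t.minLeaf = x ↔ x ∈ t.leaves ∧ ∀ y ∈ t.leaves, x ≤ y := by
  constructor
  · rintro rfl
    exact ⟨t.minLeaf_mem, fun y hy => Finset.min'_le _ _ hy⟩
  · rintro ⟨h1, h2⟩
    exact le_antisymm (Finset.min'_le _ _ h1) (h2 _ t.minLeaf_mem)

theorem leaves_mapLeaves (e : ℕ → ℕ) (t : Tree M) : (t.mapLeaves e).leaves = t.leaves.image e := by
  induction t with
  | leaf i => simp [mapLeaves, leaves]
  | node n m c ih =>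
    ext x
    simp only [mapLeaves, mem_leaves_node, ih, Finset.mem_image]
    grind

theorem minLeaf_mapLeaves {e : ℕ → ℕ} {t : Tree M} (he : StrictMonoOn e (t.leaves : Set ℕ)) :
    (t.mapLeaves e).minLeaf = e t.minLeaf := by
  rw [minLeaf_eq_iff, leaves_mapLeaves]
  refine ⟨Finset.mem_image_of_mem _ t.minLeaf_mem, fun y hy => ?_⟩
  obtain ⟨x, hx, rfl⟩ := Finset.mem_image.1 hy
  exact he.monotoneOn t.minLeaf_mem hx (Finset.min'_le _ _ hx)

theorem leaves_child_subset {n : ℕ} {m : M (n + 1)} {c : Fin (n + 1) → Tree M} (i : Fin (n + 1)) :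
    (c i).leaves ⊆ (node n m c).leaves := fun _ hx => mem_leaves_node.2 ⟨i, hx⟩

theorem Canonical.mapLeaves {e : ℕ → ℕ} {t : Tree M} (ht : t.Canonical)
    (he : StrictMonoOn e (t.leaves : Set ℕ)) : (t.mapLeaves e).Canonical := by
  induction t with
  | leaf i => trivial
  | node n m c ih =>
    have hc : ∀ i, StrictMonoOn e ((c i).leaves : Set ℕ) := fun i =>
      he.mono (Finset.coe_subset.2 (leaves_child_subset i))
    refine ⟨fun i => ih i (ht.1 i) (hc i), fun i j hij => ?_⟩
    obtain ⟨h1, h2⟩ := ht.2 i j hij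
    constructor
    · rw [leaves_mapLeaves, leaves_mapLeaves, Finset.disjoint_left]
      intro x hx hx'
      obtain ⟨y, hy, rfl⟩ := Finset.mem_image.1 hx
      obtain ⟨z, hz, hzy⟩ := Finset.mem_image.1 hx'
      have := he.injOn (leaves_child_subset j hz) (leaves_child_subset i hy) hzy
      subst this
      exact Finset.disjoint_left.1 h1 hy hz
    · rw [minLeaf_mapLeaves (hc i), minLeaf_mapLeaves (hc j)]
      exact he (leaves_child_subset i (c i).minLeaf_mem) (leaves_child_subset j (c j).minLeaf_mem) h2

theorem graft_of_notMem {s : Tree M} {j : ℕ} {t : Tree M} (h : j ∉ t.leaves) : graft s j t = t := by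
  induction t with
  | leaf i =>
    have : i ≠ j := by rintro rfl; exact h (by simp [leaves])
    simp [graft, this]
  | node n m c ih =>
    simp only [graft]
    congr 1
    funext i
    exact ih i fun hi => h (leaves_child_subset i hi)

theorem mem_leaves_graft {s : Tree M} {j : ℕ} {t : Tree M} {x : ℕ} :
    x ∈ (graft s j t).leaves ↔ (x ∈ t.leaves ∧ x ≠ j) ∨ (j ∈ t.leaves ∧ x ∈ s.leaves) := by
  induction t with
  | leaf i =>
    by_cases h : i = j
    · subst h; simp [graft, leaves]
    · simp only [graft, h, if_false, leaves, Finset.mem_singleton]; grind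
  | node n m c ih =>
    simp only [graft, mem_leaves_node, ih]
    grind

theorem minLeaf_graft {s : Tree M} {j : ℕ} (hs : s.minLeaf = j) (t : Tree M) :
    (graft s j t).minLeaf = t.minLeaf := by
  by_cases hj : j ∈ t.leaves
  · have h := (minLeaf_eq_iff s j).1 hs
    have ht := (minLeaf_eq_iff t _).1 rfl
    rw [minLeaf_eq_iff]
    refine ⟨?_, fun y hy => ?_⟩
    · rw [mem_leaves_graft]
      by_cases h' : t.minLeaf = j
      · right; exact ⟨hj, h' ▸ h.1⟩
      · left; exact ⟨ht.1, h'⟩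
    · rcases mem_leaves_graft.1 hy with h' | h'
      · exact ht.2 _ h'.1
      · exact (ht.2 _ hj).trans (h.2 _ h'.2)
  · rw [graft_of_notMem hj]

theorem Canonical.graft {s : Tree M} {j : ℕ} {t : Tree M} (ht : t.Canonical) (hs : s.Canonical)
    (hj : s.minLeaf = j) (hd : ∀ x ∈ s.leaves, x ∈ t.leaves → x = j) :
    (graft s j t).Canonical := by
  induction t with
  | leaf i =>
    simp only [Tree.graft]
    split_ifs
    · exact hs
    · trivial
  | node n m c ih =>
    refine ⟨fun i => ih i (ht.1 i) fun x hx hx' => hd x hx (leaves_child_subset i hx'), ?_⟩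
    intro a b hab
    obtain ⟨h1, h2⟩ := ht.2 a b hab
    refine ⟨?_, by simpa only [minLeaf_graft hj] using h2⟩
    have hda := fun x hx hx' => hd x hx (leaves_child_subset a hx')
    have hdb := fun x hx hx' => hd x hx (leaves_child_subset b hx')
    rw [Finset.disjoint_left] at h1 ⊢
    intro x hx hx'
    rw [mem_leaves_graft] at hx hx'
    grind

/-! ### Divisors under changes of labels and graftings -/

theorem mem_vertices_node {n : ℕ} {m : M (n + 1)} {c : Fin (n + 1) → Tree M} {x : List ℕ} :
    x ∈ (node n m c).vertices ↔ x = [] ∨ ∃ i, ∃ y ∈ (c i).vertices, i.1 :: y = x := by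
  simp [vertices]

theorem vertices_mapLeaves (e : ℕ → ℕ) (t : Tree M) : (t.mapLeaves e).vertices = t.vertices := by
  induction t with
  | leaf i => rfl
  | node n m c ih => simp only [mapLeaves, vertices, ih]

theorem growing_mapLeaves (e : ℕ → ℕ) (t : Tree M) (r : List ℕ) :
    (t.mapLeaves e).growing r = (t.growing r).mapLeaves e := by
  induction r generalizing t with
  | nil => cases t <;> rfl
  | cons a p ih =>
    cases t with
    | leaf i => rfl
    | node n m c =>
      simp only [mapLeaves, growing]
      split_ifs with h
      · exact ih _
      · rfl

theorem leaves_growing (t : Tree M) (r : List ℕ) : (t.growing r).leaves ⊆ t.leaves := by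
  induction r generalizing t with
  | nil => cases t <;> exact subset_rfl
  | cons a p ih =>
    cases t with
    | leaf i => exact subset_rfl
    | node n m c =>
      simp only [growing]
      split_ifs with h
      · exact (ih _).trans (leaves_child_subset _)
      · exact subset_rfl

theorem leaves_prune (S : Finset (List ℕ)) (t : Tree M) (p : List ℕ) :
    (t.prune S p).leaves ⊆ t.leaves := by
  induction t generalizing p with
  | leaf i => exact subset_rfl
  | node n m c ih =>
    simp only [prune]
    split_ifs with h
    · intro x hx
      obtain ⟨i, hi⟩ := mem_leaves_node.1 hx
      exact mem_leaves_node.2 ⟨i, ih i _ hi⟩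
    · intro x hx
      simp only [leaves, Finset.mem_singleton] at hx
      subst hx
      exact minLeaf_mem _

theorem leaves_restrict (t : Tree M) (r : List ℕ) (S : Finset (List ℕ)) :
    (t.restrict r S).leaves ⊆ t.leaves :=
  (leaves_prune _ _ _).trans (leaves_growing _ _)

theorem prune_mapLeaves {e : ℕ → ℕ} (S : Finset (List ℕ)) {t : Tree M}
    (he : StrictMonoOn e (t.leaves : Set ℕ)) (p : List ℕ) :
    (t.mapLeaves e).prune S p = (t.prune S p).mapLeaves e := by
  induction t generalizing p with
  | leaf i => rfl
  | node n m c ih =>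
    have h := minLeaf_mapLeaves he
    simp only [mapLeaves] at h
    simp only [mapLeaves, prune]
    split_ifs
    · simp only [mapLeaves]
      congr 1
      funext i
      exact ih i (he.mono (Finset.coe_subset.2 (leaves_child_subset i))) _
    · simp only [mapLeaves, h]

theorem mapLeaves_mapLeaves (e f : ℕ → ℕ) (t : Tree M) :
    (t.mapLeaves f).mapLeaves e = t.mapLeaves (e ∘ f) := by
  induction t with
  | leaf i => rfl
  | node n m c ih => simp only [mapLeaves, ih]

theorem SameShape.mapLeaves {s t : Tree M} (h : s.SameShape t) {e : ℕ → ℕ}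
    (he : StrictMonoOn e (t.leaves : Set ℕ)) : s.SameShape (t.mapLeaves e) := by
  obtain ⟨f, hf, rfl⟩ := h
  refine ⟨e ∘ f, he.comp hf fun x hx => ?_, mapLeaves_mapLeaves _ _ _⟩
  rw [leaves_mapLeaves]
  exact Finset.mem_coe.2 (Finset.mem_image_of_mem _ hx)

/-- The divisors of a tree do not change under an order-preserving change of labels. -/
def Divisor.relabel {G : Set (Tree M)} {e : ℕ → ℕ} {t : Tree M}
    (he : StrictMonoOn e (t.leaves : Set ℕ)) (D : t.Divisor G) : (t.mapLeaves e).Divisor G :=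
  ⟨D.1, by
    obtain ⟨r, h, g, hg, hs⟩ := D.2
    refine ⟨r, ⟨h.root_mem, ?_, h.root_prefix, h.path_mem⟩, g, hg, ?_⟩
    · rw [vertices_mapLeaves]; exact h.subset
    · rw [restrict, growing_mapLeaves,
        prune_mapLeaves D.1 (he.mono (Finset.coe_subset.2 (leaves_growing _ _)))]
      exact hs.mapLeaves (he.mono (Finset.coe_subset.2 (leaves_restrict _ _ _)))⟩

theorem vertices_subset_graft (s : Tree M) (j : ℕ) (t : Tree M) :
    t.vertices ⊆ (graft s j t).vertices := by
  induction t with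
  | leaf i => exact Finset.empty_subset _
  | node n m c ih =>
    intro x hx
    rw [graft, mem_vertices_node]
    rcases mem_vertices_node.1 hx with h | ⟨i, y, hy, h⟩
    · exact Or.inl h
    · exact Or.inr ⟨i, y, ih i hy, h⟩

theorem growing_graft {s : Tree M} {j : ℕ} {t : Tree M} {r : List ℕ} (hr : r ∈ t.vertices) :
    (graft s j t).growing r = graft s j (t.growing r) := by
  induction r generalizing t with
  | nil => cases t <;> simp [growing, graft]
  | cons a p ih =>
    cases t with
    | leaf i => simp [vertices] at hr
    | node n m c =>
      obtain ⟨i, y, hy, h⟩ := (mem_vertices_node.1 hr).resolve_left (List.cons_ne_nil _ _)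
      obtain ⟨rfl, rfl⟩ := List.cons.inj h
      simpa only [graft, growing, i.2, dif_pos] using ih hy

theorem mem_vertices_growing {t : Tree M} {r q : List ℕ} (h : r ++ q ∈ t.vertices) :
    q ∈ (t.growing r).vertices := by
  induction r generalizing t with
  | nil => cases t <;> simpa [growing] using h
  | cons a p ih =>
    cases t with
    | leaf i => simp [vertices] at h
    | node n m c =>
      obtain ⟨i, y, hy, h'⟩ := (mem_vertices_node.1 h).resolve_left (by simp)
      obtain ⟨rfl, rfl⟩ := List.cons.inj h'
      simpa only [growing, i.2, dif_pos] using ih hy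

theorem prune_graft {s : Tree M} {j : ℕ} (hs : s.minLeaf = j) {S : Finset (List ℕ)} {t : Tree M}
    {p : List ℕ} (h : ∀ q, p ++ q ∈ S → q ∈ t.vertices) :
    (graft s j t).prune S p = t.prune S p := by
  induction t generalizing p with
  | leaf i =>
    by_cases hij : i = j
    · subst hij
      have hp : p ∉ S := fun hp => by
        have := h [] (by simpa using hp)
        simp [vertices] at this
      simp only [graft, if_true]
      cases s with
      | leaf a => simp only [prune]; rw [← hs]; simp [minLeaf, leaves]
      | node n m c => simp only [prune, hp, if_false, hs]
    · simp [graft, hij]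
  | node n m c ih =>
    have hm := minLeaf_graft hs (node n m c)
    simp only [graft] at hm
    simp only [graft, prune, hm]
    split_ifs
    · congr 1
      funext i
      refine ih i fun q hq => ?_
      have h' := h (i.1 :: q) (by simpa using hq)
      obtain ⟨i', y, hy, hh⟩ := (mem_vertices_node.1 h').resolve_left (List.cons_ne_nil _ _)
      obtain ⟨h1, rfl⟩ := List.cons.inj hh
      rw [← Fin.ext h1]; exact hy
    · rfl

/-- The divisors of `t` are divisors of the tree obtained by grafting at a leaf of `t`. -/
def Divisor.left {G : Set (Tree M)} {s t : Tree M} {j : ℕ} (hs : s.minLeaf = j)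
    (D : t.Divisor G) : (graft s j t).Divisor G :=
  ⟨D.1, by
    obtain ⟨r, h, g, hg, hsh⟩ := D.2
    refine ⟨r, ⟨h.root_mem, h.subset.trans (vertices_subset_graft _ _ _), h.root_prefix,
      h.path_mem⟩, g, hg, ?_⟩
    rw [restrict, growing_graft (h.subset h.root_mem),
      prune_graft hs fun q hq => mem_vertices_growing (h.subset hq)]
    exact hsh⟩

theorem growing_address {s : Tree M} {j : ℕ} {t : Tree M} (hj : j ∈ t.leaves) (r : List ℕ) :
    (graft s j t).growing (t.address j ++ r) = s.growing r := by
  induction t with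
  | leaf i =>
    have : i = j := by simpa [leaves, eq_comm] using hj
    simp [graft, address, this]
  | node n m c ih =>
    have h := mem_leaves_node.1 hj
    simp only [address, h, dif_pos, graft, List.cons_append, growing, Fin.is_lt]
    exact ih _ h.choose_spec

theorem address_append_mem {s : Tree M} {j : ℕ} {t : Tree M} (hj : j ∈ t.leaves) {v : List ℕ}
    (hv : v ∈ s.vertices) : t.address j ++ v ∈ (graft s j t).vertices := by
  induction t with
  | leaf i =>
    have : i = j := by simpa [leaves, eq_comm] using hj
    simpa [graft, address, this] using hv
  | node n m c ih =>
    have h := mem_leaves_node.1 hj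
    simp only [address, h, dif_pos, graft, List.cons_append]
    exact mem_vertices_node.2 (Or.inr ⟨_, _, ih _ h.choose_spec, rfl⟩)

theorem prune_image (S : Finset (List ℕ)) (a : List ℕ) (t : Tree M) (p : List ℕ) :
    t.prune (S.image (a ++ ·)) (a ++ p) = t.prune S p := by
  induction t generalizing p with
  | leaf i => rfl
  | node n m c ih =>
    simp only [prune, Finset.mem_image, List.append_cancel_left_eq, exists_eq_right]
    split_ifs
    · congr 1
      funext i
      rw [List.append_assoc, ih]
    · rfl

/-- The divisors of `s` are divisors of the tree obtained by grafting `s` at the leaf `j`. -/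
noncomputable def Divisor.right {G : Set (Tree M)} {s t : Tree M} {j : ℕ} (hj : j ∈ t.leaves)
    (D : s.Divisor G) : (graft s j t).Divisor G :=
  ⟨D.1.image (t.address j ++ ·), by
    obtain ⟨r, h, g, hg, hsh⟩ := D.2
    refine ⟨t.address j ++ r, ⟨Finset.mem_image_of_mem _ h.root_mem, ?_, ?_, ?_⟩, g, hg, ?_⟩
    · intro v hv
      obtain ⟨x, hx, rfl⟩ := Finset.mem_image.1 hv
      exact address_append_mem hj (h.subset hx)
    · intro v hv
      obtain ⟨x, hx, rfl⟩ := Finset.mem_image.1 hv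
      exact (List.prefix_append_right_inj _).2 (h.root_prefix x hx)
    · intro v hv x hrx hxv
      obtain ⟨y, hy, rfl⟩ := Finset.mem_image.1 hv
      obtain ⟨z, rfl⟩ := hrx
      rw [List.append_assoc] at hxv ⊢
      exact Finset.mem_image_of_mem _
        (h.path_mem y hy _ (List.prefix_append _ _) ((List.prefix_append_right_inj _).1 hxv))
    · rw [restrict, growing_address hj, prune_image]
      exact hsh⟩

end Tree

/-! ## Tree monomials -/

/-- Tree monomials whose leaves are labelled by the ordered set `I`. -/
def TreeMonomial (M : ℕ → Type v) (I : FinOrd) : Type v :=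
  {t : Tree M // t.Canonical ∧ t.leaves = I.1}

/-- The order-preserving bijection from `I` to `J` (extended to all natural numbers): the element
of `I` preceded by exactly `n` elements of `I` goes to the element of `J` preceded by exactly `n`
elements of `J`. -/
noncomputable def orderBij (I J : FinOrd) (x : ℕ) : ℕ := Nat.nth (· ∈ J.1) (Nat.count (· ∈ I.1) x)

theorem count_lt_card (I : FinOrd) {x : ℕ} (hx : x ∈ I.1) :
    Nat.count (· ∈ I.1) x < I.1.card := by
  have h := Nat.count_lt_card (p := (· ∈ I.1)) I.1.finite_toSet hx
  simpa using h

theorem orderBij_strictMonoOn {I J : FinOrd} (h : I.1.card = J.1.card) :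
    StrictMonoOn (orderBij I J) (I.1 : Set ℕ) := by
  intro x hx y hy hxy
  refine Nat.nth_lt_nth_of_lt_card J.1.finite_toSet (Nat.count_strict_mono hx hxy) ?_
  simpa [h] using count_lt_card I hy

theorem image_orderBij {I J : FinOrd} (h : I.1.card = J.1.card) :
    I.1.image (orderBij I J) = J.1 := by
  refine Finset.eq_of_subset_of_card_le ?_ ?_
  · intro y hy
    obtain ⟨x, hx, rfl⟩ := Finset.mem_image.1 hy
    refine Nat.nth_mem_of_lt_card J.1.finite_toSet ?_
    simpa [h] using count_lt_card I hx
  · rw [Finset.card_image_of_injOn (orderBij_strictMonoOn h).injOn, h]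

theorem strictMonoOn_leaves {M : ℕ → Type v} {I J : FinOrd} (h : I.1.card = J.1.card)
    (t : TreeMonomial M I) : StrictMonoOn (orderBij I J) (t.1.leaves : Set ℕ) := by
  rw [t.2.2]; exact orderBij_strictMonoOn h

theorem IsGraft.least_mem {I J K : FinOrd} (h : IsGraft I J K) : J.least ∈ I.1 :=
  Finset.mem_of_mem_inter_left (h.inter ▸ Finset.mem_singleton_self _ : J.least ∈ I.1 ∩ J.1)

namespace TreeMonomial

variable {M : ℕ → Type v}

/-- The degenerate tree. -/
def one (i : ℕ) : TreeMonomial M (FinOrd.single i) := ⟨Tree.leaf i, trivial, rfl⟩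

/-- The action of order-preserving bijections on tree monomials. -/
noncomputable def relabel {I J : FinOrd} (h : I.1.card = J.1.card) (t : TreeMonomial M I) :
    TreeMonomial M J :=
  ⟨t.1.mapLeaves (orderBij I J), t.2.1.mapLeaves (strictMonoOn_leaves h t), by
    rw [Tree.leaves_mapLeaves, t.2.2, image_orderBij h]⟩

theorem minLeaf_eq {I : FinOrd} (t : TreeMonomial M I) : t.1.minLeaf = I.least := by
  obtain ⟨t, h1, h2⟩ := t
  simp only [Tree.minLeaf, FinOrd.least, h2]

/-- The shuffle composition of tree monomials. -/
def graft {I J K : FinOrd} (h : IsGraft I J K) (t : TreeMonomial M I) (s : TreeMonomial M J) :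
    TreeMonomial M K :=
  ⟨Tree.graft s.1 J.least t.1, t.2.1.graft s.2.1 s.minLeaf_eq (by
      intro x hx hx'
      rw [s.2.2] at hx
      rw [t.2.2] at hx'
      have : x ∈ I.1 ∩ J.1 := Finset.mem_inter.2 ⟨hx', hx⟩
      rw [h.inter] at this
      exact Finset.mem_singleton.1 this), by
    ext x
    rw [Tree.mem_leaves_graft, t.2.2, s.2.2, ← h.union, Finset.mem_union]
    have h1 := h.least_mem
    have h2 : J.least ∈ J.1 := Finset.min'_mem _ _
    by_cases hx : x = J.least
    · subst hx; simp [h1, h2]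
    · simp [hx, h1]⟩

theorem least_mem_leaves {I J K : FinOrd} (h : IsGraft I J K) (t : TreeMonomial M I) :
    J.least ∈ t.1.leaves := by
  rw [t.2.2]; exact h.least_mem

end TreeMonomial

/-! ## The operad with monomial relations -/

section Monomial

variable (k : Type u) [Field k] {M : ℕ → Type v}

/-- The shuffle composition in the free operad generated by `M`, whose component at `I` is the
vector space with basis the tree monomials with leaves `I`. -/
noncomputable def freeComp {I J K : FinOrd} (h : IsGraft I J K) :
    (TreeMonomial M I →₀ k) →ₗ[k] (TreeMonomial M J →₀ k) →ₗ[k] (TreeMonomial M K →₀ k) :=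
  Finsupp.linearCombination k fun t => Finsupp.lmapDomain k k fun s => t.graft h s

/-- The action of order-preserving bijections on the free operad. -/
noncomputable def freeRelabel {I J : FinOrd} (h : I.1.card = J.1.card) :
    (TreeMonomial M I →₀ k) →ₗ[k] (TreeMonomial M J →₀ k) :=
  Finsupp.lmapDomain k k (TreeMonomial.relabel h)

/-- Ideals of the free operad. -/
structure IsIdeal (N : ∀ I : FinOrd, Submodule k (TreeMonomial M I →₀ k)) : Prop where
  relabel_mem : ∀ {I J : FinOrd} (h : I.1.card = J.1.card), ∀ a ∈ N I, freeRelabel k h a ∈ N J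
  comp_mem_left : ∀ {I J K : FinOrd} (h : IsGraft I J K), ∀ a ∈ N I, ∀ b, freeComp k h a b ∈ N K
  comp_mem_right : ∀ {I J K : FinOrd} (h : IsGraft I J K), ∀ a, ∀ b ∈ N J, freeComp k h a b ∈ N K

variable (G : Set (Tree M))

/-- The ideal of the free operad generated by the set `G` of tree monomials: the smallest ideal
which contains them. -/
noncomputable def monomialIdeal (I : FinOrd) : Submodule k (TreeMonomial M I →₀ k) :=
  sInf {U | ∃ N : ∀ J : FinOrd, Submodule k (TreeMonomial M J →₀ k), IsIdeal k N ∧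
    (∀ J (t : TreeMonomial M J), t.1 ∈ G → Finsupp.single t 1 ∈ N J) ∧ N I = U}

theorem mem_monomialIdeal {I : FinOrd} {a : TreeMonomial M I →₀ k} :
    a ∈ monomialIdeal k G I ↔ ∀ N : ∀ J : FinOrd, Submodule k (TreeMonomial M J →₀ k),
      IsIdeal k N → (∀ J (t : TreeMonomial M J), t.1 ∈ G → Finsupp.single t 1 ∈ N J) → a ∈ N I := by
  rw [monomialIdeal, Submodule.mem_sInf]
  constructor
  · intro h N h1 h2
    exact h _ ⟨N, h1, h2, rfl⟩
  · rintro h U ⟨N, h1, h2, rfl⟩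
    exact h N h1 h2

theorem isIdeal_monomialIdeal : IsIdeal k (monomialIdeal k G) where
  relabel_mem h a ha := (mem_monomialIdeal k G).2 fun N h1 h2 =>
    h1.relabel_mem h a ((mem_monomialIdeal k G).1 ha N h1 h2)
  comp_mem_left h a ha b := (mem_monomialIdeal k G).2 fun N h1 h2 =>
    h1.comp_mem_left h a ((mem_monomialIdeal k G).1 ha N h1 h2) b
  comp_mem_right h a b hb := (mem_monomialIdeal k G).2 fun N h1 h2 =>
    h1.comp_mem_right h a b ((mem_monomialIdeal k G).1 hb N h1 h2)

/-- The quotient of the free operad generated by `M` by the ideal generated by the set `G` of tree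
monomials, regarded as a dg operad concentrated in degree zero, with zero differential. -/
noncomputable def monomialOperad : DGData.{u, max u v} k where
  obj I := (TreeMonomial M I →₀ k) ⧸ monomialIdeal k G I
  deg _ p := if p = 0 then ⊤ else ⊥
  relabel {I J} h := Submodule.mapQ (monomialIdeal k G I) (monomialIdeal k G J) (freeRelabel k h)
    fun a ha => (isIdeal_monomialIdeal k G).relabel_mem h a ha
  one i := Submodule.Quotient.mk (Finsupp.single (TreeMonomial.one i) 1)
  comp {I J K} h := Submodule.liftQ _
    (LinearMap.flip (Submodule.liftQ _
      (LinearMap.flip ((freeComp k h).compr₂ (monomialIdeal k G K).mkQ)) (by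
        intro b hb
        rw [LinearMap.mem_ker]
        refine LinearMap.ext fun a => ?_
        simpa using (isIdeal_monomialIdeal k G).comp_mem_right h a b hb))) (by
    intro a ha
    rw [LinearMap.mem_ker]
    refine LinearMap.ext fun b => ?_
    obtain ⟨b, rfl⟩ := Submodule.Quotient.mk_surjective _ b
    simpa using (isIdeal_monomialIdeal k G).comp_mem_left h a ha b)
  d _ := 0

end Monomial

/-! ## The inclusion-exclusion operad -/

section InclusionExclusion

variable (k : Type u) [Field k] {M : ℕ → Type v} (G : Set (Tree M))

/-- The exterior algebra with one generator for each divisor of `t` that belongs to `G`. -/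
abbrev Marks (t : Tree M) : Type u := ExteriorAlgebra k (t.Divisor G →₀ k)

/-- The derivation of degree `-1` of the exterior algebra which sends each generator to `1`: the
contraction with the linear functional equal to `1` on each generator. It is the sum of the
derivations which remove one of the generators. -/
noncomputable def markD (t : Tree M) : Marks k G t →ₗ[k] Marks k G t :=
  CliffordAlgebra.contractLeft (Finsupp.linearCombination k fun _ : t.Divisor G => (1 : k))

/-- Composition of marked tree monomials: the trees are composed, and the wedge product of the
symbols labelling their divisors is taken. -/
noncomputable def markComp {I J K : FinOrd} (h : IsGraft I J K) (t : TreeMonomial M I)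
    (s : TreeMonomial M J) :
    Marks k G t.1 →ₗ[k] Marks k G s.1 →ₗ[k] Marks k G (t.graft h s).1 :=
  (LinearMap.mul k (Marks k G (t.graft h s).1)).compl₁₂
    (ExteriorAlgebra.map (Finsupp.lmapDomain k k
      (Tree.Divisor.left (G := G) (t := t.1) s.minLeaf_eq))).toLinearMap
    (ExteriorAlgebra.map (Finsupp.lmapDomain k k
      (Tree.Divisor.right (G := G) (s := s.1) (t.least_mem_leaves h)))).toLinearMap

/-- The action of order-preserving bijections on the marks. -/
noncomputable def markRelabel {I J : FinOrd} (h : I.1.card = J.1.card) (t : TreeMonomial M I) :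
    Marks k G t.1 →ₗ[k] Marks k G (t.relabel h).1 :=
  (ExteriorAlgebra.map (Finsupp.lmapDomain k k
    (Tree.Divisor.relabel (G := G) (strictMonoOn_leaves h t)))).toLinearMap

open Classical in
/-- The inclusion-exclusion dg operad: the direct sum over all tree monomials of the exterior
algebras on those of their divisors that belong to `G`. -/
noncomputable def inclusionExclusion : DGData.{u, max u v} k where
  obj I := ⨁ t : TreeMonomial M I, Marks k G t.1
  deg I p := ⨅ t : TreeMonomial M I,
    (⋀[k]^p (t.1.Divisor G →₀ k)).comap
      (DirectSum.component k (TreeMonomial M I) (fun t => Marks k G t.1) t)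
  relabel {I J} h := DirectSum.toModule k (TreeMonomial M I) _ fun t =>
    DirectSum.lof k (TreeMonomial M J) (fun t => Marks k G t.1) (t.relabel h) ∘ₗ markRelabel k G h t
  one i := DirectSum.lof k (TreeMonomial M (FinOrd.single i)) (fun t => Marks k G t.1)
    (TreeMonomial.one i) 1
  comp {I J K} h := DirectSum.toModule k (TreeMonomial M I) _ fun t =>
    LinearMap.flip (DirectSum.toModule k (TreeMonomial M J) _ fun s =>
      LinearMap.flip ((markComp k G h t s).compr₂
        (DirectSum.lof k (TreeMonomial M K) (fun t => Marks k G t.1) (t.graft h s))))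
  d I := DirectSum.toModule k (TreeMonomial M I) _ fun t =>
    DirectSum.lof k (TreeMonomial M I) (fun t => Marks k G t.1) t ∘ₗ markD k G t.1

open Classical in
/-- The tree monomial `t` with marks `x`, as an element of the inclusion-exclusion operad. -/
noncomputable def marked {I : FinOrd} (t : TreeMonomial M I) (x : Marks k G t.1) :
    (inclusionExclusion k G).obj I :=
  DirectSum.lof k (TreeMonomial M I) (fun t => Marks k G t.1) t x

/-- The class of the tree monomial `t` in the operad with monomial relations. -/
noncomputable def monomialClass {I : FinOrd} (t : TreeMonomial M I) : (monomialOperad k G).obj I :=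
  (monomialIdeal k G I).mkQ (Finsupp.single t 1)

end InclusionExclusion

end ShuffleOperad

/-!
For a tree monomial `T` with `q` divisors in `G`, the complex at `T` is the Koszul complex `Λ(S₁,
…, S_q)` whose differential is the derivation with `d Sᵢ = 1`. If `q > 0`, multiplication by any
one of the `Sᵢ` is a contracting homotopy (`unmark_ι_mul`), so the complex is acyclic; if `q = 0`,
it is the field in degree zero. Hence the homology is spanned by the tree monomials without
divisors in `G`. The same holds for the quotient by the ideal generated by `G`: the ideal is
spanned by the tree monomials that have a divisor in `G`. Such monomials belong to the ideal
because a divisor can be isolated by cutting off the rest of the tree (`single_mem_of_isDivisor`),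
and their span is an ideal (`isIdeal_divisibleSpan`) because divisors of the factors are divisors
of a composition. The map to the quotient is the projection to the part without marks
(`augmentation`), and it is a quasi-isomorphism (`isQuasiIso_augmentationHom`).

The axioms of a dg operad for the inclusion-exclusion operad are checked on tree monomials marked
by lists of divisors (`monomial`). Those for the quotient follow, since the augmentation is
surjective.

Freeness comes from a basis with unique factorization. Tree monomials with a finite set of marked
divisors (`MarkedTree`) form a basis (`markedBasis`), and a composition of two elements of this
basis is, up to sign, an element of the basis again. An element is decomposable exactly when its
tree has an internal edge that belongs to no marked divisor, and the generators are the
indecomposable ones. Factorizations correspond to cuts of the tree at such edges. Two cuts of a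
tree are the same, nested, or independent (`Tree.graft_eq_graft`), and the marked divisors, which
are not cut, are distributed among the parts (`MarkedTree.comp_eq_comp`). So any two factorizations
have a common refinement of the shape of the axiom of sequential or of parallel composition. This
suffices for the universal property (`FactorizationBasis.isFree`): a map on generators is extended
along any iterated factorization, and by induction on the number of vertices the result does not
depend on the factorization (`FactorizationBasis.Value.unique`).
-/

namespace ShuffleOperad

/-! ### Finite ordered sets and their grafts -/

theorem FinOrd.least_mem (I : FinOrd) : I.least ∈ I.1 := Finset.min'_mem _ _

theorem FinOrd.least_single (i : ℕ) : (FinOrd.single i).least = i := by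
  simp [FinOrd.least, FinOrd.single]

theorem FinOrd.least_eq {I : FinOrd} {x : ℕ} (hx : x ∈ I.1) (h : ∀ y ∈ I.1, x ≤ y) :
    I.least = x :=
  le_antisymm (Finset.min'_le _ _ hx) (h _ I.least_mem)

theorem IsGraft.subset_left {I J K : FinOrd} (h : IsGraft I J K) : I.1 ⊆ K.1 :=
  h.union ▸ Finset.subset_union_left

theorem IsGraft.subset_right {I J K : FinOrd} (h : IsGraft I J K) : J.1 ⊆ K.1 :=
  h.union ▸ Finset.subset_union_right

theorem IsGraft.eq_least {I J K : FinOrd} (h : IsGraft I J K) {x : ℕ} (hI : x ∈ I.1)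
    (hJ : x ∈ J.1) : x = J.least :=
  Finset.mem_singleton.1 (h.inter ▸ Finset.mem_inter.2 ⟨hI, hJ⟩)

theorem IsGraft.eq_of_single_left {i : ℕ} {J K : FinOrd} (h : IsGraft (FinOrd.single i) J K) :
    J = K := by
  have h1 : J.least = i := by simpa [FinOrd.single] using h.least_mem
  apply Subtype.ext
  rw [← h.union]
  refine (Finset.union_eq_right.2 ?_).symm
  simpa [FinOrd.single, ← h1] using J.least_mem

theorem IsGraft.eq_of_single_right {i : ℕ} {I K : FinOrd} (h : IsGraft I (FinOrd.single i) K) :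
    I = K := by
  have h1 := h.least_mem
  rw [FinOrd.least_single] at h1
  apply Subtype.ext
  rw [← h.union]
  refine (Finset.union_eq_left.2 ?_).symm
  simpa [FinOrd.single] using h1

/-- The image of a graft under the order-preserving bijection from `K` to `K'`. -/
theorem IsGraft.exists_image {I J K K' : FinOrd} (h : IsGraft I J K) (hK : K.1.card = K'.1.card) :
    ∃ (I' J' : FinOrd), IsGraft I' J' K' ∧ I.1.card = I'.1.card ∧ J.1.card = J'.1.card ∧
      I.1.image (orderBij K K') = I'.1 ∧ J.1.image (orderBij K K') = J'.1 := by
  have he := orderBij_strictMonoOn hK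
  have hI := he.mono (Finset.coe_subset.2 h.subset_left)
  have hJ := he.mono (Finset.coe_subset.2 h.subset_right)
  refine ⟨⟨I.1.image (orderBij K K'), I.2.image _⟩, ⟨J.1.image (orderBij K K'), J.2.image _⟩,
    ⟨?_, ?_⟩, (Finset.card_image_of_injOn hI.injOn).symm,
    (Finset.card_image_of_injOn hJ.injOn).symm, rfl, rfl⟩
  · rw [FinOrd.least_eq (x := orderBij K K' J.least) (Finset.mem_image_of_mem _ J.least_mem)]
    · simp only
      rw [← Finset.image_inter_of_injOn, h.inter, Finset.image_singleton]
      rw [← Finset.coe_union, h.union]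
      exact he.injOn
    · intro y hy
      obtain ⟨x, hx, rfl⟩ := Finset.mem_image.1 hy
      exact hJ.monotoneOn J.least_mem hx (Finset.min'_le _ _ hx)
  · simp only
    rw [← Finset.image_union, h.union, image_orderBij hK]

/-! ### Freeness from unique factorization of basis elements -/

section FactorizationBasis

variable {k : Type u} [Field k]

/-- A homogeneous basis of a graded shuffle operad which is closed, up to invertible scalars, under
compositions and order-preserving bijections, whose elements have an additive size that vanishes
only on the units, and in which two factorizations of the same element into elements of positive
size either agree, or have a common refinement of one of the two shapes described by the axioms of
sequential and parallel composition. Elements of `Mon I` and `Mon I'` are compared by `HEq` where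
`I = I'` is part of the conclusion. -/
structure FactorizationBasis (P : GradedData.{u, w} k) where
  Mon : FinOrd → Type v
  basis : ∀ I, Module.Basis (Mon I) k (P.obj I)
  deg : ∀ {I}, Mon I → ℕ
  size : ∀ {I}, Mon I → ℕ
  comp : ∀ {I J K : FinOrd}, IsGraft I J K → Mon I → Mon J → Mon K
  relabel : ∀ {I J : FinOrd}, I.1.card = J.1.card → Mon I → Mon J
  deg_eq : ∀ I p, P.deg I p = Submodule.span k (basis I '' {b | deg b = p})
  exists_one : ∀ i, ∃ b : Mon (FinOrd.single i), size b = 0 ∧ basis _ b = P.one i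
  eq_one : ∀ {I} (b : Mon I), size b = 0 → deg b = 0 ∧
    ∃ i, I = FinOrd.single i ∧ HEq (basis I b) (P.one i)
  deg_comp : ∀ {I J K : FinOrd} (h : IsGraft I J K) b c, deg (comp h b c) = deg b + deg c
  size_comp : ∀ {I J K : FinOrd} (h : IsGraft I J K) b c, size (comp h b c) = size b + size c
  deg_relabel : ∀ {I J : FinOrd} (h : I.1.card = J.1.card) b, deg (relabel h b) = deg b
  size_relabel : ∀ {I J : FinOrd} (h : I.1.card = J.1.card) b, size (relabel h b) = size b
  basis_comp : ∀ {I J K : FinOrd} (h : IsGraft I J K) b c, ∃ r : kˣ,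
    P.comp h (basis I b) (basis J c) = r • basis K (comp h b c)
  basis_relabel : ∀ {I J : FinOrd} (h : I.1.card = J.1.card) b, ∃ r : kˣ,
    P.relabel h (basis I b) = r • basis J (relabel h b)
  refine : ∀ {I J I' J' K : FinOrd} (h : IsGraft I J K) (h' : IsGraft I' J' K)
    (b : Mon I) (c : Mon J) (b' : Mon I') (c' : Mon J'), size b ≠ 0 → size c ≠ 0 → size b' ≠ 0 →
    size c' ≠ 0 → comp h b c = comp h' b' c' →
    (I = I' ∧ J = J' ∧ HEq b b' ∧ HEq c c') ∨
    (∃ (L : FinOrd) (y : Mon L) (g : IsGraft I' L I) (g' : IsGraft L J J'),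
      size y ≠ 0 ∧ b = comp g b' y ∧ c' = comp g' y c) ∨
    (∃ (L : FinOrd) (y : Mon L) (g : IsGraft I L I') (g' : IsGraft L J' J),
      size y ≠ 0 ∧ b' = comp g b y ∧ c = comp g' y c') ∨
    (∃ (L : FinOrd) (x : Mon L) (g : IsGraft L J' I) (g' : IsGraft L J I'),
      J.least ≠ J'.least ∧ size x ≠ 0 ∧ b = comp g x c' ∧ b' = comp g' x c)

namespace FactorizationBasis

variable {P : GradedData.{u, w} k} (B : FactorizationBasis.{u, v, w} P)

/-- The elements of the basis, other than the units, that are not products of smaller ones. -/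
def Indecomposable {K : FinOrd} (b : B.Mon K) : Prop :=
  B.size b ≠ 0 ∧ ∀ {I J : FinOrd} (h : IsGraft I J K) (x : B.Mon I) (y : B.Mon J),
    B.size x ≠ 0 → B.size y ≠ 0 → B.comp h x y ≠ b

/-- The graded subcollection spanned by the indecomposable elements of the basis. -/
def generators (I : FinOrd) (p : ℕ) : Submodule k (P.obj I) :=
  Submodule.span k (B.basis I '' {b | B.Indecomposable b ∧ B.deg b = p})

theorem mem_generators {I : FinOrd} {b : B.Mon I} (hb : B.Indecomposable b) {p : ℕ}
    (hp : B.deg b = p) : B.basis I b ∈ B.generators I p :=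
  Submodule.subset_span ⟨b, ⟨hb, hp⟩, rfl⟩

theorem smul_basis_inj {I : FinOrd} {b c : B.Mon I} {r s : kˣ}
    (h : r • B.basis I b = s • B.basis I c) : b = c ∧ r = s := by
  have h1 := congrArg (fun x => (B.basis I).repr x) h
  simp only [Units.smul_def, map_smul, Module.Basis.repr_self, Finsupp.smul_single, smul_eq_mul,
    mul_one] at h1
  rw [Finsupp.single_eq_single_iff] at h1
  rcases h1 with h1 | h1
  · exact ⟨h1.1, Units.ext h1.2⟩
  · exact absurd h1.1 r.ne_zero

/-- Compatibility of `B.relabel` with `B.comp`. The factors of the relabelled composition are the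
same for the basis, for `P` and for every other operad `Q`, which is what an induction along
factorizations needs. -/
theorem relabel_comp (hP : IsGradedOperad P) {I J K K' : FinOrd} (h : IsGraft I J K)
    (hK : K.1.card = K'.1.card) (b : B.Mon I) (c : B.Mon J) :
    ∃ (I' J' : FinOrd) (h' : IsGraft I' J' K') (hI : I.1.card = I'.1.card)
      (hJ : J.1.card = J'.1.card),
      B.relabel hK (B.comp h b c) = B.comp h' (B.relabel hI b) (B.relabel hJ c) ∧
      (∀ x y, P.relabel hK (P.comp h x y) = P.comp h' (P.relabel hI x) (P.relabel hJ y)) ∧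
      ∀ {Q : GradedData.{u, w'} k}, IsGradedOperad Q → ∀ x y,
        Q.relabel hK (Q.comp h x y) = Q.comp h' (Q.relabel hI x) (Q.relabel hJ y) := by
  obtain ⟨I', J', h', hI, hJ, e1, e2⟩ := h.exists_image hK
  have key := hP.relabel_comp h h' _ (orderBij_strictMonoOn hK)
    e1 e2 (image_orderBij hK) hI hJ hK
  refine ⟨I', J', h', hI, hJ, ?_, key, fun hQ x y =>
    hQ.relabel_comp h h' _ (orderBij_strictMonoOn hK) e1 e2 (image_orderBij hK) hI hJ hK x y⟩
  specialize key (B.basis I b) (B.basis J c)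
  obtain ⟨r1, h1⟩ := B.basis_comp h b c
  obtain ⟨r2, h2⟩ := B.basis_relabel hK (B.comp h b c)
  obtain ⟨r3, h3⟩ := B.basis_relabel hI b
  obtain ⟨r4, h4⟩ := B.basis_relabel hJ c
  obtain ⟨r5, h5⟩ := B.basis_comp h' (B.relabel hI b) (B.relabel hJ c)
  simp only [h1, h2, h3, h4, h5, Units.smul_def, map_smul, LinearMap.smul_apply, smul_smul] at key
  exact (B.smul_basis_inj (r := r1 * r2) (s := r4 * (r3 * r5))
    (by simpa only [Units.smul_def, Units.val_mul] using key)).1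

theorem relabel_relabel (hP : IsGradedOperad P) {I J : FinOrd} (h : I.1.card = J.1.card)
    (b : B.Mon I) : B.relabel h.symm (B.relabel h b) = b := by
  obtain ⟨r1, h1⟩ := B.basis_relabel h b
  obtain ⟨r2, h2⟩ := B.basis_relabel h.symm (B.relabel h b)
  have key := hP.relabel_trans h h.symm (B.basis I b)
  rw [hP.relabel_refl, h1, Units.smul_def, map_smul, h2, Units.smul_def, smul_smul] at key
  exact (B.smul_basis_inj (r := r1 * r2) (s := 1)
    (by simpa only [Units.smul_def, Units.val_mul, Units.val_one, one_smul] using key)).1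

theorem Indecomposable.relabel (hP : IsGradedOperad P) {I J : FinOrd} (h : I.1.card = J.1.card)
    {b : B.Mon I} (hb : B.Indecomposable b) : B.Indecomposable (B.relabel h b) := by
  refine ⟨by rw [B.size_relabel]; exact hb.1, fun g x y hx hy hxy => ?_⟩
  obtain ⟨I', J', h', hI, hJ, e, -, -⟩ := relabel_comp.{u, v, w, w} B hP g h.symm x y
  rw [hxy, B.relabel_relabel hP] at e
  exact hb.2 h' _ _ (by rwa [B.size_relabel]) (by rwa [B.size_relabel]) e.symm

theorem relabel_mem_generators (hP : IsGradedOperad P) {I J : FinOrd} (h : I.1.card = J.1.card)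
    (p : ℕ) : ∀ a ∈ B.generators I p, P.relabel h a ∈ B.generators J p := by
  intro a ha
  induction ha using Submodule.span_induction with
  | mem x hx =>
    obtain ⟨b, ⟨hb, hp⟩, rfl⟩ := hx
    obtain ⟨r, hr⟩ := B.basis_relabel h b
    rw [hr, Units.smul_def]
    exact Submodule.smul_mem _ _ (B.mem_generators (hb.relabel B hP h)
      ((B.deg_relabel h b).trans hp))
  | zero => rw [map_zero]; exact Submodule.zero_mem _
  | add x y _ _ hx hy => rw [map_add]; exact Submodule.add_mem _ hx hy
  | smul r x _ hx => rw [map_smul]; exact Submodule.smul_mem _ _ hx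

section Extension

variable {Q : GradedData.{u, w'} k} (f : ∀ I p, B.generators I p →ₗ[k] Q.obj I)

/-- `B.Value f b x` means that `x` can be computed as the value at `b` of a morphism extending `f`,
by means of some iterated factorization of `b` into indecomposable elements. The scalars `r` are
those by which the products of the elements of the basis differ from elements of the basis. -/
inductive Value : ∀ {I : FinOrd}, B.Mon I → Q.obj I → Prop
  | one {I : FinOrd} (b : B.Mon I) (x : Q.obj I) (i : ℕ) (hb : B.size b = 0)
      (hI : I = FinOrd.single i) (hx : HEq x (Q.one i)) : Value b x
  | gen {I : FinOrd} (b : B.Mon I) (p : ℕ) (hb : B.Indecomposable b) (hp : B.deg b = p) :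
      Value b (f I p ⟨B.basis I b, B.mem_generators hb hp⟩)
  | comp {I J K : FinOrd} (h : IsGraft I J K) (b : B.Mon I) (c : B.Mon J) (a : B.Mon K)
      (x : Q.obj I) (y : Q.obj J) (r : kˣ) (hb : B.size b ≠ 0) (hc : B.size c ≠ 0)
      (ha : B.comp h b c = a) (hr : P.comp h (B.basis I b) (B.basis J c) = r • B.basis K a)
      (hx : Value b x) (hy : Value c y) : Value a ((r⁻¹ : kˣ) • Q.comp h x y)

variable {f}

/-- Every element of the basis has a factorization into indecomposable elements, by induction on
the size. -/
theorem exists_value {I : FinOrd} (b : B.Mon I) : ∃ x, B.Value f b x := by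
  induction hn : B.size b using Nat.strong_induction_on generalizing I with
  | _ n ih =>
    by_cases h0 : B.size b = 0
    · obtain ⟨i, rfl, -⟩ := (B.eq_one b h0).2
      exact ⟨_, .one b _ i h0 rfl HEq.rfl⟩
    · by_cases hb : B.Indecomposable b
      · exact ⟨_, .gen b _ hb rfl⟩
      · simp only [Indecomposable, not_and, not_forall, not_not] at hb
        obtain ⟨J, L, h, x, y, hx, hy, rfl⟩ := hb h0
        have hs := B.size_comp h x y
        obtain ⟨x', hx'⟩ := ih (B.size x) (by omega) x rfl
        obtain ⟨y', hy'⟩ := ih (B.size y) (by omega) y rfl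
        obtain ⟨r, hr⟩ := B.basis_comp h x y
        exact ⟨_, .comp h x y _ x' y' r hx hy rfl hr hx' hy'⟩

theorem Value.mem_deg (hQ : IsGradedOperad Q) (hf : ∀ I p a, f I p a ∈ Q.deg I p) {I : FinOrd}
    {b : B.Mon I} {x : Q.obj I} (h : B.Value f b x) : x ∈ Q.deg I (B.deg b) := by
  induction h with
  | @one I b x i hb hI hx =>
    subst hI
    obtain rfl := eq_of_heq hx
    rw [(B.eq_one b hb).1]
    exact hQ.one_deg i
  | gen b p hb hp => subst hp; exact hf _ _ _
  | comp h b c a x y r hb hc ha hr hx hy ihx ihy =>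
    subst ha
    rw [B.deg_comp, Units.smul_def]
    exact Submodule.smul_mem _ _ (hQ.comp_deg h _ _ _ ihx _ ihy)

/-- A value at `b` gives a value at each relabelling of `b`. -/
theorem Value.relabel (hP : IsGradedOperad P) (hQ : IsGradedOperad Q)
    (hf : ∀ {I J : FinOrd} (h : I.1.card = J.1.card) (p : ℕ) (a : B.generators I p),
      f J p ⟨P.relabel h a, B.relabel_mem_generators hP h p a a.2⟩ = Q.relabel h (f I p a))
    {I : FinOrd} {b : B.Mon I} {x : Q.obj I} (hx : B.Value f b x) {J : FinOrd}
    (h : I.1.card = J.1.card) (r : kˣ)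
    (hr : P.relabel h (B.basis I b) = r • B.basis J (B.relabel h b)) :
    B.Value f (B.relabel h b) ((r⁻¹ : kˣ) • Q.relabel h x) := by
  induction hx generalizing J r with
  | @one I b x i hb hI hx =>
    subst hI
    obtain rfl := eq_of_heq hx
    have hs : B.size (B.relabel h b) = 0 := by rw [B.size_relabel, hb]
    obtain ⟨-, j, rfl, hj⟩ := B.eq_one _ hs
    obtain ⟨-, i', hi, he⟩ := B.eq_one b hb
    obtain rfl : i = i' := by simpa [FinOrd.single] using congrArg Subtype.val hi
    have hr1 : r = 1 := by
      rw [eq_of_heq he, hP.relabel_one, ← eq_of_heq hj] at hr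
      exact (B.smul_basis_inj ((one_smul kˣ _).trans hr)).2.symm
    refine .one _ _ j hs rfl ?_
    rw [hr1, inv_one, one_smul, hQ.relabel_one]
  | gen b p hb hp =>
    have := Value.gen (f := f) (B.relabel h b) p (hb.relabel B hP h) ((B.deg_relabel h b).trans hp)
    convert this using 1
    rw [← hf, Units.smul_def, ← map_smul]
    congr 1
    apply Subtype.ext
    simp only [hr, ← Units.smul_def]
    rw [Units.smul_def, SetLike.val_smul, ← Units.smul_def, inv_smul_smul]
  | comp g b c a x y s hb hc ha hs hx hy ihx ihy =>
    subst ha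
    obtain ⟨I', J', g', hI, hJ, e, eP, eQ⟩ := relabel_comp.{u, v, w, w'} B hP g h b c
    obtain ⟨s1, h1⟩ := B.basis_relabel hI b
    obtain ⟨s2, h2⟩ := B.basis_relabel hJ c
    obtain ⟨s3, h3⟩ := B.basis_comp g' (B.relabel hI b) (B.relabel hJ c)
    have hv := Value.comp g' _ _ _ _ _ s3 (by rwa [B.size_relabel]) (by rwa [B.size_relabel])
      e.symm (e ▸ h3) (ihx hI s1 h1) (ihy hJ s2 h2)
    convert hv using 1
    have key := eP (B.basis _ b) (B.basis _ c)
    rw [hs, h1, h2, Units.smul_def, map_smul, hr] at key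
    simp only [Units.smul_def, map_smul, LinearMap.smul_apply, h3, smul_smul] at key
    have hu := (B.smul_basis_inj (r := s * r) (s := s2 * (s1 * s3))
      (by simpa only [Units.smul_def, Units.val_mul] using key)).2
    simp only [Units.smul_def, map_smul, LinearMap.smul_apply, smul_smul, eQ hQ,
      ← Units.val_mul, ← mul_inv, mul_comm r s, hu]
    congr 3
    ac_rfl

/-- If two factorizations of `a` have a common refinement `b' ∘ y ∘ c`, the values computed from
them agree by the associativity of sequential compositions in `Q`; the scalars match since the same
axiom holds in `P`. -/
theorem Value.eq_of_nested (hP : IsGradedOperad P) (hQ : IsGradedOperad Q)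
    {I J I' J' K L : FinOrd} {h : IsGraft I J K} {h' : IsGraft I' J' K} {g : IsGraft I' L I}
    {g' : IsGraft L J J'} {b' : B.Mon I'} {y : B.Mon L} {c : B.Mon J} {a : B.Mon K}
    {x' : Q.obj I'} {z : Q.obj L} {t : Q.obj J} {x : Q.obj I} {t' : Q.obj J'} {r r' s s' : kˣ}
    (hr : P.comp h (B.basis I (B.comp g b' y)) (B.basis J c) = r • B.basis K a)
    (hr' : P.comp h' (B.basis I' b') (B.basis J' (B.comp g' y c)) = r' • B.basis K a)
    (hs : P.comp g (B.basis I' b') (B.basis L y) = s • B.basis I (B.comp g b' y))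
    (hs' : P.comp g' (B.basis L y) (B.basis J c) = s' • B.basis J' (B.comp g' y c))
    (hx : x = (s⁻¹ : kˣ) • Q.comp g x' z) (ht : t' = (s'⁻¹ : kˣ) • Q.comp g' z t) :
    (r⁻¹ : kˣ) • Q.comp h x t = (r'⁻¹ : kˣ) • Q.comp h' x' t' := by
  have key := hP.comp_assoc g h g' h' (B.basis _ b') (B.basis _ y) (B.basis _ c)
  rw [hs, hs', Units.smul_def, Units.smul_def, map_smul, map_smul, LinearMap.smul_apply, hr, hr',
    ← Units.smul_def, ← Units.smul_def, smul_smul, smul_smul] at key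
  have hu := (B.smul_basis_inj key).2
  subst hx ht
  simp only [Units.smul_def, map_smul, LinearMap.smul_apply, smul_smul, hQ.comp_assoc g h g' h',
      ← Units.val_mul, ← mul_inv]
  rw [mul_comm r s, hu, mul_comm]

/-- If two factorizations of `a` are obtained by inserting `c` and `c'` in different inputs of `b`,
the values computed from them agree by the axiom of parallel composition in `Q`, with the same
Koszul sign as in `P`. -/
theorem Value.eq_of_parallel (hP : IsGradedOperad P) (hQ : IsGradedOperad Q)
    {I J I' J' K L : FinOrd} {h : IsGraft I J K} {h' : IsGraft I' J' K} {g : IsGraft L J' I}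
    {g' : IsGraft L J I'} (hJ : J.least ≠ J'.least) {b : B.Mon L} {c : B.Mon J} {c' : B.Mon J'}
    {a : B.Mon K} {z : Q.obj L} {t : Q.obj J} {t' : Q.obj J'} {x : Q.obj I} {x' : Q.obj I'}
    {r r' s s' : kˣ}
    (hr : P.comp h (B.basis I (B.comp g b c')) (B.basis J c) = r • B.basis K a)
    (hr' : P.comp h' (B.basis I' (B.comp g' b c)) (B.basis J' c') = r' • B.basis K a)
    (hs : P.comp g (B.basis L b) (B.basis J' c') = s • B.basis I (B.comp g b c'))
    (hs' : P.comp g' (B.basis L b) (B.basis J c) = s' • B.basis I' (B.comp g' b c))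
    (hx : x = (s⁻¹ : kˣ) • Q.comp g z t') (hx' : x' = (s'⁻¹ : kˣ) • Q.comp g' z t)
    (ht : t ∈ Q.deg J (B.deg c)) (ht' : t' ∈ Q.deg J' (B.deg c')) :
    (r⁻¹ : kˣ) • Q.comp h x t = (r'⁻¹ : kˣ) • Q.comp h' x' t' := by
  have hd : ∀ {I : FinOrd} (b : B.Mon I), B.basis I b ∈ P.deg I (B.deg b) := fun b => by
    rw [B.deg_eq]; exact Submodule.subset_span ⟨b, rfl, rfl⟩
  have key := hP.comp_comm g h g' h' hJ.symm _ _ (B.basis _ b) _ (hd c') _ (hd c)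
  obtain ⟨e, he⟩ : ∃ e : kˣ, (-1 : k) ^ (B.deg c' * B.deg c) = e :=
    ⟨(-1) ^ (B.deg c' * B.deg c), by simp⟩
  rw [hs, hs', he, Units.smul_def, Units.smul_def, map_smul, map_smul, LinearMap.smul_apply,
    LinearMap.smul_apply, hr, hr', ← Units.smul_def, ← Units.smul_def, ← Units.smul_def,
    smul_smul, smul_smul, smul_smul] at key
  have hu := (B.smul_basis_inj key).2
  subst hx hx'
  simp only [Units.smul_def, map_smul, LinearMap.smul_apply, smul_smul,
    hQ.comp_comm g h g' h' hJ.symm _ _ z _ ht' _ ht, he, ← Units.val_mul, ← mul_inv]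
  congr 2
  calc r⁻¹ * (s⁻¹ * e) = (s * r)⁻¹ * e := by rw [mul_inv_rev, mul_assoc]
    _ = (r' * s')⁻¹ := by rw [hu, mul_assoc, mul_inv_rev, inv_mul_cancel_right, mul_comm s']

/-- The value does not depend on the choice of the factorization: two factorizations of the same
element have a common refinement, whose factors are smaller, so that induction on the size applies
to them. -/
theorem Value.unique (hP : IsGradedOperad P) (hQ : IsGradedOperad Q)
    (hf : ∀ I p a, f I p a ∈ Q.deg I p) {I : FinOrd}
    {b : B.Mon I} {x x' : Q.obj I} (hx : B.Value f b x) (hx' : B.Value f b x') : x = x' := by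
  induction hn : B.size b using Nat.strong_induction_on generalizing I with
  | _ n ih =>
    cases hx with
    | one _ _ i hb hI hx =>
      cases hx' with
      | one _ _ i' hb' hI' hx' =>
        obtain rfl : i = i' := by
          simpa [FinOrd.single] using congrArg Subtype.val (hI.symm.trans hI')
        exact eq_of_heq (hx.trans hx'.symm)
      | gen _ _ hb' => exact absurd hb hb'.1
      | comp h c d _ _ _ _ hc hd ha => rw [← ha, B.size_comp] at hb; omega
    | gen _ p hb hp =>
      cases hx' with
      | one _ _ _ hb' => exact absurd hb' hb.1
      | gen _ p' _ hp' => subst hp hp'; rfl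
      | comp h c d _ _ _ _ hc hd ha => exact absurd ha (hb.2 h c d hc hd)
    | comp h c d _ x y r hc hd ha hr hx hy =>
      cases hx' with
      | one _ _ _ hb => rw [← ha, B.size_comp] at hb; omega
      | gen _ _ hb => exact absurd ha (hb.2 h c d hc hd)
      | comp h' c' d' _ x' y' r' hc' hd' ha' hr' hx' hy' =>
        have h1 := B.size_comp h c d
        have h2 := B.size_comp h' c' d'
        rw [ha] at h1
        rw [ha'] at h2
        rcases B.refine h h' c d c' d' hc hd hc' hd' (ha.trans ha'.symm) with
          ⟨rfl, rfl, e1, e2⟩ | ⟨L, z, g, g', hz, rfl, rfl⟩ | ⟨L, z, g, g', hz, rfl, rfl⟩ |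
            ⟨L, z, g, g', hJ, hz, rfl, rfl⟩
        · obtain rfl := eq_of_heq e1
          obtain rfl := eq_of_heq e2
          obtain rfl := ih _ (by omega) hx hx' rfl
          obtain rfl := ih _ (by omega) hy hy' rfl
          rw [hr] at hr'
          rw [(B.smul_basis_inj hr').2]
        · obtain ⟨v, hv⟩ := B.exists_value (f := f) z
          obtain ⟨s, hs⟩ := B.basis_comp g c' z
          obtain ⟨s', hs'⟩ := B.basis_comp g' z d
          exact Value.eq_of_nested B hP hQ hr hr' hs hs'
            (ih _ (by omega) hx (.comp g _ _ _ _ _ s hc' hz rfl hs hx' hv) rfl)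
            (ih _ (by omega) hy' (.comp g' _ _ _ _ _ s' hz hd rfl hs' hv hy) rfl)
        · obtain ⟨v, hv⟩ := B.exists_value (f := f) z
          obtain ⟨s, hs⟩ := B.basis_comp g c z
          obtain ⟨s', hs'⟩ := B.basis_comp g' z d'
          exact (Value.eq_of_nested B hP hQ hr' hr hs hs'
            (ih _ (by omega) hx' (.comp g _ _ _ _ _ s hc hz rfl hs hx hv) rfl)
            (ih _ (by omega) hy (.comp g' _ _ _ _ _ s' hz hd' rfl hs' hv hy') rfl)).symm
        · obtain ⟨v, hv⟩ := B.exists_value (f := f) z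
          obtain ⟨s, hs⟩ := B.basis_comp g z d'
          obtain ⟨s', hs'⟩ := B.basis_comp g' z d
          exact Value.eq_of_parallel B hP hQ hJ hr hr' hs hs'
            (ih _ (by omega) hx (.comp g _ _ _ _ _ s hz hd' rfl hs hv hy') rfl)
            (ih _ (by omega) hx' (.comp g' _ _ _ _ _ s' hz hd rfl hs' hv hy) rfl)
            (hy.mem_deg B hQ hf) (hy'.mem_deg B hQ hf)

end Extension

/-- The indecomposable elements generate `P`. -/
theorem hom_ext {Q : GradedData.{u, w'} k} {F F' : GradedHom P Q}
    (h : ∀ I p, ∀ a ∈ B.generators I p, F.toFun I a = F'.toFun I a) : F = F' := by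
  have key : ∀ n, ∀ I (b : B.Mon I), B.size b = n →
      F.toFun I (B.basis I b) = F'.toFun I (B.basis I b) := by
    intro n
    induction n using Nat.strong_induction_on with
    | _ n ih =>
      intro I b hn
      by_cases h0 : B.size b = 0
      · obtain ⟨-, i, rfl, he⟩ := B.eq_one b h0
        rw [eq_of_heq he, F.map_one, F'.map_one]
      · by_cases hb : B.Indecomposable b
        · exact h I _ _ (B.mem_generators hb rfl)
        · simp only [Indecomposable, not_and, not_forall, not_not] at hb
          obtain ⟨J, L, h, x, y, hx, hy, rfl⟩ := hb h0
          have hs := B.size_comp h x y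
          obtain ⟨r, hr⟩ := B.basis_comp h x y
          have e : B.basis I (B.comp h x y) =
              (↑(r⁻¹) : k) • P.comp h (B.basis _ x) (B.basis _ y) := by
            rw [hr, ← Units.smul_def, inv_smul_smul]
          rw [e, map_smul, map_smul, F.map_comp, F'.map_comp, ih _ (by omega) _ x rfl,
            ih _ (by omega) _ y rfl]
  have : F.toFun = F'.toFun := by
    funext I
    exact (B.basis I).ext fun b => key _ I b rfl
  cases F
  cases F'
  cases this
  rfl

/-- The morphism extending `f`: it sends each element of the basis to its value. -/
theorem exists_hom (hP : IsGradedOperad P) {Q : GradedData.{u, w'} k} (hQ : IsGradedOperad Q)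
    (f : ∀ I p, B.generators I p →ₗ[k] Q.obj I) (hdeg : ∀ I p a, f I p a ∈ Q.deg I p)
    (hrel : ∀ {I J : FinOrd} (h : I.1.card = J.1.card) (p : ℕ) (a : B.generators I p),
      f J p ⟨P.relabel h a, B.relabel_mem_generators hP h p a a.2⟩ = Q.relabel h (f I p a)) :
    ∃ F : GradedHom P Q, ∀ I p (a : B.generators I p), F.toFun I a = f I p a := by
  choose val hval using fun I (b : B.Mon I) => B.exists_value (f := f) b
  have huniq : ∀ {I} {b : B.Mon I} {x}, B.Value f b x → val I b = x := fun hx =>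
    (hval _ _).unique B hP hQ hdeg hx
  let F : ∀ I, P.obj I →ₗ[k] Q.obj I := fun I => (B.basis I).constr k (val I)
  have hF : ∀ I b, F I (B.basis I b) = val I b := fun I b => (B.basis I).constr_basis k _ b
  have hone : ∀ i, F _ (P.one i) = Q.one i := fun i => by
    obtain ⟨b, hb, hb'⟩ := B.exists_one i
    rw [← hb', hF]
    exact huniq (.one b _ i hb rfl HEq.rfl)
  refine ⟨⟨F, ?_, ?_, hone, ?_⟩, ?_⟩
  · intro I p a ha
    rw [B.deg_eq] at ha
    induction ha using Submodule.span_induction with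
    | mem x hx =>
      obtain ⟨b, rfl, rfl⟩ := hx
      rw [hF]
      exact (hval I b).mem_deg B hQ hdeg
    | zero => rw [map_zero]; exact Submodule.zero_mem _
    | add x y _ _ hx hy => rw [map_add]; exact Submodule.add_mem _ hx hy
    | smul r x _ hx => rw [map_smul]; exact Submodule.smul_mem _ _ hx
  · intro I J h a
    suffices F J ∘ₗ P.relabel h = Q.relabel h ∘ₗ F I from LinearMap.congr_fun this a
    refine (B.basis I).ext fun b => ?_
    obtain ⟨r, hr⟩ := B.basis_relabel h b
    rw [LinearMap.comp_apply, LinearMap.comp_apply, hF, hr, Units.smul_def, map_smul, hF,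
      huniq ((hval I b).relabel B hP hQ hrel h r hr), ← Units.smul_def, smul_inv_smul]
  · intro I J K h a a'
    suffices (P.comp h).compr₂ (F K) = (Q.comp h).compl₁₂ (F I) (F J) from
      LinearMap.congr_fun₂ this a a'
    refine (B.basis I).ext fun b => (B.basis J).ext fun c => ?_
    simp only [LinearMap.compr₂_apply, LinearMap.compl₁₂_apply]
    -- `Value.comp` covers factors of positive size only; the unit axioms cover the others.
    by_cases hb : B.size b = 0
    · obtain ⟨-, i, rfl, he⟩ := B.eq_one b hb
      obtain rfl := h.eq_of_single_left
      rw [eq_of_heq he, hP.one_comp, hone, hQ.one_comp]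
    by_cases hc : B.size c = 0
    · obtain ⟨-, i, rfl, he⟩ := B.eq_one c hc
      obtain rfl := h.eq_of_single_right
      rw [eq_of_heq he, hP.comp_one, hone, hQ.comp_one]
    obtain ⟨r, hr⟩ := B.basis_comp h b c
    rw [hr, hF, hF, Units.smul_def, map_smul, hF,
      huniq (.comp h b c _ _ _ r hb hc rfl hr (hval I b) (hval J c)), ← Units.smul_def,
      smul_inv_smul]
  · rintro I p ⟨a, ha⟩
    simp only
    have hle : ∀ b : B.Mon I, ∀ hb : b ∈ {b | B.Indecomposable b ∧ B.deg b = p},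
        F I (B.basis I b) = f I p ⟨B.basis I b, B.mem_generators hb.1 hb.2⟩ := fun b hb => by
      rw [hF]
      exact huniq (.gen b p hb.1 hb.2)
    induction ha using Submodule.span_induction with
    | mem x hx =>
      obtain ⟨b, hb, rfl⟩ := hx
      exact hle b hb
    | zero => rw [map_zero]; exact (map_zero (f I p)).symm
    | add x y hx hy hx' hy' => rw [map_add, hx', hy']; exact (map_add (f I p) ⟨x, hx⟩ ⟨y, hy⟩).symm
    | smul r x hx hx' => rw [map_smul, hx']; exact (map_smul (f I p) r ⟨x, hx⟩).symm

/-- An operad with a factorization basis is freely generated by the span of the indecomposable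
elements of this basis. -/
theorem isFree (B : FactorizationBasis.{u, v, w} P) (hP : IsGradedOperad P) :
    IsFree.{u, w, w'} P := by
  refine ⟨B.generators, ⟨fun I p => ?_, B.relabel_mem_generators hP, ?_⟩⟩
  · rw [B.deg_eq]
    exact Submodule.span_mono (Set.image_mono fun b hb => hb.2)
  · intro Q hQ f hdeg hrel
    obtain ⟨F, hF⟩ := B.exists_hom hP hQ f hdeg hrel
    exact ⟨F, hF, fun F' hF' => B.hom_ext fun I p a ha =>
      (hF' I p ⟨a, ha⟩).trans (hF I p ⟨a, ha⟩).symm⟩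

end FactorizationBasis
end FactorizationBasis
end ShuffleOperad

namespace ShuffleOperad

/-! ### Grafting of trees -/

namespace Tree

variable {M : ℕ → Type v}

theorem Canonical.index_unique {n : ℕ} {m : M (n + 1)} {c : Fin (n + 1) → Tree M}
    (h : (node n m c).Canonical) {i i' : Fin (n + 1)} {x : ℕ} (hx : x ∈ (c i).leaves)
    (hx' : x ∈ (c i').leaves) : i = i' := by
  rcases lt_trichotomy i i' with hi | hi | hi
  · exact absurd hx' (Finset.disjoint_left.1 (h.2 _ _ hi).1 hx)
  · exact hi
  · exact absurd hx (Finset.disjoint_left.1 (h.2 _ _ hi).1 hx')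

theorem address_node {n : ℕ} {m : M (n + 1)} {c : Fin (n + 1) → Tree M}
    (h : (node n m c).Canonical) {i : Fin (n + 1)} {j : ℕ} (hj : j ∈ (c i).leaves) :
    (node n m c).address j = i.1 :: (c i).address j := by
  have hex : ∃ i, j ∈ (c i).leaves := ⟨i, hj⟩
  have : hex.choose = i := h.index_unique hex.choose_spec hj
  simp only [address, hex, dif_pos, this]

theorem mapLeaves_congr {e e' : ℕ → ℕ} {t : Tree M} (h : ∀ x ∈ t.leaves, e x = e' x) :
    t.mapLeaves e = t.mapLeaves e' := by
  induction t with
  | leaf i => simp only [mapLeaves, h i (by simp [leaves])]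
  | node n m c ih =>
    simp only [mapLeaves]
    congr 1
    funext i
    exact ih i fun x hx => h x (leaves_child_subset i hx)

theorem mapLeaves_eq_self {e : ℕ → ℕ} {t : Tree M} (h : ∀ x ∈ t.leaves, e x = x) :
    t.mapLeaves e = t := by
  induction t with
  | leaf i => simp only [mapLeaves, h i (by simp [leaves])]
  | node n m c ih =>
    simp only [mapLeaves]
    congr 1
    funext i
    exact ih i fun x hx => h x (leaves_child_subset i hx)

theorem address_mapLeaves {e : ℕ → ℕ} {t : Tree M} (ht : t.Canonical)
    (he : StrictMonoOn e (t.leaves : Set ℕ)) {j : ℕ} (hj : j ∈ t.leaves) :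
    (t.mapLeaves e).address (e j) = t.address j := by
  induction t with
  | leaf i => rfl
  | node n m c ih =>
    obtain ⟨i, hi⟩ := mem_leaves_node.1 hj
    rw [address_node ht hi]
    have hc := ht.mapLeaves he
    simp only [mapLeaves] at hc ⊢
    rw [address_node hc (i := i) (by rw [leaves_mapLeaves]; exact Finset.mem_image_of_mem _ hi),
      ih i (ht.1 i) (he.mono (Finset.coe_subset.2 (leaves_child_subset i))) hi]

theorem address_graft_right {s t : Tree M} {j l : ℕ} (ht : t.Canonical)
    (hc : (graft s j t).Canonical) (hj : j ∈ t.leaves) (hl : l ∈ s.leaves) :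
    (graft s j t).address l = t.address j ++ s.address l := by
  induction t with
  | leaf i =>
    have : i = j := by simpa [leaves, eq_comm] using hj
    simp [graft, address, this]
  | node n m c ih =>
    obtain ⟨i, hi⟩ := mem_leaves_node.1 hj
    rw [address_node ht hi]
    simp only [graft] at hc ⊢
    rw [address_node hc (i := i) (mem_leaves_graft.2 (Or.inr ⟨hi, hl⟩)),
      ih i (ht.1 i) (hc.1 i) hi, List.cons_append]

theorem address_graft_left {s t : Tree M} {j l : ℕ} (ht : t.Canonical)
    (hc : (graft s j t).Canonical) (hl : l ∈ t.leaves) (hlj : l ≠ j) :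
    (graft s j t).address l = t.address l := by
  induction t with
  | leaf i =>
    have : i = l := by simpa [leaves, eq_comm] using hl
    subst this
    simp [graft, address, hlj]
  | node n m c ih =>
    obtain ⟨i, hi⟩ := mem_leaves_node.1 hl
    rw [address_node ht hi]
    simp only [graft] at hc ⊢
    rw [address_node hc (i := i) (mem_leaves_graft.2 (Or.inl ⟨hi, hlj⟩)),
      ih i (ht.1 i) (hc.1 i) hi]

theorem graft_leaf_self (j : ℕ) (t : Tree M) : graft (leaf j) j t = t := by
  induction t with
  | leaf i => simp only [graft]; split_ifs with h <;> simp [h]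
  | node n m c ih => simp only [graft, ih]

/-- Sequential grafting. In a composition of tree monomials the only leaf which `t` may share with
`s` is `j`, hence the form of the hypothesis. -/
theorem graft_graft {s t u : Tree M} {j l : ℕ} (h : l ∈ t.leaves → l = j) :
    graft u l (graft s j t) = graft (graft u l s) j t := by
  induction t with
  | leaf i =>
    by_cases hi : i = j
    · simp [graft, hi]
    · have : i ≠ l := by
        rintro rfl
        exact hi (h (by simp [leaves]))
      simp [graft, hi, this]
  | node n m c ih =>
    simp only [graft]
    congr 1
    funext i
    exact ih i fun hl => h (leaves_child_subset i hl)

theorem graft_comm {s t u : Tree M} {j l : ℕ} (hjl : j ≠ l) (hj : j ∉ u.leaves)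
    (hl : l ∉ s.leaves) : graft u l (graft s j t) = graft s j (graft u l t) := by
  induction t with
  | leaf i =>
    by_cases hi : i = j
    · subst hi
      simp [graft, hjl, graft_of_notMem hl]
    · by_cases hi' : i = l
      · subst hi'
        simp [graft, hi, graft_of_notMem hj]
      · simp [graft, hi, hi']
  | node n m c ih => simp only [graft, ih]

theorem mapLeaves_graft {e : ℕ → ℕ} {s t : Tree M} {j : ℕ} (hj : j ∈ t.leaves)
    (he : Set.InjOn e (t.leaves : Set ℕ)) :
    (graft s j t).mapLeaves e = graft (s.mapLeaves e) (e j) (t.mapLeaves e) := by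
  suffices ∀ t' : Tree M, t'.leaves ⊆ t.leaves →
      (graft s j t').mapLeaves e = graft (s.mapLeaves e) (e j) (t'.mapLeaves e) from
    this t subset_rfl
  intro t' ht'
  induction t' with
  | leaf i =>
    have hi : i ∈ t.leaves := ht' (by simp [leaves])
    by_cases h : i = j
    · simp [graft, mapLeaves, h]
    · have : e i ≠ e j := fun h' => h (he hi hj h')
      simp [graft, mapLeaves, h, this]
  | node n m c ih =>
    simp only [graft, mapLeaves]
    congr 1
    funext i
    exact ih i ((leaves_child_subset i).trans ht')

theorem leaves_subset_graft {s t : Tree M} {j : ℕ} (hs : s.minLeaf = j) :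
    t.leaves ⊆ (graft s j t).leaves := by
  intro x hx
  rw [mem_leaves_graft]
  by_cases h : x = j
  · subst h
    exact Or.inr ⟨hx, hs ▸ s.minLeaf_mem⟩
  · exact Or.inl ⟨hx, h⟩

theorem Canonical.of_graft {s t : Tree M} {j : ℕ} (hs : s.minLeaf = j)
    (h : (Tree.graft s j t).Canonical) : t.Canonical := by
  induction t with
  | leaf i => trivial
  | node n m c ih =>
    refine ⟨fun i => ih i (h.1 i), fun a b hab => ?_⟩
    obtain ⟨h1, h2⟩ := h.2 a b hab
    rw [minLeaf_graft hs, minLeaf_graft hs] at h2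
    exact ⟨h1.mono (leaves_subset_graft hs) (leaves_subset_graft hs), h2⟩

/-! ### Vertices of grafts -/

/-- No vertex lies above a leaf. -/
theorem address_append_notMem {t : Tree M} {j : ℕ} (hj : j ∈ t.leaves) (v : List ℕ) :
    t.address j ++ v ∉ t.vertices := by
  induction t with
  | leaf i => simp [vertices]
  | node n m c ih =>
    have h := mem_leaves_node.1 hj
    simp only [address, h, dif_pos, List.cons_append, mem_vertices_node]
    rintro (h' | ⟨i, y, hy, h'⟩)
    · exact List.cons_ne_nil _ _ h'
    · obtain ⟨h1, rfl⟩ := List.cons.inj h'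
      obtain rfl := Fin.ext h1
      exact ih _ h.choose_spec hy

theorem mem_vertices_graft {s t : Tree M} {j : ℕ} (ht : t.Canonical) (hj : j ∈ t.leaves)
    {v : List ℕ} : v ∈ (graft s j t).vertices ↔
      v ∈ t.vertices ∨ ∃ x ∈ s.vertices, t.address j ++ x = v := by
  refine ⟨fun hv => ?_, ?_⟩
  · induction t generalizing v with
    | leaf i =>
      have : i = j := by simpa [leaves, eq_comm] using hj
      simpa [graft, address, vertices, this] using hv
    | node n m c ih =>
      obtain ⟨a, ha⟩ := mem_leaves_node.1 hj
      rw [address_node ht ha, mem_vertices_node]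
      rw [graft, mem_vertices_node] at hv
      rcases hv with hv | ⟨i, y, hy, rfl⟩
      · exact Or.inl (Or.inl hv)
      · by_cases hi : i = a
        · subst hi
          rcases ih i (ht.1 i) ha hy with h | ⟨x, hx, rfl⟩
          · exact Or.inl (Or.inr ⟨i, y, h, rfl⟩)
          · exact Or.inr ⟨x, hx, rfl⟩
        · rw [graft_of_notMem fun h => hi (ht.index_unique h ha)] at hy
          exact Or.inl (Or.inr ⟨i, y, hy, rfl⟩)
  · rintro (h | ⟨x, hx, rfl⟩)
    · exact vertices_subset_graft _ _ _ h
    · exact address_append_mem hj hx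

theorem card_vertices_graft {s t : Tree M} {j : ℕ} (ht : t.Canonical) (hj : j ∈ t.leaves) :
    (graft s j t).vertices.card = t.vertices.card + s.vertices.card := by
  have : (graft s j t).vertices = t.vertices ∪ s.vertices.image (t.address j ++ ·) := by
    ext v
    simp [mem_vertices_graft ht hj]
  rw [this, Finset.card_union_of_disjoint,
    Finset.card_image_of_injective _ (List.append_right_injective _)]
  rw [Finset.disjoint_left]
  intro v hv hv'
  obtain ⟨x, -, rfl⟩ := Finset.mem_image.1 hv'
  exact address_append_notMem hj x hv

theorem card_vertices_eq_zero {t : Tree M} : t.vertices.card = 0 ↔ ∃ i, t = leaf i := by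
  cases t with
  | leaf i => simp [vertices]
  | node n m c => simp [vertices]

/-- Every vertex `v` of a tree `t` cuts `t` into the subtree `s` growing from `v` and the rest. -/
theorem Canonical.exists_graft {t : Tree M} (ht : t.Canonical) {v : List ℕ} (hv : v ∈ t.vertices) :
    ∃ s c : Tree M, s.Canonical ∧ c.Canonical ∧ s.minLeaf ∈ c.leaves ∧
      (∀ x ∈ s.leaves, x ∈ c.leaves → x = s.minLeaf) ∧ s.vertices.card ≠ 0 ∧
      c.address s.minLeaf = v ∧ t = Tree.graft s s.minLeaf c := by
  induction v generalizing t with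
  | nil =>
    refine ⟨t, leaf t.minLeaf, ht, trivial, by simp [leaves], by simp [leaves], ?_, rfl, by
      simp [Tree.graft]⟩
    exact Finset.card_ne_zero_of_mem hv
  | cons a p ih =>
    cases t with
    | leaf i => simp [vertices] at hv
    | node n m c =>
      obtain ⟨i, y, hy, h⟩ := (mem_vertices_node.1 hv).resolve_left (List.cons_ne_nil _ _)
      obtain ⟨rfl, rfl⟩ := List.cons.inj h
      obtain ⟨s, b, hs, hb, hj, hd, hs0, hsv, hg⟩ := ih (ht.1 i) hy
      have hbl : b.leaves ⊆ (c i).leaves := by rw [hg]; exact leaves_subset_graft rfl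
      have hsl : s.leaves ⊆ (c i).leaves := by
        intro x hx
        rw [hg, mem_leaves_graft]
        exact Or.inr ⟨hj, hx⟩
      have hbm : b.minLeaf = (c i).minLeaf := by rw [hg, minLeaf_graft rfl]
      have hl : ∀ l, (Function.update c i b l).leaves ⊆ (c l).leaves := by
        intro l
        by_cases h : l = i
        · subst h; simpa using hbl
        · simp [h]
      have hm : ∀ l, (Function.update c i b l).minLeaf = (c l).minLeaf := by
        intro l
        by_cases h : l = i
        · subst h; simpa using hbm
        · simp [h]
      have hcan : (node n m (Function.update c i b)).Canonical := by
        refine ⟨fun l => ?_, fun l l' hll => ?_⟩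
        · by_cases h : l = i
          · subst h; simpa using hb
          · simpa [h] using ht.1 l
        · rw [hm, hm]
          exact ⟨(ht.2 _ _ hll).1.mono (hl _) (hl _), (ht.2 _ _ hll).2⟩
      have hji : s.minLeaf ∈ (Function.update c i b i).leaves := by simpa using hj
      refine ⟨s, node n m (Function.update c i b), hs, hcan, mem_leaves_node.2 ⟨i, hji⟩, ?_, hs0,
        ?_, ?_⟩
      · intro x hx hx'
        obtain ⟨l, hxl⟩ := mem_leaves_node.1 hx'
        obtain rfl := ht.index_unique (hl l hxl) (hsl hx)
        exact hd x hx (by simpa using hxl)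
      · rw [address_node hcan hji]
        simp [hsv]
      · simp only [Tree.graft]
        congr 1
        funext l
        by_cases h : l = i
        · subst h; simpa using hg
        · have : s.minLeaf ∉ (c l).leaves := fun h' =>
            h (ht.index_unique h' (hsl s.minLeaf_mem))
          simp [h, graft_of_notMem this]

/-! ### Two factorizations of the same tree -/

theorem graft_node_update {n : ℕ} {m : M (n + 1)} {c : Fin (n + 1) → Tree M} {s : Tree M} {j : ℕ}
    {a : Fin (n + 1)} {x : Tree M} (h : ∀ i ≠ a, j ∉ (c i).leaves) :
    graft s j (node n m (Function.update c a x)) =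
      node n m (Function.update c a (graft s j x)) := by
  simp only [graft]
  congr 1
  funext i
  by_cases hi : i = a
  · subst hi; simp
  · simp [hi, graft_of_notMem (h i hi)]

/-- The possible relative positions of two factorizations `graft s j t = graft s' j' t'`: they
agree, the second one cuts the tree below the first one, or above it, or the two cuts are
independent. -/
theorem graft_eq_graft {s s' t t' : Tree M} {j j' : ℕ} (hs : s.minLeaf = j) (hs' : s'.minLeaf = j')
    (ht : t.Canonical) (ht' : t'.Canonical) (hj : j ∈ t.leaves) (hj' : j' ∈ t'.leaves)
    (h0 : t.vertices.card ≠ 0) (h0' : t'.vertices.card ≠ 0)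
    (h : graft s j t = graft s' j' t') :
    (t = t' ∧ s = s') ∨
    (∃ y, y.vertices.card ≠ 0 ∧ j ∈ y.leaves ∧ t = graft y j' t' ∧ s' = graft s j y) ∨
    (∃ y, y.vertices.card ≠ 0 ∧ j' ∈ y.leaves ∧ t' = graft y j t ∧ s = graft s' j' y) ∨
    (∃ x, x.vertices.card ≠ 0 ∧ j ∈ x.leaves ∧ j' ∈ x.leaves ∧ j ≠ j' ∧ t = graft s' j' x ∧
      t' = graft s j x) := by
  induction t generalizing t' with
  | leaf i => simp [vertices] at h0
  | node n m c ih =>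
    cases t' with
    | leaf i => simp [vertices] at h0'
    | node n' m' c' =>
      simp only [graft, node.injEq] at h
      obtain ⟨rfl, h1, h2⟩ := h
      obtain rfl := eq_of_heq h1
      have hg := fun i => congrFun (eq_of_heq h2) i
      clear h1 h2
      obtain ⟨a, ha⟩ := mem_leaves_node.1 hj
      obtain ⟨a', ha'⟩ := mem_leaves_node.1 hj'
      have hna : ∀ i ≠ a, j ∉ (c i).leaves := fun i hi h => hi (ht.index_unique h ha)
      have hna' : ∀ i ≠ a', j' ∉ (c' i).leaves := fun i hi h => hi (ht'.index_unique h ha')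
      have hca : ∀ i ≠ a', graft s j (c i) = c' i := fun i hi => by
        simpa [graft_of_notMem (hna' i hi)] using hg i
      have hca' : ∀ i ≠ a, c i = graft s' j' (c' i) := fun i hi => by
        simpa [graft_of_notMem (hna i hi)] using hg i
      by_cases haa : a = a'
      -- Both cuts lie in the same branch.
      · subst haa
        have hcc : ∀ i ≠ a, c i = c' i := fun i hi => by
          rw [← hca i hi, graft_of_notMem (hna i hi)]
        have hna₁ : ∀ i ≠ a, j ∉ (c' i).leaves := fun i hi => hcc i hi ▸ hna i hi
        have hna₂ : ∀ i ≠ a, j' ∉ (c i).leaves := fun i hi => (hcc i hi).symm ▸ hna' i hi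
        have hc : c = Function.update c' a (c a) := by
          funext i
          by_cases hi : i = a
          · subst hi; simp
          · simp [hi, hcc i hi]
        have hc' : c' = Function.update c a (c' a) := by
          funext i
          by_cases hi : i = a
          · subst hi; simp
          · simp [hi, hcc i hi]
        have lift_t : ∀ y, c a = graft y j' (c' a) → node n m c = graft y j' (node n m c') := by
          intro y hy
          have h := graft_node_update (m := m) (s := y) (j := j') (x := c' a) hna'
          rw [Function.update_eq_self] at h
          rw [h, ← hy, ← hc]
        have lift_t' : ∀ y, c' a = graft y j (c a) → node n m c' = graft y j (node n m c) := by
          intro y hy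
          have h := graft_node_update (m := m) (s := y) (j := j) (x := c a) hna
          rw [Function.update_eq_self] at h
          rw [h, ← hy, ← hc']
        -- The induction hypothesis needs both branches to have vertices; a branch without
        -- vertices is the leaf at which one grafts.
        by_cases hl : (c a).vertices.card = 0
        · obtain ⟨i, hi⟩ := card_vertices_eq_zero.1 hl
          have hij : i = j := by simpa [hi, leaves, eq_comm] using ha
          subst hij
          have e := hg a
          rw [hi] at e
          simp only [graft, if_true] at e
          by_cases hl' : (c' a).vertices.card = 0
          · obtain ⟨i', hi'⟩ := card_vertices_eq_zero.1 hl'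
            have hij' : i' = j' := by simpa [hi', leaves, eq_comm] using ha'
            subst hij'
            rw [hi'] at e
            simp only [graft, if_true] at e
            left
            refine ⟨?_, e⟩
            rw [hc, hi, ← hs, e, hs', ← hi', Function.update_eq_self]
          · right; right; left
            refine ⟨c' a, hl', ha', lift_t' _ ?_, e⟩
            rw [hi]
            simp [graft]
        · by_cases hl' : (c' a).vertices.card = 0
          · obtain ⟨i', hi'⟩ := card_vertices_eq_zero.1 hl'
            have hij' : i' = j' := by simpa [hi', leaves, eq_comm] using ha'
            subst hij'
            have e := hg a
            rw [hi'] at e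
            simp only [graft, if_true] at e
            right; left
            refine ⟨c a, hl, ha, lift_t _ ?_, e.symm⟩
            rw [hi']
            simp [graft]
          · rcases ih a (ht.1 a) (ht'.1 a) ha ha' hl hl' (hg a) with ⟨e1, e2⟩ |
              ⟨y, hy, hjy, e1, e2⟩ | ⟨y, hy, hjy, e1, e2⟩ | ⟨x, hx, hjx, hjx', hjj, e1, e2⟩
            · left
              refine ⟨?_, e2⟩
              rw [hc, e1, Function.update_eq_self]
            · right; left
              exact ⟨y, hy, hjy, lift_t _ e1, e2⟩
            · right; right; left
              exact ⟨y, hy, hjy, lift_t' _ e1, e2⟩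
            · right; right; right
              refine ⟨node n m (Function.update c a x), by simp [vertices],
                mem_leaves_node.2 ⟨a, by simpa using hjx⟩,
                mem_leaves_node.2 ⟨a, by simpa using hjx'⟩, hjj, ?_, ?_⟩
              · rw [graft_node_update hna₂, ← e1, Function.update_eq_self]
              · rw [graft_node_update hna, ← e2, ← hc']
      -- The cuts lie in different branches, so they are independent.
      · have e := hca a haa
        have e' := hca' a' (Ne.symm haa)
        have hjs : j ∈ s.leaves := hs ▸ s.minLeaf_mem
        have hjs' : j' ∈ s'.leaves := hs' ▸ s'.minLeaf_mem
        have hjca' : j' ∈ (c a').leaves := by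
          rw [e', mem_leaves_graft]; exact Or.inr ⟨ha', hjs'⟩
        have hjca : j ∈ (c' a).leaves := by
          rw [← e, mem_leaves_graft]; exact Or.inr ⟨ha, hjs⟩
        have hjj : j ≠ j' := by
          rintro rfl
          exact haa (ht.index_unique ha hjca')
        right; right; right
        refine ⟨node n m (Function.update c a' (c' a')), by simp [vertices],
          mem_leaves_node.2 ⟨a, by simpa [haa] using ha⟩,
          mem_leaves_node.2 ⟨a', by simpa using ha'⟩, hjj, ?_, ?_⟩
        · rw [graft_node_update fun i hi h => hi (ht.index_unique h hjca'), ← e',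
            Function.update_eq_self]
        · simp only [graft]
          congr 1
          funext i
          by_cases hi : i = a'
          · subst hi
            simp [graft_of_notMem fun h => haa (ht'.index_unique hjca h)]
          · simp [hi, hca i hi]

/-! ### Divisors of grafts -/

/-- The defining property of the set of vertices of a divisor of `t` that belongs to `G`. -/
def IsDivisor (G : Set (Tree M)) (t : Tree M) (S : Finset (List ℕ)) : Prop :=
  ∃ r, t.IsSubtree r S ∧ ∃ g ∈ G, g.SameShape (t.restrict r S)

theorem IsDivisor.of_graft_left {G : Set (Tree M)} {s t : Tree M} {j : ℕ} (hs : s.minLeaf = j)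
    {S : Finset (List ℕ)} (h : IsDivisor G (graft s j t) S) (hS : S ⊆ t.vertices) :
    IsDivisor G t S := by
  obtain ⟨r, h, g, hg, hsh⟩ := h
  refine ⟨r, ⟨h.root_mem, hS, h.root_prefix, h.path_mem⟩, g, hg, ?_⟩
  rwa [restrict, growing_graft (hS h.root_mem),
    prune_graft hs fun q hq => mem_vertices_growing (hS hq)] at hsh

theorem IsDivisor.of_graft_right {G : Set (Tree M)} {s t : Tree M} {j : ℕ} (hj : j ∈ t.leaves)
    {S : Finset (List ℕ)} (h : IsDivisor G (graft s j t) (S.image (t.address j ++ ·)))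
    (hS : S ⊆ s.vertices) : IsDivisor G s S := by
  obtain ⟨r, h, g, hg, hsh⟩ := h
  obtain ⟨r, hr, rfl⟩ := Finset.mem_image.1 h.root_mem
  refine ⟨r, ⟨hr, hS, fun v hv => ?_, fun v hv x hrx hxv => ?_⟩, g, hg, ?_⟩
  · exact (List.prefix_append_right_inj _).1 (h.root_prefix _ (Finset.mem_image_of_mem _ hv))
  · have := h.path_mem _ (Finset.mem_image_of_mem _ hv) (t.address j ++ x)
      ((List.prefix_append_right_inj _).2 hrx) ((List.prefix_append_right_inj _).2 hxv)
    obtain ⟨y, hy, hyx⟩ := Finset.mem_image.1 this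
    rwa [← List.append_cancel_left hyx]
  · rwa [restrict, growing_address hj, prune_image] at hsh

theorem IsDivisor.subset_vertices {G : Set (Tree M)} {t : Tree M} {S : Finset (List ℕ)}
    (h : IsDivisor G t S) : S ⊆ t.vertices := by
  obtain ⟨r, h, -⟩ := h
  exact h.subset

theorem IsDivisor.nonempty {G : Set (Tree M)} {t : Tree M} {S : Finset (List ℕ)}
    (h : IsDivisor G t S) : S.Nonempty := by
  obtain ⟨r, h, -⟩ := h
  exact ⟨r, h.root_mem⟩

end Tree
end ShuffleOperad

namespace ShuffleOperad

/-! ### Exterior algebras on a set of generators -/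

section Wedge

variable (k : Type u) [Field k] {D : Type v} {D' : Type w}

/-- The wedge product of a list of generators. -/
noncomputable def wedge (l : List D) : ExteriorAlgebra k (D →₀ k) :=
  (l.map fun x => ExteriorAlgebra.ι k (Finsupp.single x 1)).prod

@[simp] theorem wedge_nil : wedge k ([] : List D) = 1 := rfl

@[simp] theorem wedge_cons (x : D) (l : List D) :
    wedge k (x :: l) = ExteriorAlgebra.ι k (Finsupp.single x 1) * wedge k l := by
  simp [wedge]

theorem wedge_append (l l' : List D) : wedge k (l ++ l') = wedge k l * wedge k l' := by
  simp [wedge]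

theorem map_wedge (f : D → D') (l : List D) :
    ExteriorAlgebra.map (Finsupp.lmapDomain k k f) (wedge k l) = wedge k (l.map f) := by
  induction l with
  | nil => simp
  | cons x l ih =>
    rw [wedge_cons, map_mul, ih, ExteriorAlgebra.map_apply_ι, List.map_cons, wedge_cons,
      Finsupp.lmapDomain_apply, Finsupp.mapDomain_single]

theorem exteriorPower_eq_span_wedge (p : ℕ) :
    (⋀[k]^p (D →₀ k)) = Submodule.span k (wedge k '' {l : List D | l.length = p}) := by
  have h1 : LinearMap.range (ExteriorAlgebra.ι k (M := D →₀ k)) =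
      Submodule.span k (Set.range fun x : D => ExteriorAlgebra.ι k (Finsupp.single x (1 : k))) := by
    rw [LinearMap.range_eq_map, ← Finsupp.basisSingleOne.span_eq, Submodule.map_span,
      ← Set.range_comp]
    rfl
  induction p with
  | zero =>
    have : {l : List D | l.length = 0} = {[]} := by ext; simp
    rw [this, Set.image_singleton, wedge_nil, ExteriorAlgebra.exteriorPower, pow_zero,
      Submodule.one_eq_span]
  | succ p ih =>
    rw [ExteriorAlgebra.exteriorPower] at ih ⊢
    rw [pow_succ', ih, h1, Submodule.span_mul_span]
    congr 1
    ext y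
    simp only [Set.mem_mul, Set.mem_range, Set.mem_image, Set.mem_ofPred_eq]
    constructor
    · rintro ⟨_, ⟨x, rfl⟩, _, ⟨l, hl, rfl⟩, rfl⟩
      exact ⟨x :: l, by simp [hl], by simp⟩
    · rintro ⟨l, hl, rfl⟩
      obtain ⟨x, l, rfl⟩ := List.exists_cons_of_length_eq_add_one hl
      exact ⟨_, ⟨x, rfl⟩, _, ⟨l, by simpa using hl, rfl⟩, by simp⟩

theorem wedge_mem (l : List D) : wedge k l ∈ ⋀[k]^l.length (D →₀ k) := by
  rw [exteriorPower_eq_span_wedge]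
  exact Submodule.subset_span ⟨l, rfl, rfl⟩

theorem span_wedge : Submodule.span k (Set.range (wedge k (D := D))) = ⊤ := by
  rw [eq_top_iff, ← (DirectSum.Decomposition.isInternal
    (fun p => ⋀[k]^p (D →₀ k))).submodule_iSup_eq_top]
  refine iSup_le fun p => ?_
  rw [exteriorPower_eq_span_wedge]
  exact Submodule.span_mono (Set.image_subset_range _ _)

theorem wedge_swap (x y : D) (l : List D) : wedge k (x :: y :: l) = -wedge k (y :: x :: l) := by
  simp only [wedge_cons, ← mul_assoc]
  rw [← neg_mul, eq_neg_of_add_eq_zero_left (ExteriorAlgebra.ι_add_mul_swap _ _)]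

theorem wedge_cons_eq (x : D) (l : List D) :
    wedge k (x :: l) = (-1 : k) ^ l.length • wedge k (l ++ [x]) := by
  induction l with
  | nil => simp
  | cons y l ih =>
    rw [wedge_swap, wedge_cons, ih, List.cons_append, wedge_cons, List.length_cons, pow_succ,
      mul_smul_comm]
    simp

theorem wedge_mul_comm (l l' : List D) :
    wedge k l * wedge k l' = (-1 : k) ^ (l.length * l'.length) • (wedge k l' * wedge k l) := by
  induction l with
  | nil => simp
  | cons x l ih =>
    rw [wedge_cons, mul_assoc, ih, mul_smul_comm, ← mul_assoc, ← wedge_cons, wedge_cons_eq,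
      smul_mul_assoc, smul_smul, wedge_append, wedge_cons, wedge_nil, mul_one, mul_assoc,
      List.length_cons, add_mul, one_mul, pow_add]

theorem wedge_perm {l l' : List D} (h : l.Perm l') : ∃ r : kˣ, wedge k l = r • wedge k l' := by
  induction h with
  | nil => exact ⟨1, by simp⟩
  | cons x _ ih =>
    obtain ⟨r, hr⟩ := ih
    exact ⟨r, by rw [wedge_cons, wedge_cons, hr, Units.smul_def, mul_smul_comm, Units.smul_def]⟩
  | swap x y l => exact ⟨-1, by rw [wedge_swap, Units.smul_def]; simp⟩
  | trans _ _ ih ih' =>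
    obtain ⟨r, hr⟩ := ih
    obtain ⟨r', hr'⟩ := ih'
    exact ⟨r * r', by rw [hr, hr', smul_smul]⟩

/-- The derivation of degree `-1` of the exterior algebra which sends each generator to `1`, as the
contraction with the linear form that takes the value `1` at all generators. -/
noncomputable def unmark : ExteriorAlgebra k (D →₀ k) →ₗ[k] ExteriorAlgebra k (D →₀ k) :=
  CliffordAlgebra.contractLeft (Finsupp.linearCombination k fun _ : D => (1 : k))

/-- The Leibniz rule for a generator. It says that the multiplication by a generator is a homotopy
contracting the complex with the differential `unmark`. -/
theorem unmark_ι_mul (x : D) (y : ExteriorAlgebra k (D →₀ k)) :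
    unmark k (ExteriorAlgebra.ι k (Finsupp.single x 1) * y) =
      y - ExteriorAlgebra.ι k (Finsupp.single x 1) * unmark k y := by
  simp [unmark, CliffordAlgebra.contractLeft_ι_mul]

theorem unmark_one : unmark k (1 : ExteriorAlgebra k (D →₀ k)) = 0 :=
  CliffordAlgebra.contractLeft_one _ _

theorem unmark_unmark (x : ExteriorAlgebra k (D →₀ k)) : unmark k (unmark k x) = 0 :=
  CliffordAlgebra.contractLeft_contractLeft _ _

theorem unmark_wedge_mul (l : List D) (y : ExteriorAlgebra k (D →₀ k)) :
    unmark k (wedge k l * y) =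
      unmark k (wedge k l) * y + (-1 : k) ^ l.length • (wedge k l * unmark k y) := by
  induction l with
  | nil => simp [unmark_one]
  | cons x l ih =>
    rw [wedge_cons, mul_assoc, unmark_ι_mul, unmark_ι_mul, ih, List.length_cons, pow_succ]
    simp only [mul_add, sub_mul, mul_assoc, mul_smul_comm, mul_neg, mul_one, neg_smul]
    abel

theorem unmark_map (f : D → D') (x : ExteriorAlgebra k (D →₀ k)) :
    unmark k (ExteriorAlgebra.map (Finsupp.lmapDomain k k f) x) =
      ExteriorAlgebra.map (Finsupp.lmapDomain k k f) (unmark k x) := by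
  suffices unmark k ∘ₗ (ExteriorAlgebra.map (Finsupp.lmapDomain k k f)).toLinearMap =
      (ExteriorAlgebra.map (Finsupp.lmapDomain k k f)).toLinearMap ∘ₗ unmark k from
    LinearMap.congr_fun this x
  refine LinearMap.ext_on_range (span_wedge k) fun l => ?_
  simp only [LinearMap.comp_apply, AlgHom.toLinearMap_apply]
  induction l with
  | nil => simp [unmark_one]
  | cons x l ih =>
    rw [wedge_cons, map_mul, ExteriorAlgebra.map_apply_ι, Finsupp.lmapDomain_apply,
      Finsupp.mapDomain_single, unmark_ι_mul, ih, unmark_ι_mul, map_sub, map_mul,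
      ExteriorAlgebra.map_apply_ι, Finsupp.lmapDomain_apply, Finsupp.mapDomain_single]

theorem unmark_wedge_mem (l : List D) (p : ℕ) (h : l.length = p + 1) :
    unmark k (wedge k l) ∈ ⋀[k]^p (D →₀ k) := by
  induction l generalizing p with
  | nil => simp at h
  | cons x l ih =>
    rw [wedge_cons, unmark_ι_mul]
    have hl : l.length = p := by simpa using h
    refine Submodule.sub_mem _ (hl ▸ wedge_mem k l) ?_
    cases p with
    | zero =>
      rw [List.length_eq_zero_iff.1 hl, wedge_nil, unmark_one, mul_zero]
      exact Submodule.zero_mem _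
    | succ p =>
      have := ih p hl
      rw [ExteriorAlgebra.exteriorPower] at this ⊢
      rw [pow_succ']
      exact Submodule.mul_mem_mul ⟨_, rfl⟩ this

end Wedge

end ShuffleOperad

namespace ShuffleOperad

/-! ### Tree monomials under compositions and changes of labels -/

/-- Uniqueness of order-preserving bijections between finite ordered sets. -/
theorem orderBij_eq {I I' : FinOrd} {e : ℕ → ℕ} (he : StrictMonoOn e (I.1 : Set ℕ))
    (h : I.1.image e = I'.1) {x : ℕ} (hx : x ∈ I.1) : orderBij I I' x = e x := by
  have hc : Nat.count (· ∈ I'.1) (e x) = Nat.count (· ∈ I.1) x := by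
    rw [Nat.count_eq_card_filter_range, Nat.count_eq_card_filter_range]
    symm
    refine Finset.card_bij (fun y _ => e y) ?_ ?_ ?_
    · intro y hy
      simp only [Finset.mem_filter, Finset.mem_range] at hy ⊢
      exact ⟨he hy.2 hx hy.1, h ▸ Finset.mem_image_of_mem e hy.2⟩
    · intro y hy z hz hyz
      simp only [Finset.mem_filter] at hy hz
      exact he.injOn hy.2 hz.2 hyz
    · intro z hz
      simp only [Finset.mem_filter, Finset.mem_range] at hz
      rw [← h] at hz
      obtain ⟨y, hy, rfl⟩ := Finset.mem_image.1 hz.2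
      exact ⟨y, by simpa [hy] using (he.lt_iff_lt hy hx).1 hz.1, rfl⟩
  have hx' : e x ∈ I'.1 := h ▸ Finset.mem_image_of_mem e hx
  rw [orderBij, ← hc]
  exact Nat.nth_count (p := (· ∈ I'.1)) hx'

theorem orderBij_least {I J : FinOrd} (h : I.1.card = J.1.card) :
    orderBij I J I.least = J.least := by
  have he := orderBij_strictMonoOn h
  symm
  refine FinOrd.least_eq (image_orderBij h ▸ Finset.mem_image_of_mem _ I.least_mem) fun y hy => ?_
  rw [← image_orderBij h] at hy
  obtain ⟨x, hx, rfl⟩ := Finset.mem_image.1 hy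
  exact he.monotoneOn I.least_mem hx (Finset.min'_le _ _ hx)

namespace TreeMonomial

variable {M : ℕ → Type v}

theorem relabel_refl {I : FinOrd} (t : TreeMonomial M I) : t.relabel rfl = t := by
  refine Subtype.ext (Tree.mapLeaves_eq_self fun x hx => ?_)
  rw [t.2.2] at hx
  exact orderBij_eq (e := id) (strictMonoOn_id) (by simp) hx

theorem relabel_trans {I J K : FinOrd} (h : I.1.card = J.1.card) (h' : J.1.card = K.1.card)
    (t : TreeMonomial M I) : (t.relabel h).relabel h' = t.relabel (h.trans h') := by
  refine Subtype.ext ?_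
  simp only [relabel, Tree.mapLeaves_mapLeaves]
  refine Tree.mapLeaves_congr fun x hx => ?_
  rw [t.2.2] at hx
  refine (orderBij_eq ((orderBij_strictMonoOn h').comp (orderBij_strictMonoOn h) ?_) ?_ hx).symm
  · intro y hy
    rw [Finset.mem_coe, ← image_orderBij h]
    exact Finset.mem_image_of_mem _ hy
  · rw [← Finset.image_image, image_orderBij h, image_orderBij h']

theorem relabel_one {i j : ℕ} (h : (FinOrd.single i).1.card = (FinOrd.single j).1.card) :
    (one i : TreeMonomial M _).relabel h = one j := by
  refine Subtype.ext ?_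
  have := orderBij_least h
  rw [FinOrd.least_single, FinOrd.least_single] at this
  simp [relabel, one, Tree.mapLeaves, this]

theorem relabel_graft {I J K I' J' K' : FinOrd} (h : IsGraft I J K) (h' : IsGraft I' J' K')
    {e : ℕ → ℕ} (he : StrictMonoOn e (K.1 : Set ℕ)) (hI : I.1.image e = I'.1)
    (hJ : J.1.image e = J'.1) (hK : K.1.image e = K'.1) (cI : I.1.card = I'.1.card)
    (cJ : J.1.card = J'.1.card) (cK : K.1.card = K'.1.card) (t : TreeMonomial M I)
    (s : TreeMonomial M J) :
    (t.graft h s).relabel cK = (t.relabel cI).graft h' (s.relabel cJ) := by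
  have h1 : ∀ x ∈ I.1, orderBij I I' x = e x := fun x hx =>
    orderBij_eq (he.mono (Finset.coe_subset.2 h.subset_left)) hI hx
  have h2 : ∀ x ∈ J.1, orderBij J J' x = e x := fun x hx =>
    orderBij_eq (he.mono (Finset.coe_subset.2 h.subset_right)) hJ hx
  have h3 : ∀ x ∈ K.1, orderBij K K' x = e x := fun x hx => orderBij_eq he hK hx
  refine Subtype.ext ?_
  simp only [relabel, graft]
  rw [← orderBij_least cJ, h2 _ J.least_mem,
    Tree.mapLeaves_congr (t := Tree.graft _ _ _) (e' := e) (by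
      intro x hx
      have := (t.graft h s).2.2
      simp only [graft] at this
      exact h3 x (this ▸ hx)),
    Tree.mapLeaves_congr (t := s.1) (e' := e) (by rw [s.2.2]; exact h2),
    Tree.mapLeaves_congr (t := t.1) (e' := e) (by rw [t.2.2]; exact h1)]
  exact Tree.mapLeaves_graft (t.least_mem_leaves h)
    (by rw [t.2.2]; exact he.injOn.mono (Finset.coe_subset.2 h.subset_left))

theorem address_relabel {I J K I' J' : FinOrd} (h : IsGraft I J K) {e : ℕ → ℕ}
    (he : StrictMonoOn e (K.1 : Set ℕ)) (hI : I.1.image e = I'.1) (hJ : J.1.image e = J'.1)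
    (cI : I.1.card = I'.1.card) (cJ : J.1.card = J'.1.card) (t : TreeMonomial M I) :
    (t.relabel cI).1.address J'.least = t.1.address J.least := by
  have : J'.least = orderBij I I' J.least := by
    rw [orderBij_eq (he.mono (Finset.coe_subset.2 h.subset_left)) hI h.least_mem,
      ← orderBij_eq (he.mono (Finset.coe_subset.2 h.subset_right)) hJ J.least_mem,
      orderBij_least cJ]
  rw [this]
  exact Tree.address_mapLeaves t.2.1 (strictMonoOn_leaves cI t) (t.least_mem_leaves h)

theorem one_graft {I : FinOrd} {i : ℕ} (h : IsGraft (FinOrd.single i) I I)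
    (t : TreeMonomial M I) : (one i).graft h t = t := by
  have h1 : I.least = i := by simpa [FinOrd.single] using h.least_mem
  refine Subtype.ext ?_
  simp [graft, one, Tree.graft, h1]

theorem graft_one {I : FinOrd} {i : ℕ} (h : IsGraft I (FinOrd.single i) I)
    (t : TreeMonomial M I) : t.graft h (one i) = t := by
  refine Subtype.ext ?_
  simp [graft, one, FinOrd.least_single, Tree.graft_leaf_self]

section

variable {I J K L N R : FinOrd} (h₁ : IsGraft I J K) (h₂ : IsGraft K L N)

theorem graft_graft (h₃ : IsGraft J L R) (h₄ : IsGraft I R N) (t : TreeMonomial M I)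
    (s : TreeMonomial M J) (u : TreeMonomial M L) :
    (t.graft h₁ s).graft h₂ u = t.graft h₄ (s.graft h₃ u) := by
  refine Subtype.ext ?_
  have hR : R.least = J.least := by
    rw [← (s.graft h₃ u).minLeaf_eq, ← s.minLeaf_eq]
    exact Tree.minLeaf_graft u.minLeaf_eq s.1
  simp only [graft]
  rw [hR]
  exact Tree.graft_graft fun hl => h₁.eq_least (t.2.2 ▸ hl) h₃.least_mem

theorem address_graft_right (h₃ : IsGraft J L R) (t : TreeMonomial M I) (s : TreeMonomial M J) :
    (t.graft h₁ s).1.address L.least = t.1.address J.least ++ s.1.address L.least :=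
  Tree.address_graft_right t.2.1 (t.graft h₁ s).2.1 (t.least_mem_leaves h₁)
    (s.least_mem_leaves h₃)

theorem address_graft_left (h₃ : IsGraft I L R) (hJL : J.least ≠ L.least) (t : TreeMonomial M I)
    (s : TreeMonomial M J) : (t.graft h₁ s).1.address L.least = t.1.address L.least :=
  Tree.address_graft_left t.2.1 (t.graft h₁ s).2.1 (t.least_mem_leaves h₃) hJL.symm

theorem graft_comm (h₃ : IsGraft I L R) (h₄ : IsGraft R J N) (hJL : J.least ≠ L.least)
    (t : TreeMonomial M I) (s : TreeMonomial M J) (u : TreeMonomial M L) :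
    (t.graft h₁ s).graft h₂ u = (t.graft h₃ u).graft h₄ s := by
  exact Subtype.ext (Tree.graft_comm hJL
    (fun hl => hJL (h₃.eq_least h₁.least_mem (u.2.2 ▸ hl)))
    fun hl => hJL (h₁.eq_least h₃.least_mem (s.2.2 ▸ hl)).symm)

end

end TreeMonomial

/-! ### The inclusion-exclusion operad -/

section Monomials

variable (k : Type u) [Field k] {M : ℕ → Type v} (G : Set (Tree M))

/-- The set of vertices of a divisor. -/
def Tree.Divisor.support {G : Set (Tree M)} {t : Tree M} (D : t.Divisor G) : Finset (List ℕ) := D.1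

theorem Tree.Divisor.support_injective {G : Set (Tree M)} {t : Tree M} :
    Function.Injective (Tree.Divisor.support (G := G) (t := t)) := Subtype.val_injective

variable {G} in
/-- The divisors of the first factor, as divisors of a composition. -/
def TreeMonomial.left {I J K : FinOrd} (h : IsGraft I J K) (t : TreeMonomial M I)
    (s : TreeMonomial M J) (D : t.1.Divisor G) : (t.graft h s).1.Divisor G :=
  Tree.Divisor.left s.minLeaf_eq D

variable {G} in
/-- The divisors of the second factor, as divisors of a composition. -/
noncomputable def TreeMonomial.right {I J K : FinOrd} (h : IsGraft I J K) (t : TreeMonomial M I)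
    (s : TreeMonomial M J) (D : s.1.Divisor G) : (t.graft h s).1.Divisor G :=
  Tree.Divisor.right (t.least_mem_leaves h) D

variable {G} in
/-- The divisors of a tree monomial, as divisors of the same monomial with other labels. -/
noncomputable def TreeMonomial.rename {I J : FinOrd} (h : I.1.card = J.1.card)
    (t : TreeMonomial M I) (D : t.1.Divisor G) : (t.relabel h).1.Divisor G :=
  Tree.Divisor.relabel (strictMonoOn_leaves h t) D

section Supports

variable {G} {I J K : FinOrd}

theorem map_support_left (h : IsGraft I J K) (t : TreeMonomial M I) (s : TreeMonomial M J)
    (l : List (t.1.Divisor G)) : (l.map (TreeMonomial.left h t s)).map Tree.Divisor.support =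
      l.map Tree.Divisor.support := by
  rw [List.map_map]
  rfl

theorem map_support_right (h : IsGraft I J K) (t : TreeMonomial M I) (s : TreeMonomial M J)
    (l : List (s.1.Divisor G)) : (l.map (TreeMonomial.right h t s)).map Tree.Divisor.support =
      (l.map Tree.Divisor.support).map (Finset.image (t.1.address J.least ++ ·)) := by
  rw [List.map_map, List.map_map]
  rfl

theorem map_support_rename (h : I.1.card = J.1.card) (t : TreeMonomial M I)
    (l : List (t.1.Divisor G)) : (l.map (TreeMonomial.rename h t)).map Tree.Divisor.support =
      l.map Tree.Divisor.support := by
  rw [List.map_map]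
  rfl

end Supports

/-- A tree monomial marked by the wedge product of a list of divisors. -/
noncomputable def monomial {I : FinOrd} (t : TreeMonomial M I) (l : List (t.1.Divisor G)) :
    (inclusionExclusion k G).obj I :=
  marked k G t (wedge k l)

variable {k G}

/-- Divisors of equal tree monomials are compared through their sets of vertices, which avoids
casts between the types of divisors. -/
theorem monomial_congr {I : FinOrd} {t t' : TreeMonomial M I} (h : t = t')
    {l : List (t.1.Divisor G)} {l' : List (t'.1.Divisor G)}
    (hl : l.map Tree.Divisor.support = l'.map Tree.Divisor.support) :
    monomial k G t l = monomial k G t' l' := by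
  subst h
  rw [List.map_injective_iff.2 Tree.Divisor.support_injective hl]

theorem marked_add {I : FinOrd} (t : TreeMonomial M I) (x y : Marks k G t.1) :
    marked k G t (x + y) = marked k G t x + marked k G t y := map_add _ _ _

theorem marked_smul {I : FinOrd} (t : TreeMonomial M I) (r : k) (x : Marks k G t.1) :
    marked k G t (r • x) = r • marked k G t x := map_smul _ _ _

theorem marked_zero {I : FinOrd} (t : TreeMonomial M I) : marked k G t 0 = 0 := map_zero _

theorem comp_marked {I J K : FinOrd} (h : IsGraft I J K) (t : TreeMonomial M I)
    (s : TreeMonomial M J) (x : Marks k G t.1) (y : Marks k G s.1) :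
    (inclusionExclusion k G).comp h (marked k G t x) (marked k G s y) =
      marked k G (t.graft h s) (markComp k G h t s x y) := by
  classical
  refine (LinearMap.congr_fun (DirectSum.toModule_lof k
    (M := fun t : TreeMonomial M I => Marks k G t.1)
    (N := (⨁ s : TreeMonomial M J, Marks k G s.1) →ₗ[k] ⨁ u : TreeMonomial M K, Marks k G u.1)
    t x) _).trans ?_
  exact LinearMap.congr_fun (DirectSum.toModule_lof k
    (M := fun s : TreeMonomial M J => Marks k G s.1)
    (N := Marks k G t.1 →ₗ[k] ⨁ u : TreeMonomial M K, Marks k G u.1) s y) x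

theorem relabel_marked {I J : FinOrd} (h : I.1.card = J.1.card) (t : TreeMonomial M I)
    (x : Marks k G t.1) : (inclusionExclusion k G).relabel h (marked k G t x) =
      marked k G (t.relabel h) (markRelabel k G h t x) := by
  classical
  exact DirectSum.toModule_lof k (M := fun t : TreeMonomial M I => Marks k G t.1)
    (N := ⨁ s : TreeMonomial M J, Marks k G s.1) t x

theorem d_marked {I : FinOrd} (t : TreeMonomial M I) (x : Marks k G t.1) :
    (inclusionExclusion k G).d I (marked k G t x) = marked k G t (unmark k x) := by
  classical
  exact DirectSum.toModule_lof k (M := fun t : TreeMonomial M I => Marks k G t.1)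
    (N := ⨁ s : TreeMonomial M I, Marks k G s.1) t x

theorem one_eq_monomial (i : ℕ) :
    (inclusionExclusion k G).one i = monomial k G (TreeMonomial.one i) [] := rfl

theorem comp_monomial {I J K : FinOrd} (h : IsGraft I J K) (t : TreeMonomial M I)
    (s : TreeMonomial M J) (l : List (t.1.Divisor G)) (l' : List (s.1.Divisor G)) :
    (inclusionExclusion k G).comp h (monomial k G t l) (monomial k G s l') =
      monomial k G (t.graft h s) (l.map (TreeMonomial.left h t s) ++
        l'.map (TreeMonomial.right h t s)) := by
  refine (comp_marked h t s _ _).trans (congrArg (marked k G (t.graft h s)) ?_)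
  refine Eq.trans ?_ (wedge_append k _ _).symm
  exact congrArg₂ (· * ·) (map_wedge k _ l) (map_wedge k _ l')

theorem relabel_monomial {I J : FinOrd} (h : I.1.card = J.1.card) (t : TreeMonomial M I)
    (l : List (t.1.Divisor G)) : (inclusionExclusion k G).relabel h (monomial k G t l) =
      monomial k G (t.relabel h) (l.map (TreeMonomial.rename h t)) := by
  refine (relabel_marked h t _).trans (congrArg (marked k G (t.relabel h)) ?_)
  exact map_wedge k _ l

open Classical in
theorem marked_induction {I : FinOrd} {p : (inclusionExclusion k G).obj I → Prop} (h0 : p 0)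
    (hm : ∀ t x, p (marked k G t x)) (ha : ∀ x y, p x → p y → p (x + y)) (a) : p a :=
  DirectSum.induction_on a h0 hm ha

theorem span_monomial (I : FinOrd) : Submodule.span k {a : (inclusionExclusion k G).obj I |
    ∃ t l, monomial k G t l = a} = ⊤ := by
  rw [eq_top_iff]
  rintro a -
  induction a using marked_induction with
  | h0 => exact Submodule.zero_mem _
  | hm t x =>
    have hx : x ∈ Submodule.span k (Set.range (wedge k)) := by rw [span_wedge]; trivial
    induction hx using Submodule.span_induction with
    | mem x hx =>
      obtain ⟨l, rfl⟩ := hx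
      exact Submodule.subset_span ⟨t, l, rfl⟩
    | zero => rw [marked_zero]; exact Submodule.zero_mem _
    | add x y _ _ hx hy => rw [marked_add]; exact Submodule.add_mem _ hx hy
    | smul r x _ hx => rw [marked_smul]; exact Submodule.smul_mem _ _ hx
  | ha x y hx hy => exact Submodule.add_mem _ hx hy

theorem monomial_induction {I : FinOrd} {p : (inclusionExclusion k G).obj I → Prop}
    (hm : ∀ t l, p (monomial k G t l)) (h0 : p 0) (ha : ∀ x y, p x → p y → p (x + y))
    (hs : ∀ (r : k) x, p x → p (r • x)) (a) : p a := by
  have : a ∈ Submodule.span k {a : (inclusionExclusion k G).obj I |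
      ∃ t l, monomial k G t l = a} := by rw [span_monomial]; trivial
  induction this using Submodule.span_induction with
  | mem x hx => obtain ⟨t, l, rfl⟩ := hx; exact hm t l
  | zero => exact h0
  | add x y _ _ hx hy => exact ha x y hx hy
  | smul r x _ hx => exact hs r x hx

open Classical in
/-- The marks of the tree monomial `t` in an element of the inclusion-exclusion operad. -/
noncomputable def marks {I : FinOrd} (t : TreeMonomial M I) :
    (inclusionExclusion k G).obj I →ₗ[k] Marks k G t.1 :=
  DirectSum.component k (TreeMonomial M I) (fun t => Marks k G t.1) t

theorem marks_marked_self {I : FinOrd} (t : TreeMonomial M I) (x : Marks k G t.1) :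
    marks t (marked k G t x) = x := by
  classical
  exact DirectSum.component.lof_self k (M := fun t : TreeMonomial M I => Marks k G t.1) t x

theorem marks_marked_of_ne {I : FinOrd} {t t' : TreeMonomial M I} (h : t' ≠ t)
    (x : Marks k G t'.1) : marks t (marked k G t' x) = 0 := by
  classical
  exact (DirectSum.component.of k (M := fun t : TreeMonomial M I => Marks k G t.1) t t' x).trans
    (dif_neg h)

theorem ext_marks {I : FinOrd} {a b : (inclusionExclusion k G).obj I}
    (h : ∀ t, marks t a = marks t b) : a = b :=
  DirectSum.ext_component k h

theorem mem_deg_iff {I : FinOrd} {p : ℕ} {a : (inclusionExclusion k G).obj I} :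
    a ∈ (inclusionExclusion k G).deg I p ↔ ∀ t, marks t a ∈ ⋀[k]^p (t.1.Divisor G →₀ k) := by
  exact Submodule.mem_iInf (R := k) (M := (inclusionExclusion k G).obj I) _

theorem marked_mem_deg {I : FinOrd} {p : ℕ} (t : TreeMonomial M I) {x : Marks k G t.1}
    (hx : x ∈ ⋀[k]^p (t.1.Divisor G →₀ k)) :
    marked k G t x ∈ (inclusionExclusion k G).deg I p := by
  rw [mem_deg_iff]
  intro t'
  by_cases h : t = t'
  · subst h
    rwa [marks_marked_self]
  · rw [marks_marked_of_ne h]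
    exact Submodule.zero_mem _

theorem monomial_mem_deg {I : FinOrd} (t : TreeMonomial M I) (l : List (t.1.Divisor G)) :
    monomial k G t l ∈ (inclusionExclusion k G).deg I l.length :=
  marked_mem_deg t (wedge_mem k l)

theorem eq_sum_marked {I : FinOrd} (a : (inclusionExclusion k G).obj I) :
    ∃ T : Finset (TreeMonomial M I), a = ∑ t ∈ T, marked k G t (marks t a) := by
  classical
  refine ⟨DFinsupp.support a, ?_⟩
  exact (DirectSum.sum_support_of a).symm

theorem deg_eq_span (I : FinOrd) (p : ℕ) : (inclusionExclusion k G).deg I p =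
    Submodule.span k {a | ∃ t l, l.length = p ∧ monomial k G t l = a} := by
  refine le_antisymm (fun a ha => ?_) (Submodule.span_le.2 ?_)
  · obtain ⟨T, hT⟩ := eq_sum_marked a
    rw [hT]
    refine Submodule.sum_mem _ fun t _ => ?_
    have hx := mem_deg_iff.1 ha t
    rw [exteriorPower_eq_span_wedge] at hx
    generalize marks t a = x at hx
    induction hx using Submodule.span_induction with
    | mem x hx =>
      obtain ⟨l, hl, rfl⟩ := hx
      exact Submodule.subset_span ⟨t, l, hl, rfl⟩
    | zero => rw [marked_zero]; exact Submodule.zero_mem _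
    | add x y _ _ hx hy => rw [marked_add]; exact Submodule.add_mem _ hx hy
    | smul r x _ hx => rw [marked_smul]; exact Submodule.smul_mem _ _ hx
  · rintro _ ⟨t, l, rfl, rfl⟩
    exact monomial_mem_deg t l

theorem isInternal_deg (I : FinOrd) : DirectSum.IsInternal ((inclusionExclusion k G).deg I) := by
  refine DirectSum.isInternal_submodule_of_iSupIndep_of_iSup_eq_top (fun p => ?_) ?_
  · rw [Submodule.disjoint_def]
    refine fun a hp hq => ext_marks fun t => ?_
    have hind := (DirectSum.Decomposition.isInternal
      (fun p => ⋀[k]^p (t.1.Divisor G →₀ k))).submodule_iSupIndep p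
    rw [map_zero]
    refine Submodule.disjoint_def.1 hind _ (mem_deg_iff.1 hp t) ?_
    have := Submodule.mem_map_of_mem (f := marks t) hq
    simp only [Submodule.map_iSup] at this
    refine (iSup₂_mono fun q _ => ?_ : _ ≤ ⨆ q, ⨆ (_ : q ≠ p), ⋀[k]^q (t.1.Divisor G →₀ k)) this
    rintro _ ⟨b, hb, rfl⟩
    exact mem_deg_iff.1 hb t
  · rw [eq_top_iff, ← span_monomial, Submodule.span_le]
    rintro _ ⟨t, l, rfl⟩
    exact Submodule.mem_iSup_of_mem l.length (monomial_mem_deg t l)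

end Monomials
end ShuffleOperad

namespace ShuffleOperad

/-! ### The axioms of a dg operad for the inclusion-exclusion operad -/

section Axioms

variable {k : Type u} [Field k] {M : ℕ → Type v} {G : Set (Tree M)}

theorem image_append_image (v w : List ℕ) (l : List (Finset (List ℕ))) :
    (l.map (Finset.image (w ++ ·))).map (Finset.image (v ++ ·)) =
      l.map (Finset.image (v ++ w ++ ·)) := by
  rw [List.map_map]
  congr 1
  funext S
  simp [Finset.image_image, Function.comp_def]

theorem monomial_append_comm {I : FinOrd} (t : TreeMonomial M I) (l l' l'' : List (t.1.Divisor G)) :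
    monomial k G t (l ++ l' ++ l'') =
      (-1 : k) ^ (l'.length * l''.length) • monomial k G t (l ++ l'' ++ l') := by
  rw [monomial, monomial, ← marked_smul, wedge_append, wedge_append, wedge_append, wedge_append,
    mul_assoc, wedge_mul_comm, mul_smul_comm, mul_assoc]

/-- It suffices to check the axioms on tree monomials marked by lists of divisors, where each of
them amounts to an identity between tree monomials and an equality of lists of sets of vertices. In
the axiom of parallel composition two blocks of the list are exchanged, which gives the Koszul
sign. -/
theorem isGradedOperad_inclusionExclusion :
    IsGradedOperad (inclusionExclusion k G).toGradedData where
  graded := isInternal_deg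
  relabel_deg {I J} h p a ha := by
    rw [deg_eq_span] at ha
    induction ha using Submodule.span_induction with
    | mem x hx =>
      obtain ⟨t, l, hl, rfl⟩ := hx
      rw [relabel_monomial, ← hl, ← List.length_map (TreeMonomial.rename h t)]
      exact monomial_mem_deg _ _
    | zero => rw [map_zero]; exact Submodule.zero_mem _
    | add x y _ _ hx hy => rw [map_add]; exact Submodule.add_mem _ hx hy
    | smul r x _ hx => rw [map_smul]; exact Submodule.smul_mem _ _ hx
  relabel_refl {I} a := by
    induction a using monomial_induction with
    | hm t l =>
      rw [relabel_monomial]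
      exact monomial_congr t.relabel_refl (map_support_rename _ _ _)
    | h0 => rw [map_zero]
    | ha x y hx hy => rw [map_add, hx, hy]
    | hs r x hx => rw [map_smul, hx]
  relabel_trans h h' a := by
    induction a using monomial_induction with
    | hm t l =>
      rw [relabel_monomial, relabel_monomial, relabel_monomial]
      exact monomial_congr (t.relabel_trans h h')
        ((map_support_rename _ _ _).trans
          ((map_support_rename _ _ _).trans (map_support_rename _ _ _).symm))
    | h0 => simp only [map_zero]
    | ha x y hx hy => simp only [map_add, hx, hy]
    | hs r x hx => simp only [map_smul, hx]
  one_deg i := monomial_mem_deg (TreeMonomial.one i) []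
  relabel_one i j h := by
    rw [one_eq_monomial, one_eq_monomial, relabel_monomial]
    exact monomial_congr (TreeMonomial.relabel_one h) rfl
  comp_deg {I J K} h p q a ha b hb := by
    rw [deg_eq_span] at ha
    induction ha using Submodule.span_induction with
    | mem x hx =>
      obtain ⟨t, l, hl, rfl⟩ := hx
      rw [deg_eq_span] at hb
      induction hb using Submodule.span_induction with
      | mem x hx =>
        obtain ⟨s, l', hl', rfl⟩ := hx
        rw [comp_monomial]
        have := monomial_mem_deg (k := k) (t.graft h s)
          (l.map (TreeMonomial.left h t s) ++ l'.map (TreeMonomial.right h t s))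
        rwa [List.length_append, List.length_map, List.length_map, hl, hl'] at this
      | zero => rw [map_zero]; exact Submodule.zero_mem _
      | add x y _ _ hx hy => rw [map_add]; exact Submodule.add_mem _ hx hy
      | smul r x _ hx => rw [map_smul]; exact Submodule.smul_mem _ _ hx
    | zero => rw [map_zero]; exact Submodule.zero_mem _
    | add x y _ _ hx hy => rw [map_add]; exact Submodule.add_mem _ hx hy
    | smul r x _ hx => rw [map_smul]; exact Submodule.smul_mem _ _ hx
  relabel_comp {I J K I' J' K'} h h' e he eI eJ eK hI hJ hK a b := by
    induction a using monomial_induction with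
    | hm t l =>
      induction b using monomial_induction with
      | hm s l' =>
        rw [comp_monomial, relabel_monomial, relabel_monomial, relabel_monomial, comp_monomial]
        refine monomial_congr (TreeMonomial.relabel_graft h h' he eI eJ eK hI hJ hK t s) ?_
        simp only [List.map_append, map_support_left, map_support_right, map_support_rename]
        rw [TreeMonomial.address_relabel h he eI eJ hI hJ t]
      | h0 => simp only [map_zero]
      | ha x y hx hy => simp only [map_add, hx, hy]
      | hs r x hx => simp only [map_smul, hx]
    | h0 => simp only [map_zero, LinearMap.zero_apply]
    | ha x y hx hy => simp only [map_add, LinearMap.add_apply, hx, hy]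
    | hs r x hx => simp only [map_smul, LinearMap.smul_apply, hx]
  one_comp {I} i h a := by
    induction a using monomial_induction with
    | hm t l =>
      rw [one_eq_monomial, comp_monomial]
      refine monomial_congr (TreeMonomial.one_graft h t) ?_
      simp only [List.map_append, map_support_left, map_support_right]
      simp [TreeMonomial.one, Tree.address]
    | h0 => rw [map_zero]
    | ha x y hx hy => rw [map_add, hx, hy]
    | hs r x hx => rw [map_smul, hx]
  comp_one {I} i h a := by
    induction a using monomial_induction with
    | hm t l =>
      rw [one_eq_monomial, comp_monomial]
      refine monomial_congr (TreeMonomial.graft_one h t) ?_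
      simp only [List.map_append, map_support_left, map_support_right]
      simp
    | h0 => rw [map_zero, LinearMap.zero_apply]
    | ha x y hx hy => rw [map_add, LinearMap.add_apply, hx, hy]
    | hs r x hx => rw [map_smul, LinearMap.smul_apply, hx]
  comp_assoc {I J K L N R} h₁ h₂ h₃ h₄ a b c := by
    induction a using monomial_induction with
    | hm t l =>
      induction b using monomial_induction with
      | hm s l' =>
        induction c using monomial_induction with
        | hm r l'' =>
          rw [comp_monomial, comp_monomial, comp_monomial, comp_monomial]
          refine monomial_congr (TreeMonomial.graft_graft h₁ h₂ h₃ h₄ t s r) ?_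
          have hR : R.least = J.least := by
            rw [← (s.graft h₃ r).minLeaf_eq, ← s.minLeaf_eq]
            exact Tree.minLeaf_graft r.minLeaf_eq s.1
          simp only [List.map_append, map_support_left, map_support_right]
          rw [TreeMonomial.address_graft_right h₁ h₃, hR, image_append_image, List.append_assoc]
        | h0 => simp only [map_zero]
        | ha x y hx hy => simp only [map_add, hx, hy]
        | hs r x hx => simp only [map_smul, hx]
      | h0 => simp only [map_zero, LinearMap.zero_apply]
      | ha x y hx hy => simp only [map_add, LinearMap.add_apply, hx, hy]
      | hs r x hx => simp only [map_smul, LinearMap.smul_apply, hx]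
    | h0 => simp only [map_zero, LinearMap.zero_apply]
    | ha x y hx hy => simp only [map_add, LinearMap.add_apply, hx, hy]
    | hs r x hx => simp only [map_smul, LinearMap.smul_apply, hx]
  comp_comm {I J K L N R} h₁ h₂ h₃ h₄ hJL p q a b hb c hc := by
    induction a using monomial_induction with
    | hm t l =>
      rw [deg_eq_span] at hb
      induction hb using Submodule.span_induction with
      | mem x hx =>
        obtain ⟨s, l', hl', rfl⟩ := hx
        rw [deg_eq_span] at hc
        induction hc using Submodule.span_induction with
        | mem x hx =>
          obtain ⟨r, l'', hl'', rfl⟩ := hx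
          rw [comp_monomial, comp_monomial, comp_monomial, comp_monomial, ← hl', ← hl'']
          rw [List.map_append, monomial_append_comm]
          simp only [List.length_map]
          refine congrArg _ (monomial_congr (TreeMonomial.graft_comm h₁ h₂ h₃ h₄ hJL t s r) ?_)
          simp only [List.map_append, map_support_left, map_support_right]
          rw [TreeMonomial.address_graft_left h₁ h₃ hJL,
            TreeMonomial.address_graft_left h₃ h₁ hJL.symm]
        | zero => simp only [map_zero, LinearMap.zero_apply, smul_zero]
        | add x y _ _ hx hy => simp only [map_add, LinearMap.add_apply, smul_add, hx, hy]
        | smul r x _ hx => simp only [map_smul, LinearMap.smul_apply, hx, smul_comm r]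
      | zero => simp only [map_zero, LinearMap.zero_apply, smul_zero]
      | add x y _ _ hx hy => simp only [map_add, LinearMap.add_apply, smul_add, hx, hy]
      | smul r x _ hx => simp only [map_smul, LinearMap.smul_apply, hx, smul_comm r]
    | h0 => simp only [map_zero, LinearMap.zero_apply, smul_zero]
    | ha x y hx hy => simp only [map_add, LinearMap.add_apply, smul_add, hx, hy]
    | hs r x hx => simp only [map_smul, LinearMap.smul_apply, hx, smul_comm r]

theorem markComp_wedge {I J K : FinOrd} (h : IsGraft I J K) (t : TreeMonomial M I)
    (s : TreeMonomial M J) (l : List (t.1.Divisor G)) (y : Marks k G s.1) :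
    markComp k G h t s (wedge k l) y = wedge k (l.map (TreeMonomial.left h t s)) *
      ExteriorAlgebra.map (Finsupp.lmapDomain k k (TreeMonomial.right h t s)) y :=
  congrArg (· * _) (map_wedge k (TreeMonomial.left h t s) l)

/-- The differential is compatible with compositions since `unmark` is a derivation commuting with
the maps of exterior algebras induced by maps of generators. -/
theorem isDGOperad_inclusionExclusion : IsDGOperad (inclusionExclusion k G) where
  toIsGradedOperad := isGradedOperad_inclusionExclusion
  d_deg I p a ha := by
    rw [deg_eq_span] at ha
    induction ha using Submodule.span_induction with
    | mem x hx =>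
      obtain ⟨t, l, hl, rfl⟩ := hx
      rw [monomial, d_marked]
      exact marked_mem_deg t (unmark_wedge_mem k l p hl)
    | zero => rw [map_zero]; exact Submodule.zero_mem _
    | add x y _ _ hx hy => rw [map_add]; exact Submodule.add_mem _ hx hy
    | smul r x _ hx => rw [map_smul]; exact Submodule.smul_mem _ _ hx
  d_deg_zero I a ha := by
    rw [deg_eq_span] at ha
    induction ha using Submodule.span_induction with
    | mem x hx =>
      obtain ⟨t, l, hl, rfl⟩ := hx
      rw [monomial, d_marked, List.length_eq_zero_iff.1 hl, wedge_nil, unmark_one, marked_zero]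
    | zero => rw [map_zero]
    | add x y _ _ hx hy => rw [map_add, hx, hy, add_zero]
    | smul r x _ hx => rw [map_smul, hx, smul_zero]
  d_d I a := by
    induction a using marked_induction with
    | h0 => rw [map_zero, map_zero]
    | hm t x => rw [d_marked, d_marked, unmark_unmark, marked_zero]
    | ha x y hx hy => rw [map_add, map_add, hx, hy, add_zero]
  d_relabel h a := by
    induction a using marked_induction with
    | h0 => simp only [map_zero]
    | hm t x =>
      rw [d_marked, relabel_marked, relabel_marked, d_marked]
      exact congrArg _ (unmark_map k (TreeMonomial.rename h t) x)
    | ha x y hx hy => simp only [map_add, hx, hy]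
  d_comp {I J K} h p a ha b := by
    rw [deg_eq_span] at ha
    induction ha using Submodule.span_induction with
    | mem x hx =>
      obtain ⟨t, l, hl, rfl⟩ := hx
      induction b using marked_induction with
      | h0 => simp only [map_zero, smul_zero, add_zero]
      | hm s y =>
        rw [monomial, comp_marked, d_marked, d_marked, d_marked, comp_marked, comp_marked,
          ← marked_smul, ← marked_add]
        refine congrArg _ ?_
        rw [markComp_wedge, markComp_wedge, unmark_wedge_mul, List.length_map, hl, ← map_wedge,
          unmark_map, unmark_map]
        rfl
      | ha x y hx hy =>
        simp only [map_add, hx, hy, smul_add]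
        abel
    | zero => simp only [map_zero, LinearMap.zero_apply, smul_zero, add_zero]
    | add x y _ _ hx hy =>
      simp only [map_add, LinearMap.add_apply, hx, hy, smul_add]
      abel
    | smul r x _ hx => simp only [map_smul, LinearMap.smul_apply, hx, smul_add, smul_comm r]

end Axioms
end ShuffleOperad

namespace ShuffleOperad

/-! ### The monomial ideal -/

section Ideal

variable {k : Type u} [Field k] {M : ℕ → Type v} {G : Set (Tree M)}

/-- Every vertex `v` of a tree monomial cuts it into two tree monomials, the second of which grows
from `v`. -/
theorem TreeMonomial.exists_graft {K : FinOrd} (t : TreeMonomial M K) {v : List ℕ}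
    (hv : v ∈ t.1.vertices) : ∃ (I J : FinOrd) (h : IsGraft I J K) (c : TreeMonomial M I)
      (s : TreeMonomial M J), c.graft h s = t ∧ c.1.address J.least = v ∧
      s.1.vertices.card ≠ 0 := by
  obtain ⟨s, c, hs, hc, hj, hd, h0, ha, hg⟩ := t.2.1.exists_graft hv
  refine ⟨⟨c.leaves, c.leaves_nonempty⟩, ⟨s.leaves, s.leaves_nonempty⟩, ⟨?_, ?_⟩, ⟨c, hc, rfl⟩,
    ⟨s, hs, rfl⟩, Subtype.ext hg.symm, ha, h0⟩
  · ext x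
    simp only [Finset.mem_inter, Finset.mem_singleton]
    refine ⟨fun hx => hd x hx.2 hx.1, ?_⟩
    rintro rfl
    exact ⟨hj, s.minLeaf_mem⟩
  · rw [← t.2.2, hg]
    ext x
    simp only [Finset.mem_union, Tree.mem_leaves_graft]
    by_cases hx : x = s.minLeaf
    · subst hx; simp [hj, s.minLeaf_mem]
    · simp [hx, hj]

theorem Tree.prune_eq_self {t : Tree M} {S : Finset (List ℕ)} {p : List ℕ}
    (h : ∀ v ∈ t.vertices, p ++ v ∈ S) : t.prune S p = t := by
  induction t generalizing p with
  | leaf i => rfl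
  | node n m c ih =>
    have hp : p ∈ S := by simpa using h [] (by simp [Tree.vertices])
    simp only [Tree.prune, hp, if_true]
    congr 1
    funext i
    refine ih i fun v hv => ?_
    rw [List.append_assoc]
    exact h _ (Tree.mem_vertices_node.2 (Or.inr ⟨i, v, hv, rfl⟩))

theorem freeComp_single {I J K : FinOrd} (h : IsGraft I J K) (t : TreeMonomial M I)
    (s : TreeMonomial M J) (r r' : k) :
    freeComp k h (Finsupp.single t r) (Finsupp.single s r') =
      Finsupp.single (t.graft h s) (r * r') := by
  simp [freeComp, Finsupp.mapDomain_single]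

theorem freeRelabel_single {I J : FinOrd} (h : I.1.card = J.1.card) (t : TreeMonomial M I)
    (r : k) : freeRelabel k h (Finsupp.single t r) = Finsupp.single (t.relabel h) r := by
  simp [freeRelabel, Finsupp.mapDomain_single]

theorem nonempty_divisor_iff {t : Tree M} :
    Nonempty (t.Divisor G) ↔ ∃ S, Tree.IsDivisor G t S :=
  ⟨fun ⟨D⟩ => ⟨D.1, D.2⟩, fun ⟨S, hS⟩ => ⟨⟨S, hS⟩⟩⟩

/-- A tree monomial with a divisor in `G` belongs to every ideal containing `G`: cutting off the
vertices outside of the divisor one can reduce to the case of a divisor containing all vertices. -/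
theorem single_mem_of_isDivisor {N : ∀ I : FinOrd, Submodule k (TreeMonomial M I →₀ k)}
    (hN : IsIdeal k N)
    (hNG : ∀ J (t : TreeMonomial M J), t.1 ∈ G → Finsupp.single t 1 ∈ N J)
    (hG : ∀ g ∈ G, g.Canonical) {K : FinOrd} (t : TreeMonomial M K)
    {S : Finset (List ℕ)} (hS : Tree.IsDivisor G t.1 S) : Finsupp.single t 1 ∈ N K := by
  induction hn : t.1.vertices.card using Nat.strong_induction_on generalizing K S with
  | _ n ih =>
    have hS' := hS
    obtain ⟨r, hr, g, hg, hsh⟩ := hS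
    by_cases hr0 : r = []
    · subst hr0
      by_cases hall : ∀ v ∈ t.1.vertices, v ∈ S
      -- The divisor is all of `t`, which is therefore a relabelling of an element of `G`.
      · have hgr : t.1.growing [] = t.1 := by cases t.1 <;> rfl
        rw [Tree.restrict, hgr, Tree.prune_eq_self (by simpa using hall)] at hsh
        obtain ⟨e, he, hte⟩ := hsh
        have hK : g.leaves.image e = K.1 := by rw [← Tree.leaves_mapLeaves, ← hte, t.2.2]
        let J : FinOrd := ⟨g.leaves, g.leaves_nonempty⟩
        let g' : TreeMonomial M J := ⟨g, hG g hg, rfl⟩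
        have hJK : J.1.card = K.1.card := by
          rw [← hK, Finset.card_image_of_injOn he.injOn]
        have ht : g'.relabel hJK = t := by
          refine Subtype.ext ?_
          rw [hte]
          exact Tree.mapLeaves_congr fun x hx => orderBij_eq (I := J) he hK hx
        have := hN.relabel_mem hJK _ (hNG J g' hg)
        rwa [freeRelabel_single, ht] at this
      -- The divisor contains the root; a vertex outside of it can be cut off.
      · push Not at hall
        obtain ⟨v, hv, hvS⟩ := hall
        obtain ⟨I, J, h, c, s, rfl, ha, h0⟩ := t.exists_graft hv
        have hsub : S ⊆ c.1.vertices := by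
          intro x hx
          rcases (Tree.mem_vertices_graft c.2.1 (c.least_mem_leaves h)).1 (hr.subset hx) with
            h | ⟨y, -, rfl⟩
          · exact h
          · refine absurd (hr.path_mem _ hx v (List.nil_prefix) ?_) hvS
            rw [ha]
            exact List.prefix_append _ _
        have hcard := Tree.card_vertices_graft (s := s.1) c.2.1 (c.least_mem_leaves h)
        have hc := ih c.1.vertices.card (by rw [← hn]; simp only [TreeMonomial.graft]; omega) c
          (hS'.of_graft_left s.minLeaf_eq hsub) rfl
        have := hN.comp_mem_left h _ hc (Finsupp.single s 1)
        rwa [freeComp_single, one_mul] at this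
    -- The divisor does not contain the root of `t`; everything outside of the subtree growing from
    -- the root of the divisor can be cut off.
    · obtain ⟨I, J, h, c, s, rfl, ha, h0⟩ := t.exists_graft (hr.subset hr.root_mem)
      have hex : ∀ v ∈ S, ∃ x, c.1.address J.least ++ x = v := fun v hv => by
        rw [ha]; exact hr.root_prefix v hv
      obtain ⟨S₀, rfl⟩ : ∃ S₀ : Finset (List ℕ), S₀.image (c.1.address J.least ++ ·) = S := by
        refine ⟨S.preimage (c.1.address J.least ++ ·)
          (List.append_right_injective _).injOn, ?_⟩
        classical
        rw [Finset.image_preimage]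
        exact Finset.filter_true_of_mem hex
      have hsub : S₀ ⊆ s.1.vertices := by
        intro x hx
        rcases (Tree.mem_vertices_graft c.2.1 (c.least_mem_leaves h)).1
          (hr.subset (Finset.mem_image_of_mem _ hx)) with h' | ⟨y, hy, hyx⟩
        · exact absurd h' (Tree.address_append_notMem (c.least_mem_leaves h) x)
        · rwa [← List.append_cancel_left hyx]
      have hc0 : c.1.vertices.card ≠ 0 := by
        intro h'
        obtain ⟨i, hi⟩ := Tree.card_vertices_eq_zero.1 h'
        rw [hi] at ha
        exact hr0 (by simpa [Tree.address] using ha.symm)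
      have hcard := Tree.card_vertices_graft (s := s.1) c.2.1 (c.least_mem_leaves h)
      have hs := ih s.1.vertices.card (by rw [← hn]; simp only [TreeMonomial.graft]; omega) s
        (hS'.of_graft_right (c.least_mem_leaves h) hsub) rfl
      have := hN.comp_mem_right h (Finsupp.single c 1) _ hs
      rwa [freeComp_single, one_mul] at this

variable (k G) in
/-- The subspace of the free operad spanned by the tree monomials with a divisor in `G`. -/
noncomputable def divisibleSpan (I : FinOrd) : Submodule k (TreeMonomial M I →₀ k) :=
  Submodule.span k {a | ∃ t : TreeMonomial M I, Nonempty (t.1.Divisor G) ∧ Finsupp.single t 1 = a}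

theorem single_mem_divisibleSpan {I : FinOrd} {t : TreeMonomial M I}
    (h : Nonempty (t.1.Divisor G)) (r : k) : Finsupp.single t r ∈ divisibleSpan k G I := by
  have := Submodule.smul_mem _ r (Submodule.subset_span ⟨t, h, rfl⟩ :
    Finsupp.single t (1 : k) ∈ divisibleSpan k G I)
  rwa [Finsupp.smul_single, smul_eq_mul, mul_one] at this

theorem isIdeal_divisibleSpan : IsIdeal k (divisibleSpan k G (M := M)) where
  relabel_mem {I J} h a ha := by
    induction ha using Submodule.span_induction with
    | mem x hx =>
      obtain ⟨t, ⟨D⟩, rfl⟩ := hx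
      rw [freeRelabel_single]
      exact single_mem_divisibleSpan ⟨TreeMonomial.rename h t D⟩ 1
    | zero => rw [map_zero]; exact Submodule.zero_mem _
    | add x y _ _ hx hy => rw [map_add]; exact Submodule.add_mem _ hx hy
    | smul r x _ hx => rw [map_smul]; exact Submodule.smul_mem _ _ hx
  comp_mem_left {I J K} h a ha b := by
    induction ha using Submodule.span_induction with
    | mem x hx =>
      obtain ⟨t, ⟨D⟩, rfl⟩ := hx
      induction b using Finsupp.induction_linear with
      | zero => rw [map_zero]; exact Submodule.zero_mem _
      | add x y hx hy => rw [map_add]; exact Submodule.add_mem _ hx hy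
      | single s r =>
        rw [freeComp_single]
        exact single_mem_divisibleSpan ⟨TreeMonomial.left h t s D⟩ _
    | zero => rw [map_zero]; exact Submodule.zero_mem _
    | add x y _ _ hx hy => rw [map_add]; exact Submodule.add_mem _ hx hy
    | smul r x _ hx => rw [map_smul]; exact Submodule.smul_mem _ _ hx
  comp_mem_right {I J K} h a b hb := by
    induction hb using Submodule.span_induction with
    | mem x hx =>
      obtain ⟨s, ⟨D⟩, rfl⟩ := hx
      induction a using Finsupp.induction_linear with
      | zero => rw [map_zero]; exact Submodule.zero_mem _
      | add x y hx hy => rw [map_add]; exact Submodule.add_mem _ hx hy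
      | single t r =>
        rw [freeComp_single]
        exact single_mem_divisibleSpan ⟨TreeMonomial.right h t s D⟩ _
    | zero => rw [map_zero]; exact Submodule.zero_mem _
    | add x y _ _ hx hy => rw [map_add]; exact Submodule.add_mem _ hx hy
    | smul r x _ hx => rw [map_smul]; exact Submodule.smul_mem _ _ hx

/-- A non-degenerate element of `G` is a divisor of itself. The degenerate tree has no vertices and
hence no divisors. -/
theorem nonempty_divisor_of_mem {t : Tree M} (ht : t ∈ G) (h0 : ∀ i, t ≠ Tree.leaf i) :
    Nonempty (t.Divisor G) := by
  refine nonempty_divisor_iff.2 ⟨t.vertices, [], ⟨?_, subset_rfl, fun v _ => List.nil_prefix,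
    fun v hv x _ hx => ?_⟩, t, ht, id, strictMonoOn_id, ?_⟩
  · cases t with
    | leaf i => exact absurd rfl (h0 i)
    | node n m c => simp [Tree.vertices]
  · clear ht h0
    induction x generalizing t v with
    | nil =>
      cases t with
      | leaf i => simp [Tree.vertices] at hv
      | node n m c => simp [Tree.vertices]
    | cons a x ih =>
      cases t with
      | leaf i => simp [Tree.vertices] at hv
      | node n m c =>
        obtain ⟨w, rfl⟩ := hx
        obtain ⟨i, y, hy, h⟩ := (Tree.mem_vertices_node.1 hv).resolve_left (by simp)
        obtain ⟨rfl, rfl⟩ := List.cons.inj h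
        exact Tree.mem_vertices_node.2
          (Or.inr ⟨i, x, ih _ hy List.nil_prefix (List.prefix_append x w), rfl⟩)
  · have hgr : t.growing [] = t := by cases t <;> rfl
    rw [Tree.restrict, hgr, Tree.prune_eq_self (by simp)]
    exact (Tree.mapLeaves_eq_self fun _ _ => rfl).symm

theorem monomialIdeal_le_divisibleSpan (hG : ∀ g ∈ G, ∀ i, g ≠ Tree.leaf i) (I : FinOrd) :
    monomialIdeal k G I ≤ divisibleSpan k G I := fun _ ha =>
  (mem_monomialIdeal k G).1 ha _ isIdeal_divisibleSpan fun _ t ht =>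
    single_mem_divisibleSpan (nonempty_divisor_of_mem ht (hG t.1 ht)) 1

theorem single_mem_monomialIdeal (hG : ∀ g ∈ G, g.Canonical) {I : FinOrd} {t : TreeMonomial M I}
    (h : Nonempty (t.1.Divisor G)) : Finsupp.single t 1 ∈ monomialIdeal k G I := by
  obtain ⟨S, hS⟩ := nonempty_divisor_iff.1 h
  exact (mem_monomialIdeal k G).2 fun N h1 h2 => single_mem_of_isDivisor h1 h2 hG t hS

end Ideal
end ShuffleOperad

namespace ShuffleOperad

/-! ### The augmentation -/

section Augmentation

variable {k : Type u} [Field k] {M : ℕ → Type v} {G : Set (Tree M)}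

theorem algebraMapInv_wedge_cons {D : Type v} (x : D) (l : List D) :
    ExteriorAlgebra.algebraMapInv (wedge k (x :: l)) = 0 := by
  simp [ExteriorAlgebra.algebraMapInv]

theorem algebraMapInv_map {D : Type v} {D' : Type v} (f : D → D')
    (x : ExteriorAlgebra k (D →₀ k)) :
    ExteriorAlgebra.algebraMapInv (ExteriorAlgebra.map (Finsupp.lmapDomain k k f) x) =
      ExteriorAlgebra.algebraMapInv x := by
  suffices (ExteriorAlgebra.algebraMapInv (R := k)).comp
      (ExteriorAlgebra.map (Finsupp.lmapDomain k k f)) = ExteriorAlgebra.algebraMapInv from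
    DFunLike.congr_fun this x
  ext
  simp [ExteriorAlgebra.algebraMapInv]

theorem eq_algebraMap_of_isEmpty {D : Type v} [IsEmpty D] (x : ExteriorAlgebra k (D →₀ k)) :
    x = algebraMap k _ (ExteriorAlgebra.algebraMapInv x) := by
  have hx : x ∈ Submodule.span k (Set.range (wedge k)) := by rw [span_wedge]; trivial
  induction hx using Submodule.span_induction with
  | mem x hx =>
    obtain ⟨l, rfl⟩ := hx
    cases l with
    | nil => simp
    | cons x l => exact isEmptyElim x
  | zero => simp
  | add x y _ _ hx hy => rw [map_add, map_add, ← hx, ← hy]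
  | smul r x _ hx => rw [map_smul, smul_eq_mul, map_mul, ← hx, Algebra.smul_def]

/-- Comparison with the monomial operad: the projection to the marks of degree zero. -/
noncomputable def augmentation (I : FinOrd) :
    (inclusionExclusion k G).obj I →ₗ[k] (monomialOperad k G).obj I := by
  classical
  exact DirectSum.toModule k (TreeMonomial M I) ((TreeMonomial M I →₀ k) ⧸ monomialIdeal k G I)
    fun t => (ExteriorAlgebra.algebraMapInv (R := k)
      (M := t.1.Divisor G →₀ k)).toLinearMap.smulRight
        ((monomialIdeal k G I).mkQ (Finsupp.single t 1))

theorem augmentation_marked {I : FinOrd} (t : TreeMonomial M I) (x : Marks k G t.1) :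
    augmentation I (marked k G t x) = ExteriorAlgebra.algebraMapInv x • monomialClass k G t := by
  classical
  exact DirectSum.toModule_lof k (M := fun t : TreeMonomial M I => Marks k G t.1)
    (N := (TreeMonomial M I →₀ k) ⧸ monomialIdeal k G I) t x

theorem comp_monomialClass {I J K : FinOrd} (h : IsGraft I J K) (t : TreeMonomial M I)
    (s : TreeMonomial M J) : (monomialOperad k G).comp h (monomialClass k G t)
      (monomialClass k G s) = monomialClass k G (t.graft h s) := by
  have : (monomialOperad k G).comp h (monomialClass k G t) (monomialClass k G s) =
      (monomialIdeal k G K).mkQ (freeComp k h (Finsupp.single t 1) (Finsupp.single s 1)) := rfl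
  rw [this, freeComp_single, mul_one]
  rfl

theorem relabel_monomialClass {I J : FinOrd} (h : I.1.card = J.1.card) (t : TreeMonomial M I) :
    (monomialOperad k G).relabel h (monomialClass k G t) = monomialClass k G (t.relabel h) := by
  have : (monomialOperad k G).relabel h (monomialClass k G t) =
      (monomialIdeal k G J).mkQ (freeRelabel k h (Finsupp.single t 1)) := rfl
  rw [this, freeRelabel_single]
  rfl

theorem augmentation_comp {I J K : FinOrd} (h : IsGraft I J K)
    (a : (inclusionExclusion k G).obj I) (b : (inclusionExclusion k G).obj J) :
    augmentation K ((inclusionExclusion k G).comp h a b) =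
      (monomialOperad k G).comp h (augmentation I a) (augmentation J b) := by
  induction a using marked_induction with
  | h0 => simp only [map_zero, LinearMap.zero_apply]
  | hm t x =>
    induction b using marked_induction with
    | h0 => simp only [map_zero]
    | hm s y =>
      rw [comp_marked, augmentation_marked, augmentation_marked, augmentation_marked, map_smul,
        map_smul, LinearMap.smul_apply, comp_monomialClass, smul_smul]
      congr 1
      refine (map_mul ExteriorAlgebra.algebraMapInv _ _).trans ?_
      rw [mul_comm]
      exact congrArg₂ (· * ·) (algebraMapInv_map (TreeMonomial.right h t s) y)
        (algebraMapInv_map (TreeMonomial.left h t s) x)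
    | ha x y hx hy => simp only [map_add, hx, hy]
  | ha x y hx hy => simp only [map_add, LinearMap.add_apply, hx, hy]

theorem augmentation_relabel {I J : FinOrd} (h : I.1.card = J.1.card)
    (a : (inclusionExclusion k G).obj I) :
    augmentation J ((inclusionExclusion k G).relabel h a) =
      (monomialOperad k G).relabel h (augmentation I a) := by
  induction a using marked_induction with
  | h0 => simp only [map_zero]
  | hm t x =>
    rw [relabel_marked, augmentation_marked, augmentation_marked, map_smul, relabel_monomialClass]
    exact congrArg (· • _) (algebraMapInv_map (TreeMonomial.rename h t) x)
  | ha x y hx hy => simp only [map_add, hx, hy]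

theorem augmentation_one (i : ℕ) :
    augmentation _ ((inclusionExclusion k G).one i) = (monomialOperad k G).one i := by
  rw [one_eq_monomial, monomial, augmentation_marked, wedge_nil, map_one, one_smul]
  rfl

theorem mem_deg_zero {I : FinOrd} (a : (monomialOperad k G).obj I) :
    a ∈ (monomialOperad k G).deg I 0 :=
  Submodule.mem_top (R := k) (M := (TreeMonomial M I →₀ k) ⧸ monomialIdeal k G I)

theorem mem_deg_succ {I : FinOrd} {p : ℕ} (hp : p ≠ 0) {a : (monomialOperad k G).obj I} :
    a ∈ (monomialOperad k G).deg I p ↔ a = 0 := by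
  have : (monomialOperad k G).deg I p = ⊥ := if_neg hp
  rw [this, Submodule.mem_bot]

theorem augmentation_mem_deg {I : FinOrd} {p : ℕ} {a : (inclusionExclusion k G).obj I}
    (ha : a ∈ (inclusionExclusion k G).deg I p) :
    augmentation I a ∈ (monomialOperad k G).deg I p := by
  rcases Nat.eq_zero_or_pos p with rfl | hp
  · exact mem_deg_zero _
  · rw [mem_deg_succ hp.ne']
    rw [deg_eq_span] at ha
    induction ha using Submodule.span_induction with
    | mem x hx =>
      obtain ⟨t, l, hl, rfl⟩ := hx
      cases l with
      | nil => simp at hl; omega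
      | cons D l => rw [monomial, augmentation_marked, algebraMapInv_wedge_cons, zero_smul]
    | zero => rw [map_zero]
    | add x y _ _ hx hy => rw [map_add, hx, hy, add_zero]
    | smul r x _ hx => rw [map_smul, hx, smul_zero]

theorem exists_augmentation_eq {I : FinOrd} (q : (monomialOperad k G).obj I) :
    ∃ a ∈ (inclusionExclusion k G).deg I 0, augmentation I a = q := by
  obtain ⟨f, rfl⟩ := (monomialIdeal k G I).mkQ_surjective q
  induction f using Finsupp.induction_linear with
  | zero => exact ⟨0, Submodule.zero_mem _,
      (map_zero _).trans (map_zero (monomialIdeal k G I).mkQ).symm⟩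
  | add f g hf hg =>
    obtain ⟨a, ha, ha'⟩ := hf
    obtain ⟨b, hb, hb'⟩ := hg
    exact ⟨a + b, Submodule.add_mem _ ha hb, by rw [map_add, map_add, ha', hb']; rfl⟩
  | single t r =>
    refine ⟨r • marked k G t 1, Submodule.smul_mem _ _ (monomial_mem_deg t []), ?_⟩
    rw [map_smul, augmentation_marked, map_one, one_smul]
    refine ((monomialIdeal k G I).mkQ.map_smul r _).symm.trans ?_
    rw [Finsupp.smul_single, smul_eq_mul, mul_one]

/-- The axioms are inherited from the inclusion-exclusion operad through the augmentation, which is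
surjective and compatible with all operations. -/
theorem isGradedOperad_monomialOperad : IsGradedOperad (monomialOperad k G).toGradedData where
  graded I := by
    refine DirectSum.isInternal_submodule_of_iSupIndep_of_iSup_eq_top (fun p => ?_) ?_
    · rw [Submodule.disjoint_def]
      intro a ha ha'
      by_cases hp : p = 0
      · subst hp
        have : (⨆ q, ⨆ (_ : q ≠ 0), (monomialOperad k G).deg I q) ≤ ⊥ :=
          iSup₂_le fun q hq x hx => (mem_deg_succ hq).1 hx
        exact this ha'
      · exact (mem_deg_succ hp).1 ha
    · rw [eq_top_iff]
      exact fun a _ => Submodule.mem_iSup_of_mem 0 (mem_deg_zero a)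
  relabel_deg {I J} h p a ha := by
    rcases Nat.eq_zero_or_pos p with rfl | hp
    · exact mem_deg_zero _
    · rw [mem_deg_succ hp.ne'] at ha ⊢
      rw [ha, map_zero]
  relabel_refl a := by
    obtain ⟨a, -, rfl⟩ := exists_augmentation_eq a
    rw [← augmentation_relabel, isGradedOperad_inclusionExclusion.relabel_refl]
  relabel_trans h h' a := by
    obtain ⟨a, -, rfl⟩ := exists_augmentation_eq a
    simp only [← augmentation_relabel, isGradedOperad_inclusionExclusion.relabel_trans]
  one_deg i := mem_deg_zero _
  relabel_one i j h := by
    rw [← augmentation_one, ← augmentation_relabel, isGradedOperad_inclusionExclusion.relabel_one,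
      augmentation_one]
  comp_deg {I J K} h p q a ha b hb := by
    by_cases hp : p = 0
    · by_cases hq : q = 0
      · subst hp hq; exact mem_deg_zero _
      · rw [(mem_deg_succ hq).1 hb, map_zero]; exact Submodule.zero_mem _
    · rw [(mem_deg_succ hp).1 ha, map_zero, LinearMap.zero_apply]; exact Submodule.zero_mem _
  relabel_comp h h' e he eI eJ eK hI hJ hK a b := by
    obtain ⟨a, -, rfl⟩ := exists_augmentation_eq a
    obtain ⟨b, -, rfl⟩ := exists_augmentation_eq b
    simp only [← augmentation_relabel, ← augmentation_comp]
    rw [isGradedOperad_inclusionExclusion.relabel_comp h h' e he eI eJ eK hI hJ hK]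
  one_comp i h a := by
    obtain ⟨a, -, rfl⟩ := exists_augmentation_eq a
    rw [← augmentation_one, ← augmentation_comp, isGradedOperad_inclusionExclusion.one_comp]
  comp_one i h a := by
    obtain ⟨a, -, rfl⟩ := exists_augmentation_eq a
    rw [← augmentation_one, ← augmentation_comp, isGradedOperad_inclusionExclusion.comp_one]
  comp_assoc h₁ h₂ h₃ h₄ a b c := by
    obtain ⟨a, -, rfl⟩ := exists_augmentation_eq a
    obtain ⟨b, -, rfl⟩ := exists_augmentation_eq b
    obtain ⟨c, -, rfl⟩ := exists_augmentation_eq c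
    simp only [← augmentation_comp]
    rw [isGradedOperad_inclusionExclusion.comp_assoc h₁ h₂ h₃ h₄]
  comp_comm {I J K L N R} h₁ h₂ h₃ h₄ hJL p q a b hb c hc := by
    obtain ⟨a, -, rfl⟩ := exists_augmentation_eq a
    by_cases hp : p = 0
    · by_cases hq : q = 0
      · subst hp hq
        obtain ⟨b, hb', rfl⟩ := exists_augmentation_eq b
        obtain ⟨c, hc', rfl⟩ := exists_augmentation_eq c
        simp only [← augmentation_comp]
        rw [isGradedOperad_inclusionExclusion.comp_comm h₁ h₂ h₃ h₄ hJL 0 0 a b hb' c hc',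
          map_smul]
      · rw [(mem_deg_succ hq).1 hc]
        simp only [map_zero, LinearMap.zero_apply, smul_zero]
    · rw [(mem_deg_succ hp).1 hb]
      simp only [map_zero, LinearMap.zero_apply, smul_zero]

theorem isDGOperad_monomialOperad : IsDGOperad (monomialOperad k G) where
  toIsGradedOperad := isGradedOperad_monomialOperad
  d_deg _ _ _ _ := Submodule.zero_mem _
  d_deg_zero _ _ _ := rfl
  d_d _ _ := rfl
  d_relabel h a := (map_zero ((monomialOperad k G).relabel h)).symm
  d_comp {I J K} h p a _ b := by
    have h1 : (monomialOperad k G).d I a = 0 := rfl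
    have h2 : (monomialOperad k G).d J b = 0 := rfl
    have h3 : ∀ c, (monomialOperad k G).d K c = 0 := fun _ => rfl
    rw [h1, h2, h3, map_zero, map_zero, LinearMap.zero_apply, smul_zero, add_zero]

/-! ### Exactness -/

theorem unmark_eq_zero_of_isEmpty {D : Type v} [IsEmpty D] (x : ExteriorAlgebra k (D →₀ k)) :
    unmark k x = 0 := by
  rw [eq_algebraMap_of_isEmpty x, Algebra.algebraMap_eq_smul_one, map_smul, unmark_one, smul_zero]

theorem monomialClass_eq_zero (hG : ∀ g ∈ G, g.Canonical) {I : FinOrd} {t : TreeMonomial M I}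
    (h : Nonempty (t.1.Divisor G)) : monomialClass k G t = 0 :=
  (Submodule.Quotient.mk_eq_zero _).2 (single_mem_monomialIdeal hG h)

/-- The differential of a tree monomial marked by one divisor is this tree monomial without marks,
which belongs to the ideal because it has a divisor. -/
theorem augmentation_d (hG : ∀ g ∈ G, g.Canonical) {I : FinOrd}
    (a : (inclusionExclusion k G).obj I) : augmentation I ((inclusionExclusion k G).d I a) = 0 := by
  induction a using marked_induction with
  | h0 => rw [map_zero, map_zero]
  | hm t x =>
    rw [d_marked, augmentation_marked]
    rcases isEmpty_or_nonempty (t.1.Divisor G) with h | h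
    · rw [unmark_eq_zero_of_isEmpty, map_zero, zero_smul]
    · rw [monomialClass_eq_zero hG h, smul_zero]
  | ha x y hx hy => rw [map_add, map_add, hx, hy, add_zero]

/-- The morphism from the inclusion-exclusion operad to the monomial operad. -/
noncomputable def augmentationHom (hG : ∀ g ∈ G, g.Canonical) :
    DGHom (inclusionExclusion k G) (monomialOperad k G) where
  toFun := augmentation
  map_deg _ _ _ := augmentation_mem_deg
  map_relabel := augmentation_relabel
  map_one := augmentation_one
  map_comp := augmentation_comp
  map_d _ := augmentation_d hG

theorem marks_d {I : FinOrd} (t : TreeMonomial M I) (a : (inclusionExclusion k G).obj I) :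
    marks t ((inclusionExclusion k G).d I a) = unmark k (marks t a) := by
  induction a using marked_induction with
  | h0 => simp only [map_zero]
  | hm s x =>
    rw [d_marked]
    by_cases h : s = t
    · subst h
      rw [marks_marked_self, marks_marked_self]
    · rw [marks_marked_of_ne h, marks_marked_of_ne h, map_zero]
  | ha x y hx hy => simp only [map_add, hx, hy]

/-- Tree monomials without divisors in `G` are linearly independent in the monomial operad, since
the ideal lies in the span of the tree monomials with divisors. Hence an element of the kernel of
the augmentation has no component of degree zero at such a tree monomial. -/
theorem algebraMapInv_marks_eq_zero (hG : ∀ g ∈ G, ∀ i, g ≠ Tree.leaf i) {I : FinOrd}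
    {a : (inclusionExclusion k G).obj I} (ha : augmentation I a = 0) (t : TreeMonomial M I)
    (ht : IsEmpty (t.1.Divisor G)) : ExteriorAlgebra.algebraMapInv (marks t a) = 0 := by
  have hker : monomialIdeal k G I ≤ LinearMap.ker (Finsupp.lapply t : _ →ₗ[k] k) := by
    refine (monomialIdeal_le_divisibleSpan hG I).trans (Submodule.span_le.2 ?_)
    rintro _ ⟨s, hs, rfl⟩
    have hst : s ≠ t := by
      rintro rfl
      exact not_isEmpty_iff.2 hs ht
    simp [hst]
  let c : (monomialOperad k G).obj I →ₗ[k] k :=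
    Submodule.liftQ (monomialIdeal k G I) (Finsupp.lapply t) hker
  have hc : ∀ b, c (augmentation I b) = ExteriorAlgebra.algebraMapInv (marks t b) := by
    intro b
    induction b using marked_induction with
    | h0 => simp only [map_zero]
    | hm s x =>
      have hcs : c (monomialClass k G s) = Finsupp.single s (1 : k) t := rfl
      rw [augmentation_marked, map_smul, hcs]
      by_cases h : s = t
      · subst h
        rw [marks_marked_self, Finsupp.single_eq_same, smul_eq_mul, mul_one]
      · rw [marks_marked_of_ne h, Finsupp.single_eq_of_ne (Ne.symm h), smul_zero, map_zero]
    | ha x y hx hy => simp only [map_add, hx, hy]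
  rw [← hc, ha, map_zero]

/-- A cycle in the kernel of the augmentation is a boundary. On a tree monomial with a divisor,
multiplication by this divisor is a contracting homotopy; on a tree monomial without divisors the
complex is concentrated in degree zero and maps injectively to the monomial operad. -/
theorem mem_boundaries (hG : ∀ g ∈ G, ∀ i, g ≠ Tree.leaf i) {I : FinOrd} {p : ℕ}
    {a : (inclusionExclusion k G).obj I} (ha : a ∈ (inclusionExclusion k G).deg I p)
    (hd : (inclusionExclusion k G).d I a = 0) (h0 : augmentation I a = 0) :
    a ∈ (inclusionExclusion k G).boundaries I p := by
  obtain ⟨T, hT⟩ := eq_sum_marked a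
  rw [hT]
  refine Submodule.sum_mem _ fun t _ => ?_
  rcases isEmpty_or_nonempty (t.1.Divisor G) with h | ⟨⟨D⟩⟩
  · rw [eq_algebraMap_of_isEmpty (marks t a), algebraMapInv_marks_eq_zero hG h0 t h, map_zero,
      marked_zero]
    exact Submodule.zero_mem _
  · refine ⟨marked k G t (ExteriorAlgebra.ι k (Finsupp.single D 1) * marks t a),
      marked_mem_deg t ?_, ?_⟩
    · rw [ExteriorAlgebra.exteriorPower, pow_succ']
      exact Submodule.mul_mem_mul ⟨_, rfl⟩ (mem_deg_iff.1 ha t)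
    · rw [d_marked, unmark_ι_mul, ← marks_d, hd, map_zero, mul_zero, sub_zero]

theorem isQuasiIso_augmentationHom (hG : ∀ g ∈ G, g.Canonical)
    (hG' : ∀ g ∈ G, ∀ i, g ≠ Tree.leaf i) :
    (augmentationHom (k := k) hG).IsQuasiIso := by
  intro I p
  constructor
  · rw [injective_iff_map_eq_zero]
    intro x hx
    obtain ⟨⟨a, ha⟩, rfl⟩ := Submodule.Quotient.mk_surjective _ x
    rw [Submodule.Quotient.mk_eq_zero]
    refine mem_boundaries hG' ha.1 ha.2 ?_
    obtain ⟨b, -, hb⟩ := (Submodule.Quotient.mk_eq_zero _).1 hx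
    exact hb.symm
  · intro y
    obtain ⟨⟨q, hq⟩, rfl⟩ := Submodule.Quotient.mk_surjective _ y
    by_cases hp : p = 0
    · subst hp
      obtain ⟨a, ha, rfl⟩ := exists_augmentation_eq q
      exact ⟨Submodule.Quotient.mk ⟨a, ha,
        isDGOperad_inclusionExclusion.d_deg_zero I a ha⟩, rfl⟩
    · refine ⟨0, ?_⟩
      rw [map_zero]
      have : (⟨q, hq⟩ : (monomialOperad k G).cycles I p) = 0 :=
        Subtype.ext ((mem_deg_succ hp).1 hq.1)
      rw [this]
      rfl

end Augmentation
end ShuffleOperad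

namespace ShuffleOperad

/-! ### The basis of marked tree monomials -/

section MarkBasis

variable (k : Type u) [Field k] {D : Type v}

theorem exists_basis_eq_wedge [LinearOrder D] (X : Finset D) :
    ∃ l : List D, l.Nodup ∧ (∀ x, x ∈ l ↔ x ∈ X) ∧
      (Finsupp.basisSingleOne : Module.Basis D k (D →₀ k)).ExteriorAlgebra X = wedge k l := by
  let s := (Set.powersetCard.prodEquiv.symm X).2
  have hs : (s : Finset D) = X := Set.powersetCard.prodEquiv.apply_symm_apply X
  refine ⟨List.ofFn (Set.powersetCard.ofFinEmbEquiv.symm s), ?_, fun x => ?_, ?_⟩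
  · rw [List.nodup_ofFn]
    exact (Set.powersetCard.ofFinEmbEquiv.symm s).injective
  · rw [List.mem_ofFn]
    exact (Set.powersetCard.mem_range_ofFinEmbEquiv_symm_iff_mem s x).trans Iff.rfl
  · refine (ExteriorAlgebra.basis_apply _ X).trans ?_
    change ExteriorAlgebra.ιMulti k _ _ = _
    rw [ExteriorAlgebra.ιMulti_apply, wedge, List.map_ofFn]
    congr 1

open Classical in
/-- The basis of the exterior algebra formed by the wedge products of the finite sets of
generators, each taken in the order of some well-ordering. -/
noncomputable def markBasis (D : Type v) :
    Module.Basis (Finset D) k (ExteriorAlgebra k (D →₀ k)) :=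
  letI : LinearOrder D := linearOrderOfSTO WellOrderingRel
  Module.Basis.ExteriorAlgebra Finsupp.basisSingleOne

theorem exists_markBasis_eq_wedge (X : Finset D) :
    ∃ l : List D, l.Nodup ∧ (∀ x, x ∈ l ↔ x ∈ X) ∧ markBasis k D X = wedge k l := by
  classical
  let : LinearOrder D := linearOrderOfSTO WellOrderingRel
  exact exists_basis_eq_wedge k X

/-- A wedge product of different generators agrees up to a sign with an element of the basis; only
the invertibility of the scalar matters here. -/
theorem exists_wedge_eq_smul {l : List D} (hl : l.Nodup) {X : Finset D}
    (hX : ∀ x, x ∈ l ↔ x ∈ X) : ∃ r : kˣ, wedge k l = r • markBasis k D X := by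
  obtain ⟨l', hl', hX', h⟩ := exists_markBasis_eq_wedge k X
  rw [h]
  exact wedge_perm k ((List.perm_ext_iff_of_nodup hl hl').2 fun x => (hX x).trans (hX' x).symm)

theorem wedge_eq_zero {l : List D} (hl : ¬ l.Nodup) : wedge k l = 0 := by
  classical
  induction l with
  | nil => simp at hl
  | cons x l ih =>
    by_cases hx : x ∈ l
    · obtain ⟨r, hr⟩ := wedge_perm k (List.perm_cons_erase hx)
      rw [wedge_cons, hr, wedge_cons, Units.smul_def, mul_smul_comm, ← mul_assoc,
        ExteriorAlgebra.ι_sq_zero, zero_mul, smul_zero]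
    · rw [wedge_cons, ih fun h => hl (List.nodup_cons.2 ⟨hx, h⟩), mul_zero]

end MarkBasis

section MarkedTree

variable {k : Type u} [Field k] {M : ℕ → Type v} {G : Set (Tree M)}

variable (G) in
/-- Tree monomials with a finite set of marked divisors. -/
abbrev MarkedTree (I : FinOrd) : Type v := Σ t : TreeMonomial M I, Finset (t.1.Divisor G)

theorem support_subset {t : Tree M} (D : t.Divisor G) : D.support ⊆ t.vertices :=
  Tree.IsDivisor.subset_vertices (G := G) D.2

theorem support_nonempty {t : Tree M} (D : t.Divisor G) : D.support.Nonempty :=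
  Tree.IsDivisor.nonempty (G := G) D.2

theorem isDivisor_support {t : Tree M} (D : t.Divisor G) : Tree.IsDivisor G t D.support := D.2

variable (k G) in
/-- The element of the inclusion-exclusion operad corresponding to a marked tree monomial. -/
noncomputable def markedElement (I : FinOrd) (b : MarkedTree G I) :
    (inclusionExclusion k G).obj I :=
  marked k G b.1 (markBasis k _ b.2)

variable (k G) in
/-- The marked tree monomials form a basis of the inclusion-exclusion operad. -/
noncomputable def markedBasis (I : FinOrd) :
    Module.Basis (MarkedTree G I) k ((inclusionExclusion k G).obj I) :=
  Module.Basis.mk (v := markedElement k G I) (by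
    classical
    exact DFinsupp.linearIndependent_single
      (fun t : TreeMonomial M I => (markBasis k (t.1.Divisor G) : _ → _))
      fun t => (markBasis k (t.1.Divisor G)).linearIndependent) (by
    rintro a -
    induction a using marked_induction with
    | h0 => exact Submodule.zero_mem _
    | hm t x =>
      have hx : x ∈ Submodule.span k (Set.range (markBasis k (t.1.Divisor G))) := by
        rw [(markBasis k (t.1.Divisor G)).span_eq]; trivial
      induction hx using Submodule.span_induction with
      | mem x hx =>
        obtain ⟨X, rfl⟩ := hx
        exact Submodule.subset_span ⟨⟨t, X⟩, rfl⟩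
      | zero => rw [marked_zero]; exact Submodule.zero_mem _
      | add x y _ _ hx hy => rw [marked_add]; exact Submodule.add_mem _ hx hy
      | smul r x _ hx => rw [marked_smul]; exact Submodule.smul_mem _ _ hx
    | ha x y hx hy => exact Submodule.add_mem _ hx hy)

theorem markedBasis_apply {I : FinOrd} (b : MarkedTree G I) :
    markedBasis k G I b = marked k G b.1 (markBasis k _ b.2) :=
  Module.Basis.mk_apply _ _ _

theorem exists_monomial_eq_smul {I : FinOrd} (b : MarkedTree G I) {l : List (b.1.1.Divisor G)}
    (hl : l.Nodup) (hX : ∀ x, x ∈ l ↔ x ∈ b.2) :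
    ∃ r : kˣ, monomial k G b.1 l = r • markedBasis k G I b := by
  obtain ⟨r, hr⟩ := exists_wedge_eq_smul k hl hX
  refine ⟨r, ?_⟩
  rw [monomial, hr, Units.smul_def, marked_smul, markedBasis_apply, Units.smul_def]

theorem exists_markedBasis_eq_monomial {I : FinOrd} (b : MarkedTree G I) :
    ∃ l : List (b.1.1.Divisor G), l.Nodup ∧ (∀ x, x ∈ l ↔ x ∈ b.2) ∧
      markedBasis k G I b = monomial k G b.1 l := by
  obtain ⟨l, hl, hX, h⟩ := exists_markBasis_eq_wedge k b.2
  exact ⟨l, hl, hX, by rw [markedBasis_apply, h]; rfl⟩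

namespace MarkedTree

/-- The sets of vertices of the marked divisors. -/
def supports {I : FinOrd} (b : MarkedTree G I) : Finset (Finset (List ℕ)) :=
  b.2.image Tree.Divisor.support

theorem mem_supports {I : FinOrd} {b : MarkedTree G I} {S : Finset (List ℕ)} :
    S ∈ supports b ↔ ∃ D ∈ b.2, D.support = S := by simp [supports]

/-- A marked tree monomial is determined by its tree and the vertex sets of its marked divisors. -/
theorem ext {I : FinOrd} {b c : MarkedTree G I} (h : b.1 = c.1) (h' : supports b = supports c) :
    b = c := by
  obtain ⟨t, X⟩ := b
  obtain ⟨s, Y⟩ := c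
  obtain rfl : t = s := h
  exact congrArg _ (Finset.image_injective Tree.Divisor.support_injective h')

theorem isDivisor_of_mem {I : FinOrd} {b : MarkedTree G I} {S : Finset (List ℕ)}
    (h : S ∈ supports b) : Tree.IsDivisor G b.1.1 S := by
  obtain ⟨D, -, rfl⟩ := mem_supports.1 h
  exact isDivisor_support D

open Classical in
/-- The composition of marked tree monomials. -/
noncomputable def comp {I J K : FinOrd} (h : IsGraft I J K) (b : MarkedTree G I)
    (c : MarkedTree G J) : MarkedTree G K :=
  ⟨b.1.graft h c.1, b.2.image (TreeMonomial.left h b.1 c.1) ∪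
    c.2.image (TreeMonomial.right h b.1 c.1)⟩

open Classical in
/-- The action of order-preserving bijections on marked tree monomials. -/
noncomputable def relabel {I J : FinOrd} (h : I.1.card = J.1.card) (b : MarkedTree G I) :
    MarkedTree G J :=
  ⟨b.1.relabel h, b.2.image (TreeMonomial.rename h b.1)⟩

section Comp

variable {I J K : FinOrd} (h : IsGraft I J K)

theorem left_injective (t : TreeMonomial M I) (s : TreeMonomial M J) :
    Function.Injective (TreeMonomial.left (G := G) h t s) := fun _ _ hD =>
  Tree.Divisor.support_injective (congrArg Tree.Divisor.support hD :)

theorem image_append_injective (a : List ℕ) :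
    Function.Injective (Finset.image (a ++ ·) : Finset (List ℕ) → _) :=
  Finset.image_injective (List.append_right_injective a)

theorem right_injective (t : TreeMonomial M I) (s : TreeMonomial M J) :
    Function.Injective (TreeMonomial.right (G := G) h t s) := fun _ _ hD =>
  Tree.Divisor.support_injective (image_append_injective _
    (congrArg Tree.Divisor.support hD :))

theorem rename_injective (h : I.1.card = J.1.card) (t : TreeMonomial M I) :
    Function.Injective (TreeMonomial.rename (G := G) h t) := fun _ _ hD =>
  Tree.Divisor.support_injective (congrArg Tree.Divisor.support hD :)

/-- The sets of vertices coming from the first and from the second factor of a composition are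
never the same. -/
theorem image_address_not_subset (h : IsGraft I J K) (t : TreeMonomial M I)
    {S : Finset (List ℕ)} (hS : S.Nonempty) :
    ¬ S.image (t.1.address J.least ++ ·) ⊆ t.1.vertices := by
  obtain ⟨x, hx⟩ := hS
  exact fun hsub => Tree.address_append_notMem (t.least_mem_leaves h) x
    (hsub (Finset.mem_image_of_mem _ hx))

theorem left_ne_right (t : TreeMonomial M I) (s : TreeMonomial M J) (D : t.1.Divisor G)
    (D' : s.1.Divisor G) : TreeMonomial.left h t s D ≠ TreeMonomial.right h t s D' := by
  intro hD
  have hD' : D.support = D'.support.image (t.1.address J.least ++ ·) :=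
    congrArg Tree.Divisor.support hD
  exact image_address_not_subset h t (support_nonempty D') (hD' ▸ support_subset D)

theorem supports_comp (b : MarkedTree G I) (c : MarkedTree G J) : supports (comp h b c) =
    supports b ∪ (supports c).image (Finset.image (b.1.1.address J.least ++ ·)) := by
  classical
  simp only [supports, comp, Finset.image_union]
  congr 1
  · rw [Finset.image_image]
    rfl
  · rw [Finset.image_image, Finset.image_image]
    rfl

/-- The marked divisors of the first factor of a composition are the marked divisors of the
composition whose vertices belong to this factor. -/
theorem mem_supports_left {b : MarkedTree G I} {c : MarkedTree G J} {S : Finset (List ℕ)} :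
    S ∈ supports b ↔ S ∈ supports (comp h b c) ∧ S ⊆ b.1.1.vertices := by
  rw [supports_comp, Finset.mem_union]
  refine ⟨fun hS => ⟨Or.inl hS, (isDivisor_of_mem hS).subset_vertices⟩, ?_⟩
  rintro ⟨hS | hS, hS'⟩
  · exact hS
  · obtain ⟨S', hS₁, rfl⟩ := Finset.mem_image.1 hS
    exact absurd hS' (image_address_not_subset h b.1 (isDivisor_of_mem hS₁).nonempty)

theorem mem_supports_right {b : MarkedTree G I} {c : MarkedTree G J} {S : Finset (List ℕ)} :
    S ∈ supports c ↔ S.image (b.1.1.address J.least ++ ·) ∈ supports (comp h b c) := by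
  rw [supports_comp, Finset.mem_union]
  refine ⟨fun hS => Or.inr (Finset.mem_image_of_mem _ hS), ?_⟩
  rintro (hS | hS)
  · have hd := isDivisor_of_mem hS
    exact absurd hd.subset_vertices
      (image_address_not_subset h b.1 (Finset.image_nonempty.1 hd.nonempty))
  · obtain ⟨S', hS₁, hS'⟩ := Finset.mem_image.1 hS
    rwa [← image_append_injective _ hS']

theorem comp_left_cancel {b b' : MarkedTree G I} {c c' : MarkedTree G J} (hb : b.1 = b'.1)
    (hc : comp h b c = comp h b' c') : b = b' :=
  ext hb (by
    ext S
    rw [mem_supports_left h (c := c), hc, hb, ← mem_supports_left])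

theorem comp_right_cancel {b b' : MarkedTree G I} {c c' : MarkedTree G J} (hb : b.1 = b'.1)
    (hcc : c.1 = c'.1) (hc : comp h b c = comp h b' c') : c = c' :=
  ext hcc (by
    ext S
    rw [mem_supports_right h (b := b), hc, hb, ← mem_supports_right])

end Comp

section Assoc

variable {I J K L N R : FinOrd} (h₁ : IsGraft I J K) (h₂ : IsGraft K L N)

theorem comp_assoc (h₃ : IsGraft J L R) (h₄ : IsGraft I R N) (b : MarkedTree G I)
    (c : MarkedTree G J) (d : MarkedTree G L) :
    comp h₂ (comp h₁ b c) d = comp h₄ b (comp h₃ c d) := by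
  refine ext (TreeMonomial.graft_graft h₁ h₂ h₃ h₄ _ _ _) ?_
  have hR : R.least = J.least := by
    rw [← (c.1.graft h₃ d.1).minLeaf_eq, ← c.1.minLeaf_eq]
    exact Tree.minLeaf_graft d.1.minLeaf_eq c.1.1
  have ha : (comp h₁ b c).1.1.address L.least =
      b.1.1.address J.least ++ c.1.1.address L.least :=
    TreeMonomial.address_graft_right h₁ h₃ b.1 c.1
  simp only [supports_comp, Finset.image_union, Finset.image_image, hR, ha, Finset.union_assoc]
  congr 3
  funext S
  simp [Finset.image_image, Function.comp_def]

theorem comp_comm (h₃ : IsGraft I L R) (h₄ : IsGraft R J N) (hJL : J.least ≠ L.least)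
    (b : MarkedTree G I) (c : MarkedTree G J) (d : MarkedTree G L) :
    comp h₂ (comp h₁ b c) d = comp h₄ (comp h₃ b d) c := by
  refine ext (TreeMonomial.graft_comm h₁ h₂ h₃ h₄ hJL _ _ _) ?_
  have ha : (comp h₁ b c).1.1.address L.least = b.1.1.address L.least :=
    TreeMonomial.address_graft_left h₁ h₃ hJL b.1 c.1
  have ha' : (comp h₃ b d).1.1.address J.least = b.1.1.address J.least :=
    TreeMonomial.address_graft_left h₃ h₁ hJL.symm b.1 d.1
  simp only [supports_comp, ha, ha', Finset.union_right_comm]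

end Assoc

end MarkedTree

end MarkedTree
end ShuffleOperad

namespace ShuffleOperad

/-! ### Common refinements of two factorizations -/

section Refine

variable {M : ℕ → Type v}

/-- The conditions on `K` have the form in which the leaves of a graft of trees are computed, see
`Tree.mem_leaves_graft`. -/
theorem IsGraft.of_mem {I J K : FinOrd} (h : J.least ∈ I.1)
    (h' : ∀ x ∈ I.1, x ∈ J.1 → x = J.least)
    (hK : ∀ x, x ∈ K.1 ↔ (x ∈ I.1 ∧ x ≠ J.least) ∨ (J.least ∈ I.1 ∧ x ∈ J.1)) :
    IsGraft I J K := by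
  have hJ := J.least_mem
  constructor
  · ext x
    simp only [Finset.mem_inter, Finset.mem_singleton]
    grind
  · ext x
    simp only [Finset.mem_union, hK]
    grind

/-- The tree `t`, with the set of its leaves, as a tree monomial. -/
def Tree.Canonical.toMonomial {t : Tree M} (ht : t.Canonical) :
    TreeMonomial M ⟨t.leaves, t.leaves_nonempty⟩ := ⟨t, ht, rfl⟩

/-- If the two given decompositions of `K` come from nested cuts of a tree, the tree `y` between the
two cuts is a tree monomial which can be composed with `b'` and with `c`. -/
theorem IsGraft.of_nested {I J I' J' K : FinOrd} (h : IsGraft I J K) (h' : IsGraft I' J' K)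
    {b : TreeMonomial M I} {c : TreeMonomial M J} {b' : TreeMonomial M I'}
    {c' : TreeMonomial M J'} {y : Tree M} (hj : J.least ∈ y.leaves)
    (hb : b.1 = Tree.graft y J'.least b'.1) (hc : c'.1 = Tree.graft c.1 J.least y) :
    ∃ (L : FinOrd) (z : TreeMonomial M L) (g : IsGraft I' L I) (g' : IsGraft L J J'),
      z.1 = y ∧ b = b'.graft g z ∧ c' = z.graft g' c := by
  have hy : y.Canonical := Tree.Canonical.of_graft c.minLeaf_eq (hc ▸ c'.2.1)
  have hmin : y.minLeaf = J'.least := by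
    rw [← c'.minLeaf_eq, hc, Tree.minLeaf_graft c.minLeaf_eq]
  have hL : FinOrd.least ⟨y.leaves, y.leaves_nonempty⟩ = J'.least := hmin
  have hyJ : ∀ x ∈ y.leaves, x ∈ J'.1 := fun x hx => by
    rw [← c'.2.2, hc]
    exact Tree.leaves_subset_graft c.minLeaf_eq hx
  have hI : ∀ x, x ∈ I.1 ↔ (x ∈ I'.1 ∧ x ≠ J'.least) ∨ (J'.least ∈ I'.1 ∧ x ∈ y.leaves) :=
    fun x => by rw [← b.2.2, hb, Tree.mem_leaves_graft, b'.2.2]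
  have hJ : ∀ x, x ∈ J'.1 ↔ (x ∈ y.leaves ∧ x ≠ J.least) ∨ (J.least ∈ y.leaves ∧ x ∈ J.1) :=
    fun x => by rw [← c'.2.2, hc, Tree.mem_leaves_graft, c.2.2]
  have g : IsGraft I' ⟨y.leaves, y.leaves_nonempty⟩ I :=
    .of_mem (hL ▸ h'.least_mem) (fun x hx hx' => by rw [hL]; exact h'.eq_least hx (hyJ x hx'))
      (by simpa only [hL] using hI)
  have g' : IsGraft ⟨y.leaves, y.leaves_nonempty⟩ J J' :=
    .of_mem hj (fun x hx hx' => h.eq_least (g.subset_right hx) hx') hJ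
  refine ⟨_, hy.toMonomial, g, g', rfl, Subtype.ext ?_, Subtype.ext hc⟩
  rw [hb, ← hL]
  rfl

/-- If the two given decompositions of `K` come from independent cuts of a tree, the tree `x`
outside of the two parts cut off is a tree monomial which can be composed with `c'` and with `c`. -/
theorem IsGraft.of_parallel {I J I' J' K : FinOrd} (h : IsGraft I J K) (h' : IsGraft I' J' K)
    {b : TreeMonomial M I} {c : TreeMonomial M J} {b' : TreeMonomial M I'}
    {c' : TreeMonomial M J'} {x : Tree M} (hj : J.least ∈ x.leaves) (hj' : J'.least ∈ x.leaves)
    (hb : b.1 = Tree.graft c'.1 J'.least x) (hb' : b'.1 = Tree.graft c.1 J.least x) :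
    ∃ (L : FinOrd) (z : TreeMonomial M L) (g : IsGraft L J' I) (g' : IsGraft L J I'),
      z.1 = x ∧ b = z.graft g c' ∧ b' = z.graft g' c := by
  have hx : x.Canonical := Tree.Canonical.of_graft c.minLeaf_eq (hb' ▸ b'.2.1)
  have hI : ∀ z, z ∈ I.1 ↔ (z ∈ x.leaves ∧ z ≠ J'.least) ∨ (J'.least ∈ x.leaves ∧ z ∈ J'.1) :=
    fun z => by rw [← b.2.2, hb, Tree.mem_leaves_graft, c'.2.2]
  have hI' : ∀ z, z ∈ I'.1 ↔ (z ∈ x.leaves ∧ z ≠ J.least) ∨ (J.least ∈ x.leaves ∧ z ∈ J.1) :=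
    fun z => by rw [← b'.2.2, hb', Tree.mem_leaves_graft, c.2.2]
  have hxI : ∀ z ∈ x.leaves, z ∈ I.1 := fun z hz => by
    rw [← b.2.2, hb]
    exact Tree.leaves_subset_graft c'.minLeaf_eq hz
  have hxI' : ∀ z ∈ x.leaves, z ∈ I'.1 := fun z hz => by
    rw [← b'.2.2, hb']
    exact Tree.leaves_subset_graft c.minLeaf_eq hz
  exact ⟨_, hx.toMonomial, .of_mem hj' (fun z hz hz' => h'.eq_least (hxI' z hz) hz') hI,
    .of_mem hj (fun z hz hz' => h.eq_least (hxI z hz) hz') hI', rfl, Subtype.ext hb,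
    Subtype.ext hb'⟩

/-- The relative positions of two factorizations of a tree monomial. -/
theorem TreeMonomial.graft_eq_graft {I J I' J' K : FinOrd} (h : IsGraft I J K)
    (h' : IsGraft I' J' K) (b : TreeMonomial M I) (c : TreeMonomial M J) (b' : TreeMonomial M I')
    (c' : TreeMonomial M J') (h0 : b.1.vertices.card ≠ 0) (h0' : b'.1.vertices.card ≠ 0)
    (e : b.graft h c = b'.graft h' c') :
    (I = I' ∧ J = J' ∧ HEq b b' ∧ HEq c c') ∨
    (∃ (L : FinOrd) (y : TreeMonomial M L) (g : IsGraft I' L I) (g' : IsGraft L J J'),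
      y.1.vertices.card ≠ 0 ∧ b = b'.graft g y ∧ c' = y.graft g' c) ∨
    (∃ (L : FinOrd) (y : TreeMonomial M L) (g : IsGraft I L I') (g' : IsGraft L J' J),
      y.1.vertices.card ≠ 0 ∧ b' = b.graft g y ∧ c = y.graft g' c') ∨
    (∃ (L : FinOrd) (x : TreeMonomial M L) (g : IsGraft L J' I) (g' : IsGraft L J I'),
      J.least ≠ J'.least ∧ x.1.vertices.card ≠ 0 ∧ b = x.graft g c' ∧ b' = x.graft g' c) := by
  rcases Tree.graft_eq_graft c.minLeaf_eq c'.minLeaf_eq b.2.1 b'.2.1 (b.least_mem_leaves h)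
    (b'.least_mem_leaves h') h0 h0' (congrArg Subtype.val e) with
    ⟨h1, h2⟩ | ⟨y, hy, hj, h1, h2⟩ | ⟨y, hy, hj, h1, h2⟩ | ⟨x, hx, hj, hj', hjj, h1, h2⟩
  · have hI : I = I' := Subtype.ext (by rw [← b.2.2, h1, b'.2.2])
    have hJ : J = J' := Subtype.ext (by rw [← c.2.2, h2, c'.2.2])
    subst hI hJ
    exact Or.inl ⟨rfl, rfl, heq_of_eq (Subtype.ext h1), heq_of_eq (Subtype.ext h2)⟩
  · obtain ⟨L, z, g, g', rfl, hb, hc⟩ := IsGraft.of_nested h h' hj h1 h2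
    exact Or.inr (Or.inl ⟨L, z, g, g', hy, hb, hc⟩)
  · obtain ⟨L, z, g, g', rfl, hb, hc⟩ := IsGraft.of_nested h' h hj h1 h2
    exact Or.inr (Or.inr (Or.inl ⟨L, z, g, g', hy, hb, hc⟩))
  · obtain ⟨L, z, g, g', rfl, hb, hc⟩ := IsGraft.of_parallel h h' hj hj' h1 h2
    exact Or.inr (Or.inr (Or.inr ⟨L, z, g, g', hjj, hx, hb, hc⟩))

end Refine

namespace MarkedTree

variable {M : ℕ → Type v} {G : Set (Tree M)} {I J K : FinOrd}

/-- If the tree of `b` is composite, and the marked divisors of `b` are those of `p` and some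
divisors of the second factor, then `b` is composite. -/
theorem exists_comp_right (h : IsGraft I J K) (b : MarkedTree G K) (p : MarkedTree G I)
    (y : TreeMonomial M J) (hb : b.1 = p.1.graft h y)
    (hp : ∀ S ∈ supports p, S ∈ supports b)
    (hS : ∀ S ∈ supports b, S ∈ supports p ∨
      ∃ S', S' ⊆ y.1.vertices ∧ S = S'.image (p.1.1.address J.least ++ ·)) :
    ∃ c : MarkedTree G J, c.1 = y ∧ b = comp h p c := by
  classical
  obtain ⟨t, X⟩ := b
  subst hb
  refine ⟨⟨y, X.preimage (TreeMonomial.right h p.1 y) (right_injective h _ _).injOn⟩, rfl,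
    ext rfl ?_⟩
  ext S
  rw [supports_comp, Finset.mem_union]
  constructor
  · intro hSX
    refine (hS S hSX).imp_right ?_
    rintro ⟨S', hS', rfl⟩
    obtain ⟨D, hD, hDS⟩ := mem_supports.1 hSX
    have hd : Tree.IsDivisor G y.1 S' := Tree.IsDivisor.of_graft_right
      (p.1.least_mem_leaves h) (isDivisor_of_mem hSX) hS'
    have hD' : D = TreeMonomial.right h p.1 y ⟨S', hd⟩ := Tree.Divisor.support_injective hDS
    have hX : TreeMonomial.right h p.1 y ⟨S', hd⟩ ∈ X := hD' ▸ hD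
    exact Finset.mem_image_of_mem _ (mem_supports.2
      ⟨⟨S', hd⟩, (Finset.mem_preimage
        (hf := Function.Injective.injOn (right_injective h _ _))).2 hX, rfl⟩)
  · rintro (hS₁ | hS₁)
    · exact hp S hS₁
    · obtain ⟨S', hS', rfl⟩ := Finset.mem_image.1 hS₁
      obtain ⟨D, hD, rfl⟩ := mem_supports.1 hS'
      exact mem_supports.2 ⟨_,
        (Finset.mem_preimage (hf := Function.Injective.injOn (right_injective h _ _))).1 hD, rfl⟩

/-- If the tree of `b` is composite, and the marked divisors of `b` are some divisors of the first
factor and those of `c`, then `b` is composite. -/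
theorem exists_comp_left (h : IsGraft I J K) (b : MarkedTree G K) (x : TreeMonomial M I)
    (c : MarkedTree G J) (hb : b.1 = x.graft h c.1)
    (hc : ∀ S ∈ supports c, S.image (x.1.address J.least ++ ·) ∈ supports b)
    (hS : ∀ S ∈ supports b, S ⊆ x.1.vertices ∨
      ∃ S' ∈ supports c, S = S'.image (x.1.address J.least ++ ·)) :
    ∃ p : MarkedTree G I, p.1 = x ∧ b = comp h p c := by
  classical
  obtain ⟨t, X⟩ := b
  subst hb
  refine ⟨⟨x, X.preimage (TreeMonomial.left h x c.1) (left_injective h _ _).injOn⟩, rfl,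
    ext rfl ?_⟩
  ext S
  rw [supports_comp, Finset.mem_union]
  constructor
  · intro hSX
    refine (hS S hSX).imp (fun hS' => ?_) fun ⟨S', hS', e⟩ => e ▸ Finset.mem_image_of_mem _ hS'
    obtain ⟨D, hD, hDS⟩ := mem_supports.1 hSX
    have hd : Tree.IsDivisor G x.1 S := Tree.IsDivisor.of_graft_left
      c.1.minLeaf_eq (isDivisor_of_mem hSX) hS'
    have hD' : D = TreeMonomial.left h x c.1 ⟨S, hd⟩ := Tree.Divisor.support_injective hDS
    have hX : TreeMonomial.left h x c.1 ⟨S, hd⟩ ∈ X := hD' ▸ hD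
    exact mem_supports.2 ⟨⟨S, hd⟩, (Finset.mem_preimage
      (hf := Function.Injective.injOn (left_injective h _ _))).2 hX, rfl⟩
  · rintro (hS₁ | hS₁)
    · obtain ⟨D, hD, rfl⟩ := mem_supports.1 hS₁
      exact mem_supports.2 ⟨_,
        (Finset.mem_preimage (hf := Function.Injective.injOn (left_injective h _ _))).1 hD, rfl⟩
    · obtain ⟨S', hS', rfl⟩ := Finset.mem_image.1 hS₁
      exact hc S' hS'

/-- A composite with the first factor `b` and a composite with the second factor `c'`, where the
tree of `b` is the composite of the tree of `b'` and a tree `y`, have a common refinement. -/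
theorem refine_nested {I' J' L : FinOrd} (h : IsGraft I J K) (h' : IsGraft I' J' K)
    {b : MarkedTree G I} {c : MarkedTree G J} {b' : MarkedTree G I'} {c' : MarkedTree G J'}
    (e : comp h b c = comp h' b' c') (g : IsGraft I' L I) (g' : IsGraft L J J')
    (y : TreeMonomial M L) (hb : b.1 = b'.1.graft g y) (hc : c'.1 = y.graft g' c.1) :
    ∃ z : MarkedTree G L, z.1 = y ∧ b = comp g b' z ∧ c' = comp g' z c := by
  have hL : L.least = J'.least := by
    rw [← y.minLeaf_eq, ← c'.1.minLeaf_eq, hc]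
    exact (Tree.minLeaf_graft c.1.minLeaf_eq _).symm
  have hbv : ∀ v, v ∈ b.1.1.vertices ↔ v ∈ b'.1.1.vertices ∨
      ∃ x ∈ y.1.vertices, b'.1.1.address L.least ++ x = v := fun v => by
    rw [hb]
    exact Tree.mem_vertices_graft b'.1.2.1 (b'.1.least_mem_leaves g)
  suffices hex : ∃ z : MarkedTree G L, z.1 = y ∧ b = comp g b' z by
    obtain ⟨z, rfl, hz⟩ := hex
    refine ⟨z, rfl, hz, ?_⟩
    have hR := comp_assoc g h g' h' b' z c
    rw [← hz, e] at hR
    exact comp_right_cancel h' rfl hc hR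
  refine exists_comp_right g b b' y hb (fun S hS => ?_) fun S hS => ?_
  -- A marked divisor of `b'` has its vertices in the tree of `b`.
  · have := ((mem_supports_left h' (c := c')).1 hS)
    rw [← e] at this
    exact (mem_supports_left h (c := c)).2
      ⟨this.1, fun v hv => (hbv v).2 (Or.inl (this.2 hv))⟩
  -- A marked divisor of `b` is one of `b'` or of `c'`, and in the second case it lies in `y`.
  · have h1 := ((mem_supports_left h (c := c)).1 hS)
    rw [e, supports_comp, Finset.mem_union] at h1
    refine h1.1.imp_right fun h2 => ?_
    obtain ⟨S', -, rfl⟩ := Finset.mem_image.1 h2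
    refine ⟨S', fun v hv => ?_, by rw [hL]⟩
    rcases (hbv _).1 (h1.2 (Finset.mem_image_of_mem _ hv)) with h3 | ⟨x, hx, hxv⟩
    · exact absurd h3 (Tree.address_append_notMem (b'.1.least_mem_leaves h') v)
    · rw [hL] at hxv
      rwa [← List.append_cancel_left hxv]

/-- Two composites, whose first factors have trees obtained from a tree `x` by insertions in
different inputs, have a common refinement. -/
theorem refine_parallel {I' J' L : FinOrd} (h : IsGraft I J K) (h' : IsGraft I' J' K)
    {b : MarkedTree G I} {c : MarkedTree G J} {b' : MarkedTree G I'} {c' : MarkedTree G J'}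
    (e : comp h b c = comp h' b' c') (g : IsGraft L J' I) (g' : IsGraft L J I')
    (hJ : J.least ≠ J'.least)
    (x : TreeMonomial M L) (hb : b.1 = x.graft g c'.1) (hb' : b'.1 = x.graft g' c.1) :
    ∃ z : MarkedTree G L, z.1 = x ∧ b = comp g z c' ∧ b' = comp g' z c := by
  have ha' : b'.1.1.address J'.least = x.1.address J'.least := by
    rw [hb']; exact TreeMonomial.address_graft_left g' g hJ x c.1
  have ha : b.1.1.address J.least = x.1.address J.least := by
    rw [hb]; exact TreeMonomial.address_graft_left g g' hJ.symm x c'.1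
  have hbv : ∀ v, v ∈ b.1.1.vertices ↔ v ∈ x.1.vertices ∨
      ∃ y ∈ c'.1.1.vertices, x.1.address J'.least ++ y = v := fun v => by
    rw [hb]
    exact Tree.mem_vertices_graft x.2.1 (x.least_mem_leaves g)
  have hbv' : ∀ v, v ∈ b'.1.1.vertices ↔ v ∈ x.1.vertices ∨
      ∃ y ∈ c.1.1.vertices, x.1.address J.least ++ y = v := fun v => by
    rw [hb']
    exact Tree.mem_vertices_graft x.2.1 (x.least_mem_leaves g')
  suffices hex : ∃ z : MarkedTree G L, z.1 = x ∧ b = comp g z c' by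
    obtain ⟨z, rfl, hz⟩ := hex
    refine ⟨z, rfl, hz, ?_⟩
    have hR := comp_comm g h g' h' hJ.symm z c' c
    rw [← hz, e] at hR
    exact comp_left_cancel h' hb' hR
  refine exists_comp_left g b x c' hb (fun S hS => ?_) fun S hS => ?_
  · have h1 := (mem_supports_right h' (b := b')).1 hS
    rw [← e, ha'] at h1
    refine (mem_supports_left h (c := c)).2 ⟨h1, fun v hv => ?_⟩
    obtain ⟨u, hu, rfl⟩ := Finset.mem_image.1 hv
    exact (hbv _).2 (Or.inr ⟨u, (isDivisor_of_mem hS).subset_vertices hu, rfl⟩)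
  · have h1 := ((mem_supports_left h (c := c)).1 hS)
    rw [e, supports_comp, Finset.mem_union] at h1
    rcases h1.1 with h2 | h2
    · refine Or.inl fun v hv => ((hbv' v).1 ((isDivisor_of_mem h2).subset_vertices hv)).elim id ?_
      rintro ⟨y, -, rfl⟩
      have h3 := h1.2 hv
      rw [← ha] at h3
      exact absurd h3 (Tree.address_append_notMem (b.1.least_mem_leaves h) y)
    · obtain ⟨S', hS', rfl⟩ := Finset.mem_image.1 h2
      exact Or.inr ⟨S', hS', by rw [ha']⟩

/-- The relative positions of two factorizations of a marked tree monomial. As a marked divisor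
is never cut by either of the factorizations, it lies in one of the parts of their common
refinement. -/
theorem comp_eq_comp {I' J' : FinOrd} (h : IsGraft I J K) (h' : IsGraft I' J' K)
    (b : MarkedTree G I) (c : MarkedTree G J) (b' : MarkedTree G I') (c' : MarkedTree G J')
    (h0 : b.1.1.vertices.card ≠ 0) (h0' : b'.1.1.vertices.card ≠ 0)
    (e : comp h b c = comp h' b' c') :
    (I = I' ∧ J = J' ∧ HEq b b' ∧ HEq c c') ∨
    (∃ (L : FinOrd) (y : MarkedTree G L) (g : IsGraft I' L I) (g' : IsGraft L J J'),
      y.1.1.vertices.card ≠ 0 ∧ b = comp g b' y ∧ c' = comp g' y c) ∨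
    (∃ (L : FinOrd) (y : MarkedTree G L) (g : IsGraft I L I') (g' : IsGraft L J' J),
      y.1.1.vertices.card ≠ 0 ∧ b' = comp g b y ∧ c = comp g' y c') ∨
    (∃ (L : FinOrd) (x : MarkedTree G L) (g : IsGraft L J' I) (g' : IsGraft L J I'),
      J.least ≠ J'.least ∧ x.1.1.vertices.card ≠ 0 ∧ b = comp g x c' ∧ b' = comp g' x c) := by
  rcases TreeMonomial.graft_eq_graft h h' b.1 c.1 b'.1 c'.1 h0 h0' (congrArg Sigma.fst e) with
    ⟨rfl, rfl, h1, h2⟩ | ⟨L, y, g, g', hy, h1, h2⟩ | ⟨L, y, g, g', hy, h1, h2⟩ |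
    ⟨L, x, g, g', hj, hx, h1, h2⟩
  · have h1 := eq_of_heq h1
    have h2 := eq_of_heq h2
    exact Or.inl ⟨rfl, rfl, heq_of_eq (comp_left_cancel h h1 e),
      heq_of_eq (comp_right_cancel h h1 h2 e)⟩
  · obtain ⟨z, rfl, hb, hc⟩ := refine_nested h h' e g g' y h1 h2
    exact Or.inr (Or.inl ⟨L, z, g, g', hy, hb, hc⟩)
  · obtain ⟨z, rfl, hb, hc⟩ := refine_nested h' h e.symm g g' y h1 h2
    exact Or.inr (Or.inr (Or.inl ⟨L, z, g, g', hy, hb, hc⟩))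
  · obtain ⟨z, rfl, hb, hc⟩ := refine_parallel h h' e g g' hj x h1 h2
    exact Or.inr (Or.inr (Or.inr ⟨L, z, g, g', hj, hx, hb, hc⟩))

end MarkedTree
end ShuffleOperad

namespace ShuffleOperad

/-! ### Freeness of the inclusion-exclusion operad -/

section Free

variable {k : Type u} [Field k] {M : ℕ → Type v} {G : Set (Tree M)}

theorem deg_eq_span_markedBasis (I : FinOrd) (p : ℕ) : (inclusionExclusion k G).deg I p =
    Submodule.span k (markedBasis k G I '' {b | b.2.card = p}) := by
  classical
  rw [deg_eq_span]
  apply le_antisymm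
  · rw [Submodule.span_le]
    rintro _ ⟨t, l, hl, rfl⟩
    by_cases hn : l.Nodup
    · obtain ⟨r, hr⟩ := exists_monomial_eq_smul (k := k) ⟨t, l.toFinset⟩ hn
        fun x => List.mem_toFinset.symm
      have hr' : monomial k G t l = (r : k) • markedBasis k G I ⟨t, l.toFinset⟩ := hr
      rw [hr']
      exact Submodule.smul_mem _ _ (Submodule.subset_span
        ⟨_, (List.toFinset_card_of_nodup hn).trans hl, rfl⟩)
    · rw [monomial, wedge_eq_zero k hn, marked_zero]
      exact Submodule.zero_mem _
  · rw [Submodule.span_le]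
    rintro _ ⟨b, hb, rfl⟩
    obtain ⟨l, hl, hX, h⟩ := exists_markedBasis_eq_monomial (k := k) b
    rw [h]
    refine Submodule.subset_span ⟨b.1, l, ?_, rfl⟩
    rw [← List.toFinset_card_of_nodup hl, ← show b.2.card = p from hb]
    congr 1
    ext x
    rw [List.mem_toFinset, hX]

namespace MarkedTree

/-- The degenerate tree, without marks. -/
def one (i : ℕ) : MarkedTree G (FinOrd.single i) := ⟨TreeMonomial.one i, ∅⟩

theorem markedBasis_one (i : ℕ) :
    markedBasis k G _ (one i) = (inclusionExclusion k G).one i := by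
  obtain ⟨l, -, hX, h⟩ := exists_markedBasis_eq_monomial (k := k) (one (G := G) i)
  have hl : l = [] := List.eq_nil_iff_forall_not_mem.2 fun x hx =>
    absurd ((hX x).1 hx) (Finset.notMem_empty x)
  rw [h, hl, one_eq_monomial]
  rfl

/-- The degenerate tree has no vertices, and hence no divisors to be marked. -/
theorem eq_one {I : FinOrd} (b : MarkedTree G I) (hb : b.1.1.vertices.card = 0) :
    ∃ i, I = FinOrd.single i ∧ HEq b (one (G := G) i) := by
  obtain ⟨⟨t, ht, rfl'⟩, X⟩ := b
  obtain ⟨i, rfl⟩ := Tree.card_vertices_eq_zero.1 hb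
  obtain rfl : I = FinOrd.single i := Subtype.ext rfl'.symm
  refine ⟨i, rfl, heq_of_eq (ext rfl ?_)⟩
  have h : ∀ (c : MarkedTree G (FinOrd.single i)), c.1.1 = Tree.leaf i → supports c = ∅ := by
    refine fun c hc => Finset.eq_empty_of_forall_notMem fun S hS => ?_
    have hd := isDivisor_of_mem hS
    rw [hc] at hd
    obtain ⟨x, hx⟩ := hd.nonempty
    exact absurd (hd.subset_vertices hx) (Finset.notMem_empty x)
  rw [h _ rfl, h _ rfl]

theorem card_comp {I J K : FinOrd} (h : IsGraft I J K) (b : MarkedTree G I)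
    (c : MarkedTree G J) : (comp h b c).2.card = b.2.card + c.2.card := by
  classical
  refine (Finset.card_union_of_disjoint ?_).trans (congrArg₂ _
    (Finset.card_image_of_injective _ (left_injective h _ _))
    (Finset.card_image_of_injective _ (right_injective h _ _)))
  refine Finset.disjoint_left.2 fun x hx hx' => ?_
  obtain ⟨D, -, rfl⟩ := Finset.mem_image.1 hx
  obtain ⟨D', -, h'⟩ := Finset.mem_image.1 hx'
  exact left_ne_right h _ _ _ _ h'.symm

theorem markedBasis_comp {I J K : FinOrd} (h : IsGraft I J K) (b : MarkedTree G I)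
    (c : MarkedTree G J) : ∃ r : kˣ,
      (inclusionExclusion k G).comp h (markedBasis k G I b) (markedBasis k G J c) =
        r • markedBasis k G K (comp h b c) := by
  classical
  obtain ⟨l, hl, hX, hb⟩ := exists_markedBasis_eq_monomial (k := k) b
  obtain ⟨l', hl', hX', hc⟩ := exists_markedBasis_eq_monomial (k := k) c
  rw [hb, hc, comp_monomial]
  refine exists_monomial_eq_smul (comp h b c) ?_ fun x => ?_
  · refine List.Nodup.append (hl.map (left_injective h _ _)) (hl'.map (right_injective h _ _)) ?_
    intro x hx hx'
    obtain ⟨D, -, rfl⟩ := List.mem_map.1 hx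
    obtain ⟨D', -, h'⟩ := List.mem_map.1 hx'
    exact left_ne_right h _ _ _ _ h'.symm
  · refine List.mem_append.trans (Iff.trans ?_ Finset.mem_union.symm)
    refine or_congr (List.mem_map.trans (Iff.trans ?_ Finset.mem_image.symm))
      (List.mem_map.trans (Iff.trans ?_ Finset.mem_image.symm))
    · simp only [hX]
    · simp only [hX']

theorem markedBasis_relabel {I J : FinOrd} (h : I.1.card = J.1.card) (b : MarkedTree G I) :
    ∃ r : kˣ, (inclusionExclusion k G).relabel h (markedBasis k G I b) =
      r • markedBasis k G J (relabel h b) := by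
  classical
  obtain ⟨l, hl, hX, hb⟩ := exists_markedBasis_eq_monomial (k := k) b
  rw [hb, relabel_monomial]
  refine exists_monomial_eq_smul (relabel h b) (hl.map (rename_injective h _)) fun x => ?_
  refine List.mem_map.trans (Iff.trans ?_ Finset.mem_image.symm)
  simp only [hX]

end MarkedTree

variable (k G) in
/-- The marked tree monomials, with the number of vertices as the size. -/
noncomputable def factorizationBasis :
    FactorizationBasis.{u, v, max u v} (inclusionExclusion k G).toGradedData where
  Mon := MarkedTree G
  basis := markedBasis k G
  deg b := b.2.card
  size b := b.1.1.vertices.card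
  comp := MarkedTree.comp
  relabel := MarkedTree.relabel
  deg_eq := deg_eq_span_markedBasis
  exists_one i := ⟨MarkedTree.one i, rfl, MarkedTree.markedBasis_one i⟩
  eq_one b hb := by
    obtain ⟨i, rfl, h⟩ := MarkedTree.eq_one b hb
    obtain rfl := eq_of_heq h
    exact ⟨rfl, i, rfl, heq_of_eq (MarkedTree.markedBasis_one i)⟩
  deg_comp := MarkedTree.card_comp
  size_comp h b c := Tree.card_vertices_graft b.1.2.1 (b.1.least_mem_leaves h)
  deg_relabel h b := by
    classical
    exact Finset.card_image_of_injective _ (MarkedTree.rename_injective h b.1)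
  size_relabel h b := congrArg Finset.card (Tree.vertices_mapLeaves _ _)
  basis_comp := MarkedTree.markedBasis_comp
  basis_relabel := MarkedTree.markedBasis_relabel
  refine h h' b c b' c' hb _ hb' _ e := MarkedTree.comp_eq_comp h h' b c b' c' hb hb' e

end Free

end ShuffleOperad

theorem mainTheorem1 {k : Type u} [Field k] {M : ℕ → Type v} (G : Set (ShuffleOperad.Tree M))
    (hG : ∀ g ∈ G, g.Canonical ∧ (∃ n, g.leaves = Finset.Icc 1 n) ∧
      ∀ i, g ≠ ShuffleOperad.Tree.leaf i) :
    ShuffleOperad.IsDGOperad (ShuffleOperad.inclusionExclusion k G) ∧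
    ShuffleOperad.IsDGOperad (ShuffleOperad.monomialOperad k G) ∧
    ShuffleOperad.IsFree.{u, max u v, w} (ShuffleOperad.inclusionExclusion k G).toGradedData ∧
    ∃ φ : ShuffleOperad.DGHom (ShuffleOperad.inclusionExclusion k G)
        (ShuffleOperad.monomialOperad k G),
      (∀ (I : ShuffleOperad.FinOrd) (t : ShuffleOperad.TreeMonomial M I),
        φ.toFun I (ShuffleOperad.marked k G t 1) = ShuffleOperad.monomialClass k G t) ∧
      φ.IsQuasiIso := by
  have hG₁ : ∀ g ∈ G, g.Canonical := fun g hg => (hG g hg).1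
  refine ⟨ShuffleOperad.isDGOperad_inclusionExclusion, ShuffleOperad.isDGOperad_monomialOperad,
    (ShuffleOperad.factorizationBasis k G).isFree
      ShuffleOperad.isGradedOperad_inclusionExclusion,
    ShuffleOperad.augmentationHom hG₁, fun I t => ?_,
    ShuffleOperad.isQuasiIso_augmentationHom hG₁ fun g hg => (hG g hg).2.2⟩
  exact (ShuffleOperad.augmentation_marked t 1).trans (by rw [map_one, one_smul])
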